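/- **Setting.** Let $d\in\mathbb N$, let $\Omega\subset\mathbb R^d$ be a bounded open set, and let $T>0$. Write $(\cdot,\cdot)$ and $\|\cdot\|$ for the inner product and norm of $L^2(\Omega)$ (and of $L^2(\Omega)^d$), $H^1(\Omega)$ for the space of $z\in L^2(\Omega)$ with weak gradient $\nabla z\in L^2(\Omega)^d$, normed by $(\|z\|^2+\|\nabla z\|^2)^{1/2}$, and $H^1_0(\Omega)$ for the closure of $C_c^\infty(\Omega)$ in it. **Assumptions.** Let $\rho,\kappa\in C^1([0,T];L^\infty(\Omega))$ and $\eta\in C([0,T];L^\infty(\Omega))$ satisfy, for all $t\in[0,T]$ and a.e. $x\in\Omega$, $$0<\rho_0\le\rho\le\rho_1,\quad |\partial_t\rho|\le\rho_1',\quad 0<\eta_0\le\eta\le\eta_1,\quad 0<\kappa_0\le\kappa\le\kappa_1,\quad |\partial_t\kappa|\le\kappa_1',$$ with constants $\rho_0,\rho_1,\rho_1',\eta_0,\eta_1,\kappa_0,\kappa_1,\kappa_1'$. Let $f:\mathbb R\to\mathbb R$ be Lipschitz continuous, $\tilde u_0\in H^1_0(\Omega)$, $\rho\in C([0,T];H^1(\Omega))$,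 $\omega\in H^1_0(\Omega)$, $p\in C([0,T];L^2(\Omega))$ and $m\in H^1(0,T)$ (continuous representative). Assume that $\bar\omega(t):=(p(t),\omega/\rho(t))\neq0$ for all $t\in[0,T]$ and put $\bar\omega_m:=\min_{t\in[0,T]}|\bar\omega(t)|$. Assume that $\omega/\rho(t)\in H^1(\Omega)$ for all $t\in[0,T]$, that $M:=\sup_{t\in[0,T]}\|\nabla(\omega/\rho(t))\|<\infty$, and that for some $\zeta\in(0,1)$ $$\|p\|_{C([0,T];L^2(\Omega))}^2\,\frac{M^2\eta_1^2}{4\,\bar\omega_m^2\,\eta_0\,\rho_0}<\zeta .$$ **Weak solution.** Consider the inverse problem of finding $(u,h)$ with $$\partial_t(\rho u)-\nabla\cdot(\eta\nabla\partial_tu)-\nabla\cdot(\kappa\nabla u)=f(u)+p\,h \text{ in }(0,T)\times\Omega,\quad u=0\text{ on }(0,T)\times\partial\Omega,\quad u(0)=\tilde u_0,\quad \int_\Omega u(t)\,\omega\,dx=m(t).$$ A *weak solution* is a couple $(u,h)$ with $u\in C([0,T];H^1_0(\Omega))$, $\partial_tu\in L^2(0,T;H^1_0(\Omega))$, $h\in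 L^2(0,T)$, $u(0)=\tilde u_0$, such that for a.e. $t\in(0,T)$ and all $\varphi\in H^1_0(\Omega)$ $$(\partial_t(\rho u)(t),\varphi)+(\eta(t)\nabla\partial_tu(t),\nabla\varphi)+(\kappa(t)\nabla u(t),\nabla\varphi)=h(t)\,(p(t),\varphi)+(f(u(t)),\varphi),\tag{1}$$ where $\partial_t(\rho u)=(\partial_t\rho)u+\rho\,\partial_tu$, and for a.e. $t\in(0,T)$ $$h(t)=\frac1{\bar\omega(t)}\Big[m'(t)+\Big(u(t),\tfrac{\omega\,\partial_t\rho(t)}{\rho(t)}\Big)+\Big(\eta(t)\nabla\partial_tu(t),\nabla\tfrac{\omega}{\rho(t)}\Big)+\Big(\kappa(t)\nabla u(t),\nabla\tfrac{\omega}{\rho(t)}\Big)-\Big(f(u(t)),\tfrac{\omega}{\rho(t)}\Big)\Big].\tag{2}$$ **Rothe scheme.** For $n\ge1$ put $\tau=T/n$, $t_i=i\tau$, $z_i=z(t_i)$ for the given functions $z$, and $\delta z_i=(z_i-z_{i-1})/\tau$. The discrete problem is to find $u_1,\dots,u_n\in H^1_0(\Omega)$ and $h_1,\dots,h_n\in\mathbb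 R$ such that, with $u_0=\tilde u_0$, for $i=1,\dots,n$ and all $\varphi\in H^1_0(\Omega)$, $$(\delta(\rho_iu_i),\varphi)+(\eta_i\nabla\delta u_i,\nabla\varphi)+(\kappa_i\nabla u_i,\nabla\varphi)=h_i(p_i,\varphi)+(f(u_{i-1}),\varphi),$$ $$h_i=\frac1{\bar\omega_i}\Big[\delta m_i+\Big(u_{i-1},\tfrac{\omega\,\delta\rho_i}{\rho_i}\Big)+\Big(\eta_i\nabla\delta u_i,\nabla\tfrac{\omega}{\rho_i}\Big)+\Big(\kappa_i\nabla u_{i-1},\nabla\tfrac{\omega}{\rho_i}\Big)-\Big(f(u_{i-1}),\tfrac{\omega}{\rho_i}\Big)\Big].$$ The Rothe functions are $U_n(t)=u_{i-1}+(t-t_{i-1})\delta u_i$, $\overline U_n(t)=u_i$, $\overline h_n(t)=h_i$ for $t\in(t_{i-1},t_i]$, and $U_n(0)=\overline U_n(0)=\tilde u_0$. **Theorem.** Under these assumptions: 1. There is exactly one weak solution $(u,h)$: one exists, and any two have the same $u(t)$ for all $t\in[0,T]$ and the same $h$ a.e. in $(0,T)$. 2. A couple $(u,h)$ with $u\in C([0,T];H^1_0(\Omega))$,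 $\partial_tu\in L^2(0,T;H^1_0(\Omega))$, $h\in L^2(0,T)$ and $u(0)=\tilde u_0$ satisfies (1) together with the measurement $\int_\Omega u(t)\omega\,dx=m(t)$ for all $t\in[0,T]$ if and only if it is a weak solution and $\int_\Omega\tilde u_0\,\omega\,dx=m(0)$. 3. For every $n\ge1$ the discrete problem has exactly one solution $(u_i,h_i)_{1\le i\le n}$. 4. As $n\to\infty$, the whole Rothe sequence converges to the weak solution $(u,h)$: $U_n\to u$ in $C([0,T];L^2(\Omega))$; $U_n(t)\rightharpoonup u(t)$ and $\overline U_n(t)\rightharpoonup u(t)$ weakly in $H^1_0(\Omega)$ for every $t\in[0,T]$; $\partial_tU_n\rightharpoonup\partial_tu$ weakly in $L^2(0,T;H^1_0(\Omega))$; and $\overline h_n\rightharpoonup h$ weakly in $L^2(0,T)$. -/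

import Mathlib

open MeasureTheory Set Filter Topology
open scoped ENNReal NNReal

noncomputable section

namespace PseudoParabolic

/-- The Euclidean space `ℝ^d`. -/
abbrev E (d : ℕ) : Type := EuclideanSpace ℝ (Fin d)

/-- `L²(Ω)`. -/
abbrev L2 {d : ℕ} (Ω : Set (E d)) : Type := Lp ℝ 2 (volume.restrict Ω)

/-- `L²(Ω; ℝ^d)`. -/
abbrev L2Vec {d : ℕ} (Ω : Set (E d)) : Type := Lp (E d) 2 (volume.restrict Ω)

/-- `L^∞(Ω)`. -/
abbrev LInf {d : ℕ} (Ω : Set (E d)) : Type := Lp ℝ ∞ (volume.restrict Ω)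

/-- `L²(Ω) × L²(Ω; ℝ^d)` with the Hilbert norm `(‖z‖² + ‖G‖²)^(1/2)`. -/
abbrev L2Pair {d : ℕ} (Ω : Set (E d)) : Type := WithLp 2 (L2 Ω × L2Vec Ω)

/-- Test functions: smooth, with compact support contained in `Ω`. -/
structure IsTest {d : ℕ} (Ω : Set (E d)) (φ : E d → ℝ) : Prop where
  smooth : ContDiff ℝ (⊤ : ℕ∞) φ
  compact : HasCompactSupport φ
  supp : tsupport φ ⊆ Ω

theorem IsTest.integrable_smul_gradient {d : ℕ} {Ω : Set (E d)} {φ : E d → ℝ}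
    (hφ : IsTest Ω φ) (z : L2 Ω) :
    Integrable (fun x => z x • gradient φ x) (volume.restrict Ω) := by
  have hc : Continuous (gradient φ) :=
    (InnerProductSpace.toDual ℝ (E d)).symm.continuous.comp
      (hφ.smooth.continuous_fderiv (by simp))
  have hs : HasCompactSupport (gradient φ) :=
    (hφ.compact.fderiv (𝕜 := ℝ)).comp_left
      (g := (InnerProductSpace.toDual ℝ (E d)).symm) (map_zero _)
  have h1 : MemLp (gradient φ) 2 (volume.restrict Ω) :=
    (hc.memLp_of_hasCompactSupport hs).restrict Ω
  exact memLp_one_iff_integrable.mp (h1.smul (r := 1) (Lp.memLp z))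

theorem IsTest.integrable_smul_vec {d : ℕ} {Ω : Set (E d)} {φ : E d → ℝ}
    (hφ : IsTest Ω φ) (G : L2Vec Ω) :
    Integrable (fun x => φ x • G x) (volume.restrict Ω) := by
  have h1 : MemLp φ 2 (volume.restrict Ω) :=
    (hφ.smooth.continuous.memLp_of_hasCompactSupport hφ.compact).restrict Ω
  exact memLp_one_iff_integrable.mp ((Lp.memLp G).smul (r := 1) h1)

/-- The Sobolev space `H¹(Ω)`: all pairs `(z, G)` in `L²(Ω) × L²(Ω; ℝ^d)` such that `G` is the
weak gradient of `z`, with the norm `(‖z‖² + ‖∇z‖²)^(1/2)`. -/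
def H1 {d : ℕ} (Ω : Set (E d)) : Submodule ℝ (L2Pair Ω) where
  carrier := {z | ∀ φ : E d → ℝ, IsTest Ω φ →
    ∫ x in Ω, z.fst x • gradient φ x = - ∫ x in Ω, φ x • z.snd x}
  zero_mem' := by
    intro φ _
    have h1 : (fun x => (0 : L2Pair Ω).fst x • gradient φ x) =ᵐ[volume.restrict Ω] 0 := by
      filter_upwards [Lp.coeFn_zero ℝ 2 (volume.restrict Ω)] with x hx
      have h : (0 : L2Pair Ω).fst x = 0 := hx
      rw [h, zero_smul, Pi.zero_apply]
    have h2 : (fun x => φ x • (0 : L2Pair Ω).snd x) =ᵐ[volume.restrict Ω] 0 := by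
      filter_upwards [Lp.coeFn_zero (E d) 2 (volume.restrict Ω)] with x hx
      have h : (0 : L2Pair Ω).snd x = 0 := hx
      rw [h, smul_zero, Pi.zero_apply]
    rw [integral_congr_ae h1, integral_congr_ae h2]
    simp
  add_mem' := by
    intro a b ha hb φ hφ
    have h1 : (fun x => (a + b).fst x • gradient φ x) =ᵐ[volume.restrict Ω]
        fun x => a.fst x • gradient φ x + b.fst x • gradient φ x := by
      filter_upwards [Lp.coeFn_add a.fst b.fst] with x hx
      have : (a + b).fst x = a.fst x + b.fst x := hx
      rw [this, add_smul]
    have h2 : (fun x => φ x • (a + b).snd x) =ᵐ[volume.restrict Ω]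
        fun x => φ x • a.snd x + φ x • b.snd x := by
      filter_upwards [Lp.coeFn_add a.snd b.snd] with x hx
      have : (a + b).snd x = a.snd x + b.snd x := hx
      rw [this, smul_add]
    rw [integral_congr_ae h1, integral_congr_ae h2,
      integral_add (hφ.integrable_smul_gradient _) (hφ.integrable_smul_gradient _),
      integral_add (hφ.integrable_smul_vec _) (hφ.integrable_smul_vec _), ha φ hφ, hb φ hφ,
      neg_add]
  smul_mem' := by
    intro c a ha φ hφ
    have h1 : (fun x => (c • a).fst x • gradient φ x) =ᵐ[volume.restrict Ω]
        fun x => c • (a.fst x • gradient φ x) := by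
      filter_upwards [Lp.coeFn_smul c a.fst] with x hx
      have : (c • a).fst x = c • a.fst x := hx
      rw [this, smul_assoc]
    have h2 : (fun x => φ x • (c • a).snd x) =ᵐ[volume.restrict Ω]
        fun x => c • (φ x • a.snd x) := by
      filter_upwards [Lp.coeFn_smul c a.snd] with x hx
      have : (c • a).snd x = c • a.snd x := hx
      rw [this, smul_comm]
    rw [integral_congr_ae h1, integral_congr_ae h2, integral_smul, integral_smul, ha φ hφ,
      smul_neg]

/-- The Sobolev space `H¹₀(Ω)`: the closure in the `H¹` norm of the set of all `(φ, ∇φ)` with `φ`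
a test function. An element is a pair consisting of a function and its weak gradient. -/
def H10 {d : ℕ} (Ω : Set (E d)) : Submodule ℝ (L2Pair Ω) :=
  (Submodule.span ℝ {z : L2Pair Ω | ∃ φ : E d → ℝ, IsTest Ω φ ∧
    z.fst =ᵐ[volume.restrict Ω] φ ∧ z.snd =ᵐ[volume.restrict Ω] gradient φ}).topologicalClosure

/-- An element of `H¹₀(Ω)` as an element of `L²(Ω)`. -/
def val {d : ℕ} {Ω : Set (E d)} (u : H10 Ω) : L2 Ω := (u : L2Pair Ω).fst

/-- The weak gradient of an element of `H¹₀(Ω)`. -/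
def grad {d : ℕ} {Ω : Set (E d)} (u : H10 Ω) : L2Vec Ω := (u : L2Pair Ω).snd

open Classical in
/-- The weak gradient of a function that belongs to `H¹(Ω)` (and `0` for any other function). -/
def weakGrad {d : ℕ} (Ω : Set (E d)) (g : E d → ℝ) : L2Vec Ω :=
  if hg : ∃ z ∈ H1 Ω, z.fst =ᵐ[volume.restrict Ω] g then hg.choose.snd else 0

/-- `z` belongs to `H¹(0,T; X)`, with time derivative `w ∈ L²(0,T; X)`; the function `z` is the
absolutely continuous representative. -/
def HasL2TimeDeriv {X : Type*} [NormedAddCommGroup X] [NormedSpace ℝ X]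
    (T : ℝ) (z w : ℝ → X) : Prop :=
  MemLp w 2 (volume.restrict (Ioo 0 T)) ∧
    ∀ t ∈ Icc 0 T, z t = z 0 + ∫ s in (0 : ℝ)..t, w s

open Classical in
/-- The time derivative of a real function in `H¹(0,T)` (and `0` for any other function). -/
def timeDeriv (T : ℝ) (m : ℝ → ℝ) : ℝ → ℝ :=
  if hm : ∃ w, HasL2TimeDeriv T m w then hm.choose else 0

/-- The data of the inverse problem, with the bounds for the coefficients. Functions of time are
used on `[0,T]` only. -/
structure Data (d : ℕ) where
  Ω : Set (E d)
  T : ℝ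
  ρ : ℝ → LInf Ω
  η : ℝ → LInf Ω
  κ : ℝ → LInf Ω
  f : ℝ → ℝ
  u0 : H10 Ω
  p : ℝ → L2 Ω
  ω : H10 Ω
  m : ℝ → ℝ
  ρ0 : ℝ
  ρ1 : ℝ
  dρ1 : ℝ
  η0 : ℝ
  η1 : ℝ
  κ0 : ℝ
  κ1 : ℝ
  dκ1 : ℝ
  Lf : ℝ≥0

namespace Data

variable {d : ℕ} (D : Data d)

/-- `∂_t ρ`. -/
def dρ (t : ℝ) : LInf D.Ω := derivWithin D.ρ (Icc 0 D.T) t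

/-- `∂_t κ`. -/
def dκ (t : ℝ) : LInf D.Ω := derivWithin D.κ (Icc 0 D.T) t

/-- The function `ω/ρ(t)`. -/
def weight (t : ℝ) (x : E d) : ℝ := val D.ω x / D.ρ t x

/-- `∇(ω/ρ(t))`. -/
def gradWeight (t : ℝ) : L2Vec D.Ω := weakGrad D.Ω (D.weight t)

/-- `ω̄(t) = (p(t), ω/ρ(t))`. -/
def omegaBar (t : ℝ) : ℝ := ∫ x in D.Ω, D.p t x * D.weight t x

/-- The minimum of `|ω̄|` over `[0,T]`. -/
def omegaMin : ℝ := ⨅ t : Icc (0 : ℝ) D.T, |D.omegaBar t|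

/-- `M`, the supremum of `‖∇(ω/ρ(t))‖` over `[0,T]`. -/
def M : ℝ := ⨆ t : Icc (0 : ℝ) D.T, ‖D.gradWeight t‖

/-- The norm of `p` in `C([0,T]; L²(Ω))`. -/
def normP : ℝ := ⨆ t : Icc (0 : ℝ) D.T, ‖D.p t‖

/-- The standing assumptions on the data. -/
structure Assumptions : Prop where
  isOpen_Ω : IsOpen D.Ω
  bounded_Ω : Bornology.IsBounded D.Ω
  T_pos : 0 < D.T
  /- `ρ ∈ C¹([0,T]; L^∞(Ω))`, with its bounds -/
  ρ_contDiff : ContDiffOn ℝ 1 D.ρ (Icc 0 D.T)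
  ρ0_pos : 0 < D.ρ0
  ρ_bounds : ∀ t ∈ Icc 0 D.T, ∀ᵐ x ∂(volume.restrict D.Ω), D.ρ0 ≤ D.ρ t x ∧ D.ρ t x ≤ D.ρ1
  dρ_bound : ∀ t ∈ Icc 0 D.T, ∀ᵐ x ∂(volume.restrict D.Ω), |D.dρ t x| ≤ D.dρ1
  /- `η ∈ C([0,T]; L^∞(Ω))`, with its bounds -/
  η_cont : ContinuousOn D.η (Icc 0 D.T)
  η0_pos : 0 < D.η0
  η_bounds : ∀ t ∈ Icc 0 D.T, ∀ᵐ x ∂(volume.restrict D.Ω), D.η0 ≤ D.η t x ∧ D.η t x ≤ D.η1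
  /- `κ ∈ C¹([0,T]; L^∞(Ω))`, with its bounds -/
  κ_contDiff : ContDiffOn ℝ 1 D.κ (Icc 0 D.T)
  κ0_pos : 0 < D.κ0
  κ_bounds : ∀ t ∈ Icc 0 D.T, ∀ᵐ x ∂(volume.restrict D.Ω), D.κ0 ≤ D.κ t x ∧ D.κ t x ≤ D.κ1
  dκ_bound : ∀ t ∈ Icc 0 D.T, ∀ᵐ x ∂(volume.restrict D.Ω), |D.dκ t x| ≤ D.dκ1
  f_lip : LipschitzWith D.Lf D.f
  /- `ρ ∈ C([0,T]; H¹(Ω))` -/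
  ρ_H1 : ∃ R : ℝ → L2Pair D.Ω, ContinuousOn R (Icc 0 D.T) ∧
    ∀ t ∈ Icc 0 D.T, R t ∈ H1 D.Ω ∧ (R t).fst =ᵐ[volume.restrict D.Ω] D.ρ t
  p_cont : ContinuousOn D.p (Icc 0 D.T)
  omegaBar_ne : ∀ t ∈ Icc 0 D.T, D.omegaBar t ≠ 0
  /- `m ∈ H¹(0,T)` -/
  m_H1 : ∃ w, HasL2TimeDeriv D.T D.m w
  /- the supremum `M` is taken over norms of weak gradients in `L²`, and it is finite -/
  weight_H1 : ∀ t ∈ Icc 0 D.T, ∃ z ∈ H1 D.Ω, z.fst =ᵐ[volume.restrict D.Ω] D.weight t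
  M_finite : BddAbove (range fun t : Icc (0 : ℝ) D.T => ‖D.gradWeight t‖)
  /- the smallness condition -/
  small : ∃ ζ : ℝ, 0 < ζ ∧ ζ < 1 ∧
    D.normP ^ 2 * (D.M ^ 2 * D.η1 ^ 2 / (4 * D.omegaMin ^ 2 * D.η0 * D.ρ0)) < ζ

/-- `u` belongs to `C([0,T]; H¹₀)`, has the time derivative `ut ∈ L²(0,T; H¹₀)` and the initial
value `u0`, `h` belongs to `L²(0,T)`, and the variational equation with the source `h(t) p(t)`
holds for almost all `t` and all `φ ∈ H¹₀`; here `∂_t (ρ u) = (∂_t ρ) u + ρ ∂_t u`. -/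
structure IsVariational (u ut : ℝ → H10 D.Ω) (h : ℝ → ℝ) : Prop where
  cont : ContinuousOn u (Icc 0 D.T)
  deriv : HasL2TimeDeriv D.T u ut
  init : u 0 = D.u0
  source : MemLp h 2 (volume.restrict (Ioo 0 D.T))
  eqn : ∀ᵐ t ∂(volume.restrict (Ioo 0 D.T)), ∀ φ : H10 D.Ω,
    (∫ x in D.Ω, (D.dρ t x * val (u t) x + D.ρ t x * val (ut t) x) * val φ x)
      + (∫ x in D.Ω, D.η t x * inner ℝ (grad (ut t) x) (grad φ x))
      + (∫ x in D.Ω, D.κ t x * inner ℝ (grad (u t) x) (grad φ x))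
    = h t * (∫ x in D.Ω, D.p t x * val φ x) + ∫ x in D.Ω, D.f (val (u t) x) * val φ x

/-- The expression for the unknown source `h(t)` in terms of `v = u(t)` and `vt = ∂_t u(t)`. -/
def sourceExpr (t : ℝ) (v vt : H10 D.Ω) : ℝ :=
  1 / D.omegaBar t *
    (timeDeriv D.T D.m t
      + (∫ x in D.Ω, val v x * (val D.ω x * D.dρ t x / D.ρ t x))
      + (∫ x in D.Ω, D.η t x * inner ℝ (grad vt x) (D.gradWeight t x))
      + (∫ x in D.Ω, D.κ t x * inner ℝ (grad v x) (D.gradWeight t x))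
      - ∫ x in D.Ω, D.f (val v x) * D.weight t x)

/-- Weak solution `(u, h)` of the inverse source problem, `ut` being the time derivative of `u`:
the variational equation holds, with `h` given by its expression in terms of `u`. -/
def IsWeakSolution (u ut : ℝ → H10 D.Ω) (h : ℝ → ℝ) : Prop :=
  D.IsVariational u ut h ∧
    ∀ᵐ t ∂(volume.restrict (Ioo 0 D.T)), h t = D.sourceExpr t (u t) (ut t)

/-- The variational equation holds, together with the measurement `∫ u(t) ω = m(t)`. -/
def IsMeasuredSolution (u ut : ℝ → H10 D.Ω) (h : ℝ → ℝ) : Prop :=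
  D.IsVariational u ut h ∧
    ∀ t ∈ Icc 0 D.T, ∫ x in D.Ω, val (u t) x * val D.ω x = D.m t

/-- The time step `τ = T/n`. -/
def step (n : ℕ) : ℝ := D.T / n

/-- The time point `t_i = i τ`. -/
def node (n i : ℕ) : ℝ := i * D.step n

/-- The difference quotient `δ z_(i+1) = (z_(i+1) - z_i)/τ`. -/
def diffQuot {X : Type*} [AddCommGroup X] [Module ℝ X] (n : ℕ) (z : ℕ → X) (i : ℕ) : X :=
  (D.step n)⁻¹ • (z (i + 1) - z i)

/-- The solutions `u_0, …, u_n` and `h_1, …, h_n` of the time-discrete problems with `n` steps,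
the value `h 0` being irrelevant. The equations at `t_(i+1)`, for `0 ≤ i < n`: -/
structure IsDiscrete (n : ℕ) (u : ℕ → H10 D.Ω) (h : ℕ → ℝ) : Prop where
  init : u 0 = D.u0
  eqn : ∀ i < n, ∀ φ : H10 D.Ω,
    (∫ x in D.Ω, (D.ρ (D.node n (i + 1)) x * val (u (i + 1)) x
          - D.ρ (D.node n i) x * val (u i) x) / D.step n * val φ x)
      + (∫ x in D.Ω, D.η (D.node n (i + 1)) x *
          inner ℝ (grad (D.diffQuot n u i) x) (grad φ x))
      + (∫ x in D.Ω, D.κ (D.node n (i + 1)) x * inner ℝ (grad (u (i + 1)) x) (grad φ x))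
    = h (i + 1) * (∫ x in D.Ω, D.p (D.node n (i + 1)) x * val φ x)
      + ∫ x in D.Ω, D.f (val (u i) x) * val φ x
  source : ∀ i < n, h (i + 1) = 1 / D.omegaBar (D.node n (i + 1)) *
    (D.diffQuot n (fun j => D.m (D.node n j)) i
      + (∫ x in D.Ω, val (u i) x * (val D.ω x *
          D.diffQuot n (fun j => D.ρ (D.node n j)) i x / D.ρ (D.node n (i + 1)) x))
      + (∫ x in D.Ω, D.η (D.node n (i + 1)) x *
          inner ℝ (grad (D.diffQuot n u i) x) (D.gradWeight (D.node n (i + 1)) x))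
      + (∫ x in D.Ω, D.κ (D.node n (i + 1)) x *
          inner ℝ (grad (u i) x) (D.gradWeight (D.node n (i + 1)) x))
      - ∫ x in D.Ω, D.f (val (u i) x) * D.weight (D.node n (i + 1)) x)

/-- For `0 < t ≤ T`, the index `i` with `t ∈ (t_(i-1), t_i]`; it is `0` for `t ≤ 0`. -/
def index (n : ℕ) (t : ℝ) : ℕ := ⌈t / D.step n⌉₊

/-- The piecewise constant Rothe function, equal to `z_i` on `(t_(i-1), t_i]`. -/
def rotheConst {X : Type*} (n : ℕ) (z : ℕ → X) (t : ℝ) : X := z (D.index n t)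

/-- The piecewise linear Rothe function, equal to `u_(i-1) + (t - t_(i-1)) δ u_i` on
`(t_(i-1), t_i]` and to `u_0` for `t ≤ 0`. -/
def rotheLinear (n : ℕ) (u : ℕ → H10 D.Ω) (t : ℝ) : H10 D.Ω :=
  if t ≤ 0 then u 0
  else u (D.index n t - 1) + (t - D.node n (D.index n t - 1)) •
    D.diffQuot n u (D.index n t - 1)

/-- The time derivative of the piecewise linear Rothe function, `δ u_i` on `(t_(i-1), t_i]`. -/
def rotheDeriv (n : ℕ) (u : ℕ → H10 D.Ω) (t : ℝ) : H10 D.Ω :=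
  D.diffQuot n u (D.index n t - 1)

/-- Convergence of the Rothe functions to `(u, h)`: the piecewise linear ones in `C([0,T]; L²)`,
the piecewise linear and the piecewise constant ones weakly in `H¹₀` at every `t ∈ [0,T]`, their
time derivatives weakly in `L²(0,T; H¹₀)`, the sources weakly in `L²(0,T)`. -/
structure RotheConverges (U : ℕ → ℕ → H10 D.Ω) (H : ℕ → ℕ → ℝ) (u ut : ℝ → H10 D.Ω)
    (h : ℝ → ℝ) : Prop where
  uniform : TendstoUniformlyOn (fun n t => val (D.rotheLinear n (U n) t)) (fun t => val (u t))
    atTop (Icc 0 D.T)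
  weak_linear : ∀ t ∈ Icc 0 D.T, ∀ φ : H10 D.Ω,
    Tendsto (fun n => inner ℝ (D.rotheLinear n (U n) t) φ) atTop (𝓝 (inner ℝ (u t) φ))
  weak_const : ∀ t ∈ Icc 0 D.T, ∀ φ : H10 D.Ω,
    Tendsto (fun n => inner ℝ (D.rotheConst n (U n) t) φ) atTop (𝓝 (inner ℝ (u t) φ))
  weak_deriv : ∀ g : ℝ → H10 D.Ω, MemLp g 2 (volume.restrict (Ioo 0 D.T)) →
    Tendsto (fun n => ∫ t in Ioo 0 D.T, inner ℝ (D.rotheDeriv n (U n) t) (g t)) atTop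
      (𝓝 (∫ t in Ioo 0 D.T, inner ℝ (ut t) (g t)))
  weak_source : ∀ g : ℝ → ℝ, MemLp g 2 (volume.restrict (Ioo 0 D.T)) →
    Tendsto (fun n => ∫ t in Ioo 0 D.T, D.rotheConst n (H n) t * g t) atTop
      (𝓝 (∫ t in Ioo 0 D.T, h t * g t))

end Data

end PseudoParabolic

end

open PseudoParabolic

/-! ### Test functions, mollification, and pairs with compact support in `Ω`. -/

namespace PseudoParabolic

variable {d : ℕ} {Ω : Set (E d)}

/-! At a fixed time the problem is linear in the pair (x, h) with x = ∂_t u. With B the operator of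
the form (ρx, φ) + (η∇x, ∇φ) on H¹₀, equation (1) reads Bx - h p = r, where the residual r depends
on u alone, Lipschitz continuously in the H¹₀ norm. Testing with W = ω/ρ turns the mass term (ρx, W)
into (ω, x); hence, given (1), formula (2) is the same as (ω, x) = m'. So (1) and (2) form one
bordered system `saddle` with data (r, m'), and integrating (ω, ∂_t u) = m' in time yields the
equivalence with the measurement.

W is an admissible test function only if it lies in H¹₀, while only W ∈ H¹ is assumed, on an
arbitrary bounded open set. The bridge is |W| ≤ |ω|/ρ₀ together with `mem_H10_of_le`: an H¹ function
dominated by an H¹₀ function is in H¹₀.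

By Lax–Milgram B is invertible, and the bordered system is then invertible exactly when (ω, q) ≠ 0
for Bq = p. This is where smallness enters (`isUnit_sourceOp`). If (ω, q) = 0, testing Bq = p with W
gives |ω̄| ≤ η₁ M ‖∇q‖, whereas testing with q gives 4ρ₀η₀‖∇q‖² ≤ ‖p‖²; together these contradict
the assumption.

The inverse depends continuously on t, so the weak formulation becomes an ordinary differential
equation in the Hilbert space H¹₀ with a Lipschitz right-hand side, in L² in time because of m'
(`isWeakSolution_iff`). A contraction in an exponentially weighted norm gives existence, Gronwall
gives uniqueness.

A Rothe step is the same bordered system for (δu_i, h_i), with B replaced by B + τK, K being the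
κ-stiffness operator, and ω by ω + τKW. The two τ terms cancel in the invertibility argument, so the
scheme is solvable for every τ. Moving the τ terms to the right-hand side expresses the discrete
pair through the continuous solution operator. The errors of (δu_i, h_i) at time s are then bounded
by C‖U_n(s) - u(s)‖, by a small multiple of 1 + |m'(s)|, and by C times the distance of m'(s) from
its average over the time cell. Gronwall makes U_n converge to u uniformly in H¹₀, and all the
asserted convergences follow. No compactness is needed, since u is already at hand, and the whole
sequence converges. -/

instance completeSpace_H10 : CompleteSpace (H10 Ω) :=
  (Submodule.isClosed_topologicalClosure _).completeSpace_coe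

/-- The pair `(φ, ∇φ)` of a test function. -/
theorem IsTest.memLp {φ : E d → ℝ} (hφ : IsTest Ω φ) : MemLp φ 2 (volume.restrict Ω) :=
  (hφ.smooth.continuous.memLp_of_hasCompactSupport hφ.compact).restrict Ω

theorem inner_gradient {φ : E d → ℝ} (x v : E d) :
    inner ℝ (gradient φ x) v = fderiv ℝ φ x v := by
  rw [gradient, InnerProductSpace.toDual_symm_apply]

theorem continuous_gradient {φ : E d → ℝ} (hφ : ContDiff ℝ (⊤ : ℕ∞) φ) :
    Continuous (gradient φ) :=
  (InnerProductSpace.toDual ℝ (E d)).symm.continuous.comp (hφ.continuous_fderiv (by simp))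

theorem hasCompactSupport_gradient {φ : E d → ℝ} (hφ : HasCompactSupport φ) :
    HasCompactSupport (gradient φ) :=
  (hφ.fderiv (𝕜 := ℝ)).comp_left (g := (InnerProductSpace.toDual ℝ (E d)).symm) (map_zero _)

theorem IsTest.memLp_gradient {φ : E d → ℝ} (hφ : IsTest Ω φ) :
    MemLp (gradient φ) 2 (volume.restrict Ω) :=
  ((continuous_gradient hφ.smooth).memLp_of_hasCompactSupport
    (hasCompactSupport_gradient hφ.compact)).restrict Ω

/-- The pair `(φ, ∇φ)` of a test function, as an element of `L² × L²`. -/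
noncomputable def IsTest.toPair {φ : E d → ℝ} (hφ : IsTest Ω φ) : L2Pair Ω :=
  WithLp.toLp 2 (hφ.memLp.toLp, hφ.memLp_gradient.toLp)

theorem IsTest.toPair_fst {φ : E d → ℝ} (hφ : IsTest Ω φ) :
    hφ.toPair.fst =ᵐ[volume.restrict Ω] φ := hφ.memLp.coeFn_toLp

theorem IsTest.toPair_snd {φ : E d → ℝ} (hφ : IsTest Ω φ) :
    hφ.toPair.snd =ᵐ[volume.restrict Ω] gradient φ := hφ.memLp_gradient.coeFn_toLp

/-- Membership in `H¹(Ω)` by means of directional derivatives of test functions. -/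
theorem mem_H1_iff {z : L2Pair Ω} : z ∈ H1 Ω ↔ ∀ φ : E d → ℝ, IsTest Ω φ → ∀ v : E d,
    ∫ x in Ω, z.fst x * fderiv ℝ φ x v = - ∫ x in Ω, φ x * inner ℝ (z.snd x) v := by
  have key : ∀ φ : E d → ℝ, IsTest Ω φ → ∀ v : E d,
      inner ℝ (∫ x in Ω, z.fst x • gradient φ x) v = ∫ x in Ω, z.fst x * fderiv ℝ φ x v ∧
      inner ℝ (∫ x in Ω, φ x • z.snd x) v = ∫ x in Ω, φ x * inner ℝ (z.snd x) v := by
    intro φ hφ v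
    constructor
    · rw [real_inner_comm, ← integral_inner (hφ.integrable_smul_gradient _)]
      refine integral_congr_ae (.of_forall fun x => ?_)
      simp only [inner_smul_right, real_inner_comm, ← inner_gradient]
    · rw [real_inner_comm, ← integral_inner (hφ.integrable_smul_vec _)]
      refine integral_congr_ae (.of_forall fun x => ?_)
      simp only [inner_smul_right, real_inner_comm]
  constructor
  · intro hz φ hφ v
    rw [← (key φ hφ v).1, ← (key φ hφ v).2, hz φ hφ, inner_neg_left]
  · intro hz φ hφ
    refine ext_inner_right ℝ fun v => ?_
    rw [inner_neg_left, (key φ hφ v).1, (key φ hφ v).2, hz φ hφ v]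

section Correlation

variable {F : Type*} [NormedAddCommGroup F] [InnerProductSpace ℝ F]

/-- The integral is the inner product of `ξ` with a translate of `A`, and translations act
continuously on L². -/
theorem continuous_integral_inner_translate {ξ A : E d → F} (hξ : MemLp ξ 2 volume)
    (hA : MemLp A 2 volume) : Continuous fun y => ∫ x, inner ℝ (ξ x) (A (y + x)) := by
  have : Fact ((2 : ℝ≥0∞) ≠ ∞) := ⟨by simp⟩
  have h : (fun y => ∫ x, inner ℝ (ξ x) (A (y + x))) =
      fun y => inner ℝ hξ.toLp (DomAddAct.mk y +ᵥ hA.toLp) := by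
    funext y
    rw [L2.inner_def]
    refine integral_congr_ae ?_
    filter_upwards [hξ.coeFn_toLp, DomAddAct.vadd_Lp_ae_eq (DomAddAct.mk y) hA.toLp,
      (measurePreserving_add_left volume y).quasiMeasurePreserving.ae hA.coeFn_toLp]
      with x h1 h2 h3
    rw [h1, h2]
    simp only [Equiv.symm_apply_apply, vadd_eq_add, h3]
  rw [h]
  have : Continuous fun y : E d => DomAddAct.mk y +ᵥ hA.toLp :=
    Continuous.vadd DomAddAct.continuous_mk continuous_const
  fun_prop

/-- Fubini: averaging the correlation of `ξ` and `A` against the kernel is the same as pairing `ξ`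
with the mollification of `A`. Integrability on the product space is that of a convolution
integrand, times a bounded factor. -/
theorem integral_mul_integral_inner_translate [CompleteSpace F] {η : E d → ℝ} (hη : Continuous η)
    (hc : HasCompactSupport η) {ξ A : E d → F} (hξ : Integrable ξ) (hA : Integrable A) :
    ∫ y, η y * ∫ x, inner ℝ (ξ x) (A (-y + x)) =
      ∫ x, inner ℝ (ξ x) (∫ t, η (x - t) • A t) := by
  obtain ⟨C, hC⟩ := hη.bounded_above_of_compact_support hc
  have h1 : Integrable (fun p : E d × E d => inner ℝ (ξ p.2) (A (-p.1 + p.2)))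
      (volume.prod volume) := by
    have hA' : Integrable (fun x => A (-x)) := hA.comp_neg
    have := Integrable.convolution_integrand (innerSL ℝ) (μ := volume) (ν := volume) hξ hA'
    refine this.congr (.of_forall fun p => ?_)
    simp only
    rw [innerSL_apply_apply, neg_sub, sub_eq_neg_add]
  have h2 : Integrable (fun p : E d × E d => η p.1 * inner ℝ (ξ p.2) (A (-p.1 + p.2)))
      (volume.prod volume) :=
    h1.bdd_mul (c := C) (hη.comp continuous_fst).aestronglyMeasurable
      (.of_forall fun p => hC p.1)
  calc ∫ y, η y * ∫ x, inner ℝ (ξ x) (A (-y + x))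
      = ∫ y, ∫ x, η y * inner ℝ (ξ x) (A (-y + x)) := by simp only [integral_const_mul]
    _ = ∫ x, ∫ y, η y * inner ℝ (ξ x) (A (-y + x)) := integral_integral_swap h2
    _ = ∫ x, inner ℝ (ξ x) (∫ t, η (x - t) • A t) := by
        refine integral_congr_ae (.of_forall fun x => ?_)
        have h3 : Integrable fun t => η (x - t) • A t :=
          hA.bdd_smul C (by fun_prop) (.of_forall fun t => hC _)
        simp only
        rw [← integral_inner h3, ← integral_sub_left_eq_self _ volume x]
        refine integral_congr_ae (.of_forall fun t => ?_)
        simp [inner_smul_right]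

end Correlation

/-- A pair supported in a compact subset of `Ω` whose second component is the weak gradient of the
first one on the whole space belongs to `H¹₀(Ω)`. -/
theorem mem_H10_of_compact (hΩ : IsOpen Ω) {K : Set (E d)} (hK : IsCompact K) (hKΩ : K ⊆ Ω)
    {a : E d → ℝ} {A : E d → E d} (ha : MemLp a 2 volume) (hA : MemLp A 2 volume)
    (haK : ∀ x ∉ K, a x = 0) (hAK : ∀ x ∉ K, A x = 0)
    (hid : ∀ Ψ : E d → ℝ, ContDiff ℝ (⊤ : ℕ∞) Ψ → HasCompactSupport Ψ → ∀ v : E d,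
      ∫ x, a x * fderiv ℝ Ψ x v = - ∫ x, Ψ x * inner ℝ (A x) v)
    (hfin : volume Ω ≠ ∞)
    {z : L2Pair Ω} (hz1 : z.fst =ᵐ[volume.restrict Ω] a)
    (hz2 : z.snd =ᵐ[volume.restrict Ω] A) : z ∈ H10 Ω := by
  have : IsFiniteMeasure (volume.restrict Ω) := ⟨by simpa using hfin.lt_top⟩
  have int_of : ∀ {F : Type} [NormedAddCommGroup F] {g : E d → F}, MemLp g 2 volume →
      (∀ x ∉ Ω, g x = 0) → Integrable g := by
    intro F _ g hg h0
    rw [← integrableOn_iff_integrable_of_support_subset (s := Ω)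
      (fun x hx => by by_contra h; exact hx (h0 x h))]
    exact (hg.restrict Ω).integrable (by norm_num)
  have ha1 : Integrable a := int_of ha fun x hx => haK x fun h => hx (hKΩ h)
  have hA1 : Integrable A := int_of hA fun x hx => hAK x fun h => hx (hKΩ h)
  -- The closure of a subspace is its double orthogonal complement, so it suffices that every `ξ`
  -- orthogonal to all test pairs is orthogonal to `z`. Only mollifications tested against a fixed
  -- `ξ` are then needed, not their convergence in norm.
  rw [H10, ← Submodule.orthogonal_orthogonal_eq_closure, Submodule.mem_orthogonal]
  intro ξ hξ
  rw [Submodule.mem_orthogonal'] at hξ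
  set ξ1 : E d → ℝ := Ω.indicator ξ.fst with hξ1
  set ξ2 : E d → E d := Ω.indicator ξ.snd with hξ2
  have hm1 : MemLp ξ1 2 volume := (memLp_indicator_iff_restrict hΩ.measurableSet).2 (Lp.memLp _)
  have hm2 : MemLp ξ2 2 volume := (memLp_indicator_iff_restrict hΩ.measurableSet).2 (Lp.memLp _)
  have hi1 : Integrable ξ1 := int_of hm1 fun x hx => indicator_of_notMem hx _
  have hi2 : Integrable ξ2 := int_of hm2 fun x hx => indicator_of_notMem hx _
  have inner_eq : ∀ (w : L2Pair Ω) (b : E d → ℝ) (B : E d → E d),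
      w.fst =ᵐ[volume.restrict Ω] b → w.snd =ᵐ[volume.restrict Ω] B →
      inner ℝ ξ w = (∫ x, inner ℝ (ξ1 x) (b x)) + ∫ x, inner ℝ (ξ2 x) (B x) := by
    intro w b B h1 h2
    rw [WithLp.prod_inner_apply, L2.inner_def, L2.inner_def]
    congr 1
    · rw [← setIntegral_eq_integral_of_forall_compl_eq_zero (s := Ω)
        (f := fun x => inner ℝ (ξ1 x) (b x)) (fun x hx => by simp [hξ1, hx])]
      refine integral_congr_ae ?_
      filter_upwards [h1, ae_restrict_mem hΩ.measurableSet] with x hx hm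
      rw [hξ1, indicator_of_mem hm, ← hx]; rfl
    · rw [← setIntegral_eq_integral_of_forall_compl_eq_zero (s := Ω)
        (f := fun x => inner ℝ (ξ2 x) (B x)) (fun x hx => by simp [hξ2, hx])]
      refine integral_congr_ae ?_
      filter_upwards [h2, ae_restrict_mem hΩ.measurableSet] with x hx hm
      rw [hξ2, indicator_of_mem hm, ← hx]; rfl
  -- The correlation of `ξ` with the translates of `(a, A)`; it is continuous and equals the inner
  -- product of `ξ` and `z` at the origin.
  set c : E d → ℝ := fun y => (∫ x, inner ℝ (ξ1 x) (a (y + x))) + ∫ x, inner ℝ (ξ2 x) (A (y + x))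
    with hcdef
  have hc : Continuous c := (continuous_integral_inner_translate hm1 ha).add
    (continuous_integral_inner_translate hm2 hA)
  have hc0 : inner ℝ ξ z = c 0 := by
    rw [inner_eq z a A hz1 hz2]; simp [hcdef]
  rw [hc0]
  by_contra hne
  -- `δ₁` keeps the mollification supported inside `Ω`; `δ₂` keeps `c` within `|c 0| / 2` of `c 0`.
  obtain ⟨δ₁, hδ₁, hKδ⟩ := hK.exists_cthickening_subset_open hΩ hKΩ
  obtain ⟨δ₂, hδ₂, hcδ⟩ := Metric.continuous_iff.1 hc 0 (|c 0| / 2) (by positivity)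
  obtain ⟨δ, hδ, hδ1, hδ2⟩ : ∃ δ > 0, δ ≤ δ₁ ∧ δ ≤ δ₂ :=
    ⟨min δ₁ δ₂, lt_min hδ₁ hδ₂, min_le_left _ _, min_le_right _ _⟩
  let φ : ContDiffBump (0 : E d) := ⟨δ / 2, δ, by positivity, by linarith⟩
  set η := φ.normed volume with hη
  have hηs : ContDiff ℝ (⊤ : ℕ∞) η := φ.contDiff_normed
  have hηc : HasCompactSupport η := φ.hasCompactSupport_normed
  set L := ContinuousLinearMap.mul ℝ ℝ
  set b := convolution a η L volume with hb
  have hbs : ContDiff ℝ (⊤ : ℕ∞) b :=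
    hηc.contDiff_convolution_right L ha1.locallyIntegrable hηs
  have hb0 : ∀ x ∉ Metric.cthickening δ K, b x = 0 := by
    intro x hx
    rw [hb, convolution]
    refine integral_eq_zero_of_ae (.of_forall fun t => ?_)
    by_cases ht : t ∈ K
    · have : η (x - t) = 0 := by
        have : x - t ∉ Function.support η := by
          rw [hη, φ.support_normed_eq, Metric.mem_ball, dist_zero_right, not_lt, ← dist_eq_norm]
          by_contra h
          exact hx (Metric.mem_cthickening_of_dist_le x t δ K ht (not_le.1 h).le)
        simpa using this
      simp [this]
    · simp [haK t ht]
  have hbts : tsupport b ⊆ Metric.cthickening δ K :=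
    closure_minimal (fun x hx => by by_contra h; exact hx (hb0 x h)) Metric.isClosed_cthickening
  have hbt : IsTest Ω b := ⟨hbs, hK.cthickening.of_isClosed_subset (isClosed_tsupport _) hbts,
    hbts.trans ((Metric.cthickening_mono hδ1 K).trans hKδ)⟩
  have hbη : ∀ x, b x = ∫ t, η (x - t) • a t := fun x => by
    rw [hb, convolution]
    refine integral_congr_ae (.of_forall fun t => ?_)
    simp [L, mul_comm]
  have hint : ∀ x, Integrable fun t => η (x - t) • A t := fun x => by
    obtain ⟨C, hC⟩ := hηs.continuous.bounded_above_of_compact_support hηc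
    exact hA1.bdd_smul C
      (hηs.continuous.comp (continuous_const.sub continuous_id)).aestronglyMeasurable
      (.of_forall fun t => hC _)
  have hgrad : ∀ x, gradient b x = ∫ t, η (x - t) • A t := by
    intro x
    refine ext_inner_right ℝ fun v => ?_
    have h1 := (hηc.hasFDerivAt_convolution_right L ha1.locallyIntegrable
      (hηs.of_le (by simp)) x).fderiv
    rw [inner_gradient, hb, h1, convolution_precompR_apply L ha1.locallyIntegrable
      (hηc.fderiv ℝ) (hηs.continuous_fderiv (by simp)), convolution]
    -- The derivative falls on the kernel; the weak gradient identity tested with `t ↦ η (x - t)`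
    -- moves it onto `a`. Reflecting the kernel contributes the sign that cancels the one from
    -- integration by parts.
    have h2 := hid (fun t => η (x - t)) (hηs.comp (contDiff_const.sub contDiff_id))
      (hηc.comp_homeomorph (Homeomorph.subLeft x)) v
    have h3 : ∀ t, fderiv ℝ (fun t => η (x - t)) t v = - fderiv ℝ η (x - t) v := fun t => by
      have h4 : HasFDerivAt (fun t => η (x - t)) _ t :=
        ((hηs.differentiable (by simp)) (x - t)).hasFDerivAt.comp t
          ((hasFDerivAt_id t).const_sub x)
      rw [h4.fderiv]
      simp
    simp only [h3, mul_neg, integral_neg, neg_inj] at h2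
    rw [real_inner_comm, ← integral_inner (hint x)]
    simp only [inner_smul_right, L, ContinuousLinearMap.mul_apply']
    rw [h2]
    refine integral_congr_ae (.of_forall fun t => ?_)
    simp [real_inner_comm]
  -- The mollified pair is a test pair, hence orthogonal to `ξ`; by Fubini this is an average of `c`
  -- near the origin.
  have hzero : ∫ y, η y * c (-y) = 0 := by
    have h0 := hξ _ (Submodule.subset_span ⟨b, hbt, hbt.toPair_fst, hbt.toPair_snd⟩)
    rw [inner_eq _ _ _ hbt.toPair_fst hbt.toPair_snd] at h0
    simp only [hbη, hgrad] at h0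
    rw [← integral_mul_integral_inner_translate hηs.continuous hηc hi1 ha1,
      ← integral_mul_integral_inner_translate hηs.continuous hηc hi2 hA1, ← integral_add] at h0
    · rw [← h0]
      refine integral_congr_ae (.of_forall fun y => ?_)
      simp only [hcdef, mul_add]
    · exact ((hηs.continuous.mul ((continuous_integral_inner_translate hm1 ha).comp
        continuous_neg)).integrable_of_hasCompactSupport hηc.mul_right)
    · exact ((hηs.continuous.mul ((continuous_integral_inner_translate hm2 hA).comp
        continuous_neg)).integrable_of_hasCompactSupport hηc.mul_right)
  -- The average is within `|c 0| / 2` of `c 0`, yet it vanishes: a contradiction.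
  have hd := φ.dist_normed_convolution_le (μ := volume) (x₀ := 0) (g := c) (ε := |c 0| / 2)
    hc.aestronglyMeasurable (fun x hx => (hcδ x (lt_of_lt_of_le hx hδ2)).le)
  rw [convolution] at hd
  simp only [zero_sub, ContinuousLinearMap.lsmul_apply, smul_eq_mul] at hd
  rw [← hη, hzero, dist_zero_left, Real.norm_eq_abs] at hd
  have := abs_pos.2 hne
  linarith

theorem IsTest.mul_contDiff {φ Ψ : E d → ℝ} (hφ : IsTest Ω φ) (hΨ : ContDiff ℝ (⊤ : ℕ∞) Ψ) :
    IsTest Ω fun x => φ x * Ψ x :=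
  ⟨hφ.smooth.mul hΨ, hφ.compact.mul_right, (tsupport_mul_subset_left).trans hφ.supp⟩

theorem fderiv_mul_apply {φ Ψ : E d → ℝ} (hφ : ContDiff ℝ (⊤ : ℕ∞) φ)
    (hΨ : ContDiff ℝ (⊤ : ℕ∞) Ψ) (x v : E d) :
    fderiv ℝ (fun x => φ x * Ψ x) x v = φ x * fderiv ℝ Ψ x v + Ψ x * fderiv ℝ φ x v := by
  have h1 : DifferentiableAt ℝ φ x := hφ.differentiable (by simp) x
  have h2 : DifferentiableAt ℝ Ψ x := hΨ.differentiable (by simp) x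
  rw [fderiv_fun_mul h1 h2]
  simp

/-- The product of an element of `H¹(Ω)` with a test function belongs to `H¹₀(Ω)`. -/
theorem mem_H10_of_mul_test (hΩ : IsOpen Ω) (hfin : volume Ω ≠ ∞) {z : L2Pair Ω} (hz : z ∈ H1 Ω)
    {ψ : E d → ℝ} (hψ : IsTest Ω ψ) {w : L2Pair Ω}
    (hw1 : w.fst =ᵐ[volume.restrict Ω] fun x => ψ x * z.fst x)
    (hw2 : w.snd =ᵐ[volume.restrict Ω] fun x => ψ x • z.snd x + z.fst x • gradient ψ x) :
    w ∈ H10 Ω := by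
  have : IsFiniteMeasure (volume.restrict Ω) := ⟨by simpa using hfin.lt_top⟩
  have hψ0 : ∀ x ∉ tsupport ψ, ψ x = 0 := fun x hx => image_eq_zero_of_notMem_tsupport hx
  have hψ1 : ∀ x ∉ tsupport ψ, gradient ψ x = 0 := fun x hx => by
    rw [gradient, fderiv_of_notMem_tsupport ℝ hx, map_zero]
  have hm1 : MemLp (Ω.indicator fun x => ψ x * z.fst x) 2 volume :=
    (memLp_indicator_iff_restrict hΩ.measurableSet).2 ((Lp.memLp w.fst).ae_eq hw1)
  have hm2 : MemLp (Ω.indicator fun x => ψ x • z.snd x + z.fst x • gradient ψ x) 2 volume :=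
    (memLp_indicator_iff_restrict hΩ.measurableSet).2 ((Lp.memLp w.snd).ae_eq hw2)
  refine mem_H10_of_compact hΩ (K := tsupport ψ) hψ.compact hψ.supp hm1 hm2 ?_ ?_ ?_ hfin ?_ ?_
  · intro x hx
    rw [indicator_apply_eq_zero]
    intro _
    rw [hψ0 x hx, zero_mul]
  · intro x hx
    rw [indicator_apply_eq_zero]
    intro _
    rw [hψ0 x hx, hψ1 x hx, zero_smul, smul_zero, add_zero]
  · intro Ψ hΨ hΨc v
    -- `ψ * Ψ` is a test function in `Ω` even though `Ψ` need not be; the product rule gives the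
    -- weak gradient of the zero extension on the whole space.
    have hz' := mem_H1_iff.1 hz _ (hψ.mul_contDiff hΨ) v
    have hbd : ∀ g : E d → ℝ, Continuous g → HasCompactSupport g →
        Integrable (fun x => z.fst x * g x) (volume.restrict Ω) ∧
        Integrable (fun x => g x * inner ℝ (z.snd x) v) (volume.restrict Ω) := by
      intro g hg hgc
      obtain ⟨C, hC⟩ := hg.bounded_above_of_compact_support hgc
      exact ⟨((Lp.memLp z.fst).integrable (by norm_num)).mul_bdd (c := C)
          hg.aestronglyMeasurable (.of_forall hC),
        (((Lp.memLp z.snd).integrable (by norm_num)).inner_const v).bdd_mul (c := C)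
          hg.aestronglyMeasurable (.of_forall hC)⟩
    have c1 : Continuous fun x => fderiv ℝ Ψ x v :=
      (hΨ.continuous_fderiv (by simp)).clm_apply continuous_const
    have c2 : Continuous fun x => fderiv ℝ ψ x v :=
      (hψ.smooth.continuous_fderiv (by simp)).clm_apply continuous_const
    have i1 := (hbd (fun x => ψ x * fderiv ℝ Ψ x v) (hψ.smooth.continuous.mul c1)
      hψ.compact.mul_right).1
    have i2 := (hbd (fun x => Ψ x * fderiv ℝ ψ x v) (hΨ.continuous.mul c2)
      hΨc.mul_right).1
    have i3 := (hbd (fun x => ψ x * Ψ x) (hψ.smooth.continuous.mul hΨ.continuous)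
      hψ.compact.mul_right).2
    simp only [fderiv_mul_apply hψ.smooth hΨ, mul_add] at hz'
    rw [integral_add i1 i2] at hz'
    have e1 : ∫ x, (Ω.indicator fun x => ψ x * z.fst x) x * fderiv ℝ Ψ x v =
        ∫ x in Ω, z.fst x * (ψ x * fderiv ℝ Ψ x v) := by
      rw [← integral_indicator hΩ.measurableSet]
      refine integral_congr_ae (.of_forall fun x => ?_)
      by_cases hx : x ∈ Ω
      · simp only [indicator_of_mem hx]; ring
      · simp [hx]
    have e2 : ∫ x, Ψ x * inner ℝ
          ((Ω.indicator fun x => ψ x • z.snd x + z.fst x • gradient ψ x) x) v =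
        ∫ x in Ω, (ψ x * Ψ x * inner ℝ (z.snd x) v + z.fst x * (Ψ x * fderiv ℝ ψ x v)) := by
      rw [← integral_indicator hΩ.measurableSet]
      refine integral_congr_ae (.of_forall fun x => ?_)
      by_cases hx : x ∈ Ω
      · simp only [indicator_of_mem hx, inner_add_left, inner_smul_left, inner_gradient]
        simp only [conj_trivial]
        ring
      · simp [hx]
    rw [e1, e2, integral_add i3 i2]
    linarith
  · filter_upwards [hw1, ae_restrict_mem hΩ.measurableSet] with x hx hm
    rw [hx, indicator_of_mem hm]
  · filter_upwards [hw2, ae_restrict_mem hΩ.measurableSet] with x hx hm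
    rw [hx, indicator_of_mem hm]

end PseudoParabolic

/-! ### Convergence of products in L^p, and weak gradients. -/

namespace PseudoParabolic

section Lp

variable {α : Type*} [MeasurableSpace α] {μ : Measure α} {F : Type*} [NormedAddCommGroup F]

theorem tendsto_eLpNorm_zero_of_dominated {p : ℝ≥0∞} (hp0 : p ≠ 0) (hp : p ≠ ∞) {f : ℕ → α → F}
    (hf : ∀ n, AEStronglyMeasurable (f n) μ) {b : α → ℝ} (hb : MemLp b p μ)
    (hfb : ∀ n, ∀ᵐ x ∂μ, ‖f n x‖ ≤ b x)
    (hlim : ∀ᵐ x ∂μ, Tendsto (fun n => f n x) atTop (𝓝 0)) :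
    Tendsto (fun n => eLpNorm (f n) p μ) atTop (𝓝 0) := by
  have hpos := ENNReal.toReal_pos hp0 hp
  simp only [eLpNorm_eq_lintegral_rpow_enorm_toReal hp0 hp]
  have h : Tendsto (fun n => ∫⁻ x, ‖f n x‖ₑ ^ p.toReal ∂μ) atTop (𝓝 (∫⁻ _, 0 ∂μ)) := by
    refine tendsto_lintegral_of_dominated_convergence' (fun x => ‖b x‖ₑ ^ p.toReal)
      (fun n => (hf n).enorm.pow_const _) ?_ ?_ ?_
    · intro n
      filter_upwards [hfb n] with x hx
      gcongr
      rw [enorm_le_iff_norm_le]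
      exact hx.trans (le_abs_self _)
    · exact (lintegral_rpow_enorm_lt_top_of_eLpNorm_lt_top hp0 hp hb.2).ne
    · filter_upwards [hlim] with x hx
      have h0 := hx.enorm
      rw [enorm_zero] at h0
      simpa [ENNReal.zero_rpow_of_pos hpos, Function.comp_def] using
        ((ENNReal.continuous_rpow_const (y := p.toReal)).tendsto 0).comp h0
  rw [lintegral_zero] at h
  have := (ENNReal.continuous_rpow_const (y := 1 / p.toReal)).tendsto 0 |>.comp h
  simpa [ENNReal.zero_rpow_of_pos (inv_pos.2 hpos), Function.comp_def] using this

variable [NormedSpace ℝ F]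

/-- Products `V c_k H_k` converge if `c_k` is bounded and converges a.e. and `H_k` converges in the
mean. -/
theorem tendsto_eLpNorm_mul_smul_sub {q r : ℝ≥0∞} [ENNReal.HolderTriple q 2 r] (hr0 : r ≠ 0)
    (hr1 : 1 ≤ r) (hr : r ≠ ∞) {V : α → ℝ} (hV : MemLp V q μ) {c : ℕ → α → ℝ} {c' : α → ℝ} {C : ℝ}
    (hc : ∀ n, AEStronglyMeasurable (c n) μ) (hc' : AEStronglyMeasurable c' μ)
    (hcC : ∀ n, ∀ᵐ x ∂μ, |c n x| ≤ C) (hcC' : ∀ᵐ x ∂μ, |c' x| ≤ C)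
    (hlim : ∀ᵐ x ∂μ, Tendsto (fun n => c n x) atTop (𝓝 (c' x)))
    {H : ℕ → α → F} {H' : α → F} (hH : ∀ n, MemLp (H n) 2 μ) (hH' : MemLp H' 2 μ)
    (hHlim : Tendsto (fun n => eLpNorm (H n - H') 2 μ) atTop (𝓝 0)) :
    Tendsto (fun n => eLpNorm (fun x => (V x * c n x) • H n x - (V x * c' x) • H' x) r μ) atTop
      (𝓝 0) := by
  -- The difference splits into `V c_n (H_n - H')`, handled by Hölder, and `V (c_n - c') H'`,
  -- handled by dominated convergence.
  have h1 : Tendsto (fun n => eLpNorm (fun x => (V x * c n x) • (H n - H') x) r μ) atTop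
      (𝓝 0) := by
    have hb : ∀ n, eLpNorm (fun x => (V x * c n x) • (H n - H') x) r μ ≤
        ENNReal.ofReal C * (eLpNorm V q μ * eLpNorm (H n - H') 2 μ) := by
      intro n
      refine (eLpNorm_le_mul_eLpNorm_of_ae_le_mul (g := fun x => V x • (H n - H') x) (c := C)
        ?_ r).trans ?_
      · filter_upwards [hcC n] with x hx
        rw [mul_comm (V x), mul_smul, norm_smul, Real.norm_eq_abs]
        gcongr
      · gcongr
        exact eLpNorm_smul_le_mul_eLpNorm ((hH n).sub hH').1 hV.1
    refine tendsto_of_tendsto_of_tendsto_of_le_of_le tendsto_const_nhds ?_ (fun _ => zero_le) hb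
    have := ENNReal.Tendsto.const_mul (a := ENNReal.ofReal C)
      (ENNReal.Tendsto.const_mul (a := eLpNorm V q μ) hHlim (Or.inr hV.2.ne))
      (Or.inr ENNReal.ofReal_ne_top)
    simpa using this
  have h2 : Tendsto (fun n => eLpNorm (fun x => (V x * (c n x - c' x)) • H' x) r μ) atTop
      (𝓝 0) := by
    have hVH : MemLp (fun x => V x • H' x) r μ := hH'.smul hV
    refine tendsto_eLpNorm_zero_of_dominated (b := fun x => 2 * C * ‖V x • H' x‖) hr0 hr
      (fun n => (hV.1.mul ((hc n).sub hc')).smul hH'.1) (hVH.norm.const_mul _) ?_ ?_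
    · intro n
      filter_upwards [hcC n, hcC' ] with x hx hx'
      rw [mul_comm (V x), mul_smul, norm_smul, Real.norm_eq_abs]
      gcongr
      exact (abs_sub _ _).trans (by linarith)
    · filter_upwards [hlim] with x hx
      have : Tendsto (fun n => (V x * (c n x - c' x)) • H' x) atTop
          (𝓝 ((V x * (c' x - c' x)) • H' x)) :=
        ((hx.sub_const _).const_mul _).smul_const _
      simpa using this
  have h3 := h1.add h2
  rw [add_zero] at h3
  refine tendsto_of_tendsto_of_tendsto_of_le_of_le tendsto_const_nhds h3 (fun _ => zero_le)
    fun n => ?_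
  refine le_trans (le_of_eq ?_) (eLpNorm_add_le ((hV.1.mul (hc n)).smul ((hH n).sub hH').1)
    ((hV.1.mul ((hc n).sub hc')).smul hH'.1) hr1)
  congr 1
  funext x
  simp only [Pi.add_apply, Pi.sub_apply, smul_sub, mul_sub, sub_smul, Pi.smul_apply', Pi.mul_apply]
  abel

end Lp

variable {d : ℕ} {Ω : Set (E d)}

/-- `G` is a weak gradient of `z` in `Ω`. -/
def IsWeakGrad (Ω : Set (E d)) (z : E d → ℝ) (G : E d → E d) : Prop :=
  ∀ φ : E d → ℝ, IsTest Ω φ → ∀ v : E d,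
    ∫ x in Ω, z x * fderiv ℝ φ x v = - ∫ x in Ω, φ x * inner ℝ (G x) v

theorem IsWeakGrad.congr {z z' : E d → ℝ} {G G' : E d → E d} (h : IsWeakGrad Ω z G)
    (hz : z =ᵐ[volume.restrict Ω] z') (hG : G =ᵐ[volume.restrict Ω] G') :
    IsWeakGrad Ω z' G' := by
  intro φ hφ v
  have e1 : ∫ x in Ω, z x * fderiv ℝ φ x v = ∫ x in Ω, z' x * fderiv ℝ φ x v :=
    integral_congr_ae (by filter_upwards [hz] with x hx; rw [hx])
  have e2 : ∫ x in Ω, φ x * inner ℝ (G x) v = ∫ x in Ω, φ x * inner ℝ (G' x) v :=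
    integral_congr_ae (by filter_upwards [hG] with x hx; rw [hx])
  rw [← e1, ← e2, h φ hφ v]

theorem IsTest.continuous_fderiv_apply {φ : E d → ℝ} (hφ : IsTest Ω φ) (v : E d) :
    Continuous fun x => fderiv ℝ φ x v :=
  (hφ.smooth.continuous_fderiv (by simp)).clm_apply continuous_const

theorem IsTest.hasCompactSupport_fderiv_apply {φ : E d → ℝ} (hφ : IsTest Ω φ) (v : E d) :
    HasCompactSupport fun x => fderiv ℝ φ x v :=
  (hφ.compact.fderiv (𝕜 := ℝ)).comp_left (g := fun L : E d →L[ℝ] ℝ => L v) rfl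

theorem IsTest.integrable_mul {φ : E d → ℝ} (hφ : IsTest Ω φ) {z : E d → ℝ}
    (hz : Integrable z (volume.restrict Ω)) (v : E d) :
    Integrable (fun x => z x * fderiv ℝ φ x v) (volume.restrict Ω) := by
  obtain ⟨C, hC⟩ := (hφ.continuous_fderiv_apply v).bounded_above_of_compact_support
    (hφ.hasCompactSupport_fderiv_apply v)
  exact hz.mul_bdd (c := C) (hφ.continuous_fderiv_apply v).aestronglyMeasurable (.of_forall hC)

theorem IsTest.integrable_mul_inner {φ : E d → ℝ} (hφ : IsTest Ω φ) {G : E d → E d}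
    (hG : Integrable G (volume.restrict Ω)) (v : E d) :
    Integrable (fun x => φ x * inner ℝ (G x) v) (volume.restrict Ω) := by
  obtain ⟨C, hC⟩ := hφ.smooth.continuous.bounded_above_of_compact_support hφ.compact
  exact (hG.inner_const v).bdd_mul (c := C) hφ.smooth.continuous.aestronglyMeasurable
    (.of_forall hC)

/-- Weak gradients are preserved under convergence in `L¹`. -/
theorem IsWeakGrad.of_tendsto {z : ℕ → E d → ℝ} {G : ℕ → E d → E d} {z' : E d → ℝ}
    {G' : E d → E d} (h : ∀ n, IsWeakGrad Ω (z n) (G n))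
    (hz : ∀ n, Integrable (z n) (volume.restrict Ω)) (hz' : Integrable z' (volume.restrict Ω))
    (hG : ∀ n, Integrable (G n) (volume.restrict Ω)) (hG' : Integrable G' (volume.restrict Ω))
    (hzl : Tendsto (fun n => eLpNorm (fun x => z n x - z' x) 1 (volume.restrict Ω)) atTop (𝓝 0))
    (hGl : Tendsto (fun n => eLpNorm (fun x => G n x - G' x) 1 (volume.restrict Ω)) atTop (𝓝 0)) :
    IsWeakGrad Ω z' G' := by
  intro φ hφ v
  have sq : ∀ {u w : ℕ → ℝ≥0∞} {C : ℝ}, Tendsto w atTop (𝓝 0) →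
      (∀ n, u n ≤ ENNReal.ofReal C * w n) → Tendsto u atTop (𝓝 0) := by
    intro u w C hw hu
    refine tendsto_of_tendsto_of_tendsto_of_le_of_le tendsto_const_nhds ?_ (fun _ => zero_le) hu
    simpa using ENNReal.Tendsto.const_mul (a := ENNReal.ofReal C) hw
      (Or.inr ENNReal.ofReal_ne_top)
  have l1 : Tendsto (fun n => ∫ x in Ω, z n x * fderiv ℝ φ x v) atTop
      (𝓝 (∫ x in Ω, z' x * fderiv ℝ φ x v)) := by
    obtain ⟨C, hC⟩ := (hφ.continuous_fderiv_apply v).bounded_above_of_compact_support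
      (hφ.hasCompactSupport_fderiv_apply v)
    refine tendsto_integral_of_L1' _ (hφ.integrable_mul hz' v).1
      (.of_forall fun n => hφ.integrable_mul (hz n) v)
      (sq (C := C) hzl fun n => eLpNorm_le_mul_eLpNorm_of_ae_le_mul (.of_forall fun x => ?_) 1)
    rw [Pi.sub_apply, ← sub_mul, norm_mul, mul_comm]
    gcongr
    exact hC x
  have l2 : Tendsto (fun n => ∫ x in Ω, φ x * inner ℝ (G n x) v) atTop
      (𝓝 (∫ x in Ω, φ x * inner ℝ (G' x) v)) := by
    obtain ⟨C, hC⟩ := hφ.smooth.continuous.bounded_above_of_compact_support hφ.compact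
    refine tendsto_integral_of_L1' _ (hφ.integrable_mul_inner hG' v).1
      (.of_forall fun n => hφ.integrable_mul_inner (hG n) v)
      (sq (C := C * ‖v‖) hGl fun n =>
        eLpNorm_le_mul_eLpNorm_of_ae_le_mul (.of_forall fun x => ?_) 1)
    rw [Pi.sub_apply, ← mul_sub, ← inner_sub_left, norm_mul, mul_assoc]
    have hC0 : 0 ≤ C := (norm_nonneg _).trans (hC x)
    gcongr
    · exact hC x
    · rw [mul_comm]; exact norm_inner_le_norm _ _
  refine tendsto_nhds_unique l1 ?_
  simp only [fun n => h n φ hφ v]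
  exact l2.neg

theorem IsTest.isWeakGrad {ψ : E d → ℝ} (hψ : IsTest Ω ψ) : IsWeakGrad Ω ψ (gradient ψ) := by
  intro φ hφ v
  simp only [inner_gradient]
  have z1 : ∀ x ∉ Ω, ψ x * fderiv ℝ φ x v = 0 := fun x hx => by
    rw [image_eq_zero_of_notMem_tsupport fun h => hx (hψ.supp h), zero_mul]
  have z2 : ∀ x ∉ Ω, φ x * fderiv ℝ ψ x v = 0 := fun x hx => by
    rw [image_eq_zero_of_notMem_tsupport fun h => hx (hφ.supp h), zero_mul]
  rw [setIntegral_eq_integral_of_forall_compl_eq_zero z1,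
    setIntegral_eq_integral_of_forall_compl_eq_zero z2,
    integral_mul_fderiv_eq_neg_fderiv_mul_of_integrable]
  · simp only [mul_comm]
  · exact ((hψ.continuous_fderiv_apply v).mul
      hφ.smooth.continuous).integrable_of_hasCompactSupport hφ.compact.mul_left
  · exact (hψ.smooth.continuous.mul
      (hφ.continuous_fderiv_apply v)).integrable_of_hasCompactSupport hψ.compact.mul_right
  · exact (hψ.smooth.continuous.mul
      hφ.smooth.continuous).integrable_of_hasCompactSupport hψ.compact.mul_right
  · exact fun x _ => hψ.smooth.differentiable (by simp) x
  · exact fun x _ => hφ.smooth.differentiable (by simp) x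

/-- Weak gradients are unique. -/
theorem IsWeakGrad.unique (hΩ : IsOpen Ω) {z : E d → ℝ} {G G' : E d → E d}
    (h : IsWeakGrad Ω z G) (h' : IsWeakGrad Ω z G') (hG : Integrable G (volume.restrict Ω))
    (hG' : Integrable G' (volume.restrict Ω)) : G =ᵐ[volume.restrict Ω] G' := by
  have hi : Integrable (fun x => G x - G' x) (volume.restrict Ω) := hG.sub hG'
  have key : ∀ᵐ x ∂volume, x ∈ Ω → G x - G' x = 0 := by
    refine hΩ.ae_eq_zero_of_integral_contDiff_smul_eq_zero (μ := volume)
      (IntegrableOn.locallyIntegrableOn hi) fun φ h1 h2 h3 => ?_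
    have hφ : IsTest Ω φ := ⟨h1, h2, h3⟩
    obtain ⟨C, hC⟩ := h1.continuous.bounded_above_of_compact_support h2
    have e0 : ∫ x, φ x • (G x - G' x) = ∫ x in Ω, φ x • (G x - G' x) :=
      (setIntegral_eq_integral_of_forall_compl_eq_zero fun x hx => by
        rw [image_eq_zero_of_notMem_tsupport fun h => hx (h3 h), zero_smul]).symm
    rw [e0]
    refine ext_inner_right ℝ fun v => ?_
    have hi' : Integrable (fun x => φ x • (G x - G' x)) (volume.restrict Ω) :=
      hi.bdd_smul C h1.continuous.aestronglyMeasurable (.of_forall hC)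
    rw [inner_zero_left, real_inner_comm, ← integral_inner hi']
    have e1 : ∀ x, inner ℝ v (φ x • (G x - G' x)) =
        φ x * inner ℝ (G x) v - φ x * inner ℝ (G' x) v := fun x => by
      rw [inner_smul_right, real_inner_comm, inner_sub_left, mul_sub]
    simp only [e1]
    rw [integral_sub (hφ.integrable_mul_inner hG v) (hφ.integrable_mul_inner hG' v)]
    linarith [h φ hφ v, h' φ hφ v]
  filter_upwards [ae_restrict_of_ae key, ae_restrict_mem hΩ.measurableSet] with x hx hm
  exact sub_eq_zero.1 (hx hm)

/-- Test pairs already form a linear subspace, so taking the span adds nothing. -/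
theorem exists_test_of_mem_span {z : L2Pair Ω}
    (hz : z ∈ Submodule.span ℝ {z : L2Pair Ω | ∃ φ : E d → ℝ, IsTest Ω φ ∧
      z.fst =ᵐ[volume.restrict Ω] φ ∧ z.snd =ᵐ[volume.restrict Ω] gradient φ}) :
    ∃ φ : E d → ℝ, IsTest Ω φ ∧
      z.fst =ᵐ[volume.restrict Ω] φ ∧ z.snd =ᵐ[volume.restrict Ω] gradient φ := by
  induction hz using Submodule.span_induction with
  | mem x h => exact h
  | zero =>
    refine ⟨0, ⟨contDiff_const, HasCompactSupport.zero, ?_⟩, Lp.coeFn_zero _ _ _, ?_⟩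
    · rw [tsupport_eq_empty_iff.2 rfl]; exact empty_subset _
    · have h0 : gradient (0 : E d → ℝ) = 0 := by
        funext x
        rw [gradient, show (0 : E d → ℝ) = fun _ => 0 from rfl, fderiv_fun_const]
        simp
      rw [h0]
      exact Lp.coeFn_zero _ _ _
  | add x y _ _ hx hy =>
    obtain ⟨φ, hφ, a1, a2⟩ := hx
    obtain ⟨ψ, hψ, b1, b2⟩ := hy
    refine ⟨fun x => φ x + ψ x, ⟨hφ.smooth.add hψ.smooth, hφ.compact.add hψ.compact,
      (tsupport_add _ _).trans (union_subset hφ.supp hψ.supp)⟩, ?_, ?_⟩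
    · filter_upwards [Lp.coeFn_add x.fst y.fst, a1, b1] with t h1 h2 h3
      rw [← h2, ← h3]; exact h1
    · filter_upwards [Lp.coeFn_add x.snd y.snd, a2, b2] with t h1 h2 h3
      have : gradient (fun x => φ x + ψ x) t = gradient φ t + gradient ψ t := by
        rw [gradient, fderiv_fun_add (hφ.smooth.differentiable (by simp) t)
          (hψ.smooth.differentiable (by simp) t), map_add]; rfl
      rw [this, ← h2, ← h3]; exact h1
  | smul c x _ hx =>
    obtain ⟨φ, hφ, a1, a2⟩ := hx
    refine ⟨fun x => c * φ x, ⟨contDiff_const.mul hφ.smooth, hφ.compact.mul_left,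
      (tsupport_mul_subset_right).trans hφ.supp⟩, ?_, ?_⟩
    · filter_upwards [Lp.coeFn_smul c x.fst, a1] with t h1 h2
      rw [← h2]; exact h1
    · filter_upwards [Lp.coeFn_smul c x.snd, a2] with t h1 h2
      have : gradient (fun x => c * φ x) t = c • gradient φ t := by
        rw [gradient, fderiv_const_mul (hφ.smooth.differentiable (by simp) t),
          map_smulₛₗ]; simp [gradient]
      rw [this, ← h2]; exact h1

theorem tendsto_L2Pair_iff {z : ℕ → L2Pair Ω} {z' : L2Pair Ω} :
    Tendsto z atTop (𝓝 z') ↔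
      Tendsto (fun n => eLpNorm (⇑(z n).fst - ⇑z'.fst) 2 (volume.restrict Ω)) atTop (𝓝 0) ∧
      Tendsto (fun n => eLpNorm (⇑(z n).snd - ⇑z'.snd) 2 (volume.restrict Ω)) atTop (𝓝 0) := by
  rw [← Lp.tendsto_Lp_iff_tendsto_eLpNorm', ← Lp.tendsto_Lp_iff_tendsto_eLpNorm']
  have h := (WithLp.homeomorphProd 2 (L2 Ω) (L2Vec Ω)).isInducing.tendsto_nhds_iff
    (f := z) (l := atTop) (y := z')
  rw [h, Prod.tendsto_iff]
  rfl

theorem mem_H1_iff_isWeakGrad {z : L2Pair Ω} : z ∈ H1 Ω ↔ IsWeakGrad Ω z.fst z.snd := mem_H1_iff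

/-- Approximation of elements of `H¹₀(Ω)` by test functions. -/
theorem exists_seq_test {z : L2Pair Ω} (hz : z ∈ H10 Ω) : ∃ φ : ℕ → E d → ℝ,
    (∀ n, IsTest Ω (φ n)) ∧
    Tendsto (fun n => eLpNorm (φ n - ⇑z.fst) 2 (volume.restrict Ω)) atTop (𝓝 0) ∧
    Tendsto (fun n => eLpNorm (gradient (φ n) - ⇑z.snd) 2 (volume.restrict Ω)) atTop (𝓝 0) ∧
    ∀ᵐ x ∂(volume.restrict Ω), Tendsto (fun n => φ n x) atTop (𝓝 (z.fst x)) := by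
  rw [H10, ← SetLike.mem_coe, Submodule.topologicalClosure_coe, mem_closure_iff_seq_limit] at hz
  obtain ⟨w, hw, hlim⟩ := hz
  choose φ hφ h1 h2 using fun n => exists_test_of_mem_span (hw n)
  obtain ⟨l1, l2⟩ := tendsto_L2Pair_iff.1 hlim
  have l1' : Tendsto (fun n => eLpNorm (φ n - ⇑z.fst) 2 (volume.restrict Ω)) atTop (𝓝 0) := by
    refine l1.congr fun n => eLpNorm_congr_ae ((h1 n).sub .rfl)
  have l2' : Tendsto (fun n => eLpNorm (gradient (φ n) - ⇑z.snd) 2 (volume.restrict Ω)) atTop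
      (𝓝 0) := by
    refine l2.congr fun n => eLpNorm_congr_ae ((h2 n).sub .rfl)
  -- Norm convergence gives almost everywhere convergence along a subsequence; the norm limits
  -- persist along it.
  obtain ⟨ns, hns, hae⟩ := (tendstoInMeasure_of_tendsto_eLpNorm (by norm_num)
    (fun n => (hφ n).memLp.1) (Lp.memLp z.fst).1 l1').exists_seq_tendsto_ae
  exact ⟨fun n => φ (ns n), fun n => hφ _, l1'.comp hns.tendsto_atTop,
    l2'.comp hns.tendsto_atTop, hae⟩

theorem eLpNorm_one_tendsto [IsFiniteMeasure (volume.restrict Ω)] {F : Type*}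
    [NormedAddCommGroup F] {f : ℕ → E d → F}
    (hm : ∀ n, AEStronglyMeasurable (f n) (volume.restrict Ω))
    (h : Tendsto (fun n => eLpNorm (f n) 2 (volume.restrict Ω)) atTop (𝓝 0)) :
    Tendsto (fun n => eLpNorm (f n) 1 (volume.restrict Ω)) atTop (𝓝 0) := by
  refine tendsto_of_tendsto_of_tendsto_of_le_of_le tendsto_const_nhds ?_ (fun _ => zero_le)
    fun n => eLpNorm_le_eLpNorm_mul_rpow_measure_univ (q := 2) (by norm_num) (hm n)
  have := ENNReal.Tendsto.mul_const (b := (volume.restrict Ω) univ ^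
    (1 / (1 : ℝ≥0∞).toReal - 1 / (2 : ℝ≥0∞).toReal)) h (Or.inr ?_)
  · simpa using this
  · exact ENNReal.rpow_ne_top_of_nonneg (by norm_num) (measure_ne_top _ _)

/-- Weak gradients survive L¹ limits, and on a set of finite measure L² convergence implies L¹
convergence. -/
theorem H10_le_H1 (hfin : volume Ω ≠ ∞) : H10 Ω ≤ H1 Ω := by
  intro z hz
  have : IsFiniteMeasure (volume.restrict Ω) := ⟨by simpa using hfin.lt_top⟩
  obtain ⟨φ, hφ, l1, l2, -⟩ := exists_seq_test hz
  rw [mem_H1_iff_isWeakGrad]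
  refine IsWeakGrad.of_tendsto (fun n => (hφ n).isWeakGrad)
    (fun n => (hφ n).memLp.integrable (by norm_num)) ((Lp.memLp _).integrable (by norm_num))
    (fun n => (hφ n).memLp_gradient.integrable (by norm_num))
    ((Lp.memLp _).integrable (by norm_num))
    (eLpNorm_one_tendsto (fun n => (hφ n).memLp.1.sub (Lp.memLp _).1) l1)
    (eLpNorm_one_tendsto (fun n => (hφ n).memLp_gradient.1.sub (Lp.memLp _).1) l2)

/-- The function `f` with the gradient `G` belongs to `H¹₀(Ω)`. -/
def InH10 (Ω : Set (E d)) (f : E d → ℝ) (G : E d → E d) : Prop :=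
  ∃ z ∈ H10 Ω, z.fst =ᵐ[volume.restrict Ω] f ∧ z.snd =ᵐ[volume.restrict Ω] G

theorem InH10.of_tendsto {f : ℕ → E d → ℝ} {G : ℕ → E d → E d} (h : ∀ n, InH10 Ω (f n) (G n))
    {f' : E d → ℝ} {G' : E d → E d} (hf' : MemLp f' 2 (volume.restrict Ω))
    (hG' : MemLp G' 2 (volume.restrict Ω))
    (hf : Tendsto (fun n => eLpNorm (fun x => f n x - f' x) 2 (volume.restrict Ω)) atTop (𝓝 0))
    (hG : Tendsto (fun n => eLpNorm (fun x => G n x - G' x) 2 (volume.restrict Ω)) atTop (𝓝 0)) :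
    InH10 Ω f' G' := by
  choose z hz h1 h2 using h
  refine ⟨WithLp.toLp 2 (hf'.toLp, hG'.toLp), ?_, hf'.coeFn_toLp, hG'.coeFn_toLp⟩
  refine (Submodule.isClosed_topologicalClosure _).mem_of_tendsto (b := atTop) (f := z)
    (tendsto_L2Pair_iff.2 ⟨?_, ?_⟩) (.of_forall hz)
  · refine hf.congr fun n => eLpNorm_congr_ae ?_
    exact ((h1 n).sub hf'.coeFn_toLp).symm
  · refine hG.congr fun n => eLpNorm_congr_ae ?_
    exact ((h2 n).sub hG'.coeFn_toLp).symm

theorem InH10.mul_test (hΩ : IsOpen Ω) (hfin : volume Ω ≠ ∞) {z : L2Pair Ω} (hz : z ∈ H1 Ω)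
    {ψ : E d → ℝ} (hψ : IsTest Ω ψ) :
    InH10 Ω (fun x => ψ x * z.fst x) fun x => ψ x • z.snd x + z.fst x • gradient ψ x := by
  obtain ⟨C, hC⟩ := hψ.smooth.continuous.bounded_above_of_compact_support hψ.compact
  obtain ⟨C', hC'⟩ := (continuous_gradient hψ.smooth).bounded_above_of_compact_support
    (hasCompactSupport_gradient hψ.compact)
  have m1 : MemLp (fun x => ψ x * z.fst x) 2 (volume.restrict Ω) :=
    (Lp.memLp z.fst).of_le_mul (c := C)
      (hψ.smooth.continuous.aestronglyMeasurable.mul (Lp.memLp _).1)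
      (.of_forall fun x => by rw [norm_mul]; gcongr; exact hC x)
  have m2 : MemLp (fun x => ψ x • z.snd x) 2 (volume.restrict Ω) :=
    (Lp.memLp z.snd).of_le_mul (c := C)
      (hψ.smooth.continuous.aestronglyMeasurable.smul (Lp.memLp _).1)
      (.of_forall fun x => by rw [norm_smul]; gcongr; exact hC x)
  have m3 : MemLp (fun x => z.fst x • gradient ψ x) 2 (volume.restrict Ω) :=
    (Lp.memLp z.fst).of_le_mul (c := C')
      ((Lp.memLp z.fst).1.smul (continuous_gradient hψ.smooth).aestronglyMeasurable)
      (.of_forall fun x => by rw [norm_smul, mul_comm]; gcongr; exact hC' x)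
  have m4 := m2.add m3
  refine ⟨WithLp.toLp 2 (m1.toLp, m4.toLp), ?_, m1.coeFn_toLp, m4.coeFn_toLp⟩
  exact mem_H10_of_mul_test hΩ hfin hz hψ m1.coeFn_toLp m4.coeFn_toLp

theorem InH10.mem {z : L2Pair Ω} (h : InH10 Ω z.fst z.snd) : z ∈ H10 Ω := by
  obtain ⟨w, hw, h1, h2⟩ := h
  have : w = z := by
    have e1 : w.fst = z.fst := Lp.ext h1
    have e2 : w.snd = z.snd := Lp.ext h2
    exact (WithLp.ofLp_injective 2) (Prod.ext e1 e2)
  exact this ▸ hw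

end PseudoParabolic

/-! ### Cutoffs, and domination by an element of H¹₀. -/

namespace PseudoParabolic

/-- A smooth cutoff that vanishes at the origin. -/
noncomputable def cutoff (a s : ℝ) : ℝ := s ^ 2 / (s ^ 2 + a)

/-- The derivative of the cutoff. -/
noncomputable def dcutoff (a s : ℝ) : ℝ := 2 * a * s / (s ^ 2 + a) ^ 2

section Cutoff

variable {a : ℝ} (ha : 0 < a)
include ha

theorem contDiff_cutoff : ContDiff ℝ (⊤ : ℕ∞) (cutoff a) := by
  unfold cutoff
  refine ContDiff.div (by fun_prop) (by fun_prop) fun s => by positivity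

theorem continuous_dcutoff : Continuous (dcutoff a) := by
  unfold dcutoff
  exact Continuous.div (by fun_prop) (by fun_prop) fun s => by positivity

theorem hasDerivAt_cutoff (s : ℝ) : HasDerivAt (cutoff a) (dcutoff a s) s := by
  have h1 : HasDerivAt (fun s : ℝ => s ^ 2) (2 * s) s := by simpa using hasDerivAt_pow 2 s
  have h : HasDerivAt (cutoff a) _ s := h1.div (h1.add_const a) (by positivity)
  convert h using 1
  unfold dcutoff
  congr 1
  ring

theorem cutoff_nonneg (s : ℝ) : 0 ≤ cutoff a s := by unfold cutoff; positivity

theorem cutoff_le_one (s : ℝ) : cutoff a s ≤ 1 := by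
  unfold cutoff
  rw [div_le_one (by positivity)]
  linarith

theorem abs_cutoff_le (s : ℝ) : |cutoff a s| ≤ 1 := by
  rw [abs_of_nonneg (cutoff_nonneg ha s)]; exact cutoff_le_one ha s

theorem abs_dcutoff_le (s : ℝ) : |dcutoff a s| ≤ 1 + 1 / a := by
  unfold dcutoff
  rw [abs_div, abs_of_pos (by positivity : 0 < (s ^ 2 + a) ^ 2), div_le_iff₀ (by positivity),
    abs_mul, abs_of_pos (by positivity : 0 < 2 * a)]
  have h1 : (1 + 1 / a) * (s ^ 2 + a) ^ 2 = (a + 1) * (s ^ 2 + a) ^ 2 / a := by field_simp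
  rw [h1, le_div_iff₀ ha]
  have hs : |s| ^ 2 = s ^ 2 := sq_abs s
  have h2 : 2 * |s| ≤ 1 + s ^ 2 := by nlinarith [sq_nonneg (|s| - 1)]
  have h3 : 1 + s ^ 2 ≤ 1 + s ^ 2 := le_rfl
  have h4 : a * a * (2 * |s|) ≤ a * a * (1 + s ^ 2) := by gcongr
  nlinarith [mul_nonneg ha.le (sq_nonneg s), mul_nonneg (sq_nonneg s) (sq_nonneg s),
    mul_nonneg (mul_nonneg ha.le (sq_nonneg s)) (sq_nonneg s),
    mul_nonneg (mul_nonneg ha.le ha.le) (sq_nonneg s), pow_pos ha 3]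

/-- The bound does not depend on `a`. It controls the term `z ∇(cutoff a w)` when `|z| ≤ C |w|`,
both as `a → 0` and as `a → ∞`. -/
theorem abs_mul_dcutoff_le (s : ℝ) : |s| * |dcutoff a s| ≤ 1 := by
  unfold dcutoff
  rw [← abs_mul, mul_div_assoc', abs_div, abs_of_pos (by positivity : 0 < (s ^ 2 + a) ^ 2),
    div_le_one (by positivity), abs_of_nonneg (by nlinarith [mul_nonneg ha.le (sq_nonneg s)])]
  nlinarith [sq_nonneg (s ^ 2), sq_nonneg a]

/-- It makes `(1 - cutoff a w) z` a bounded function when `|z| ≤ C |w|`, which reduces the general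
case to the bounded one. -/
theorem abs_mul_one_sub_cutoff_le (s : ℝ) : |s| * (1 - cutoff a s) ≤ 1 + a := by
  have : 1 - cutoff a s = a / (s ^ 2 + a) := by
    unfold cutoff; field_simp; ring
  rw [this, mul_div_assoc', div_le_iff₀ (by positivity)]
  have hs : |s| ^ 2 = s ^ 2 := sq_abs s
  nlinarith [sq_nonneg (|s| - 1), mul_nonneg ha.le (sq_nonneg (|s| - 1)),
    mul_nonneg ha.le (sq_nonneg s), sq_nonneg s]

end Cutoff

theorem cutoff_zero (a : ℝ) : cutoff a 0 = 0 := by simp [cutoff]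

theorem tendsto_cutoff_small {s : ℝ} (hs : s ≠ 0) :
    Tendsto (fun n : ℕ => cutoff (1 / ((n : ℝ) + 1)) s) atTop (𝓝 1) := by
  have h : Tendsto (fun n : ℕ => s ^ 2 / (s ^ 2 + 1 / ((n : ℝ) + 1))) atTop
      (𝓝 (s ^ 2 / (s ^ 2 + 0))) :=
    tendsto_const_nhds.div (tendsto_const_nhds.add tendsto_one_div_add_atTop_nhds_zero_nat)
      (by positivity)
  rwa [add_zero, div_self (by positivity)] at h

theorem tendsto_dcutoff_small (s : ℝ) :
    Tendsto (fun n : ℕ => dcutoff (1 / ((n : ℝ) + 1)) s) atTop (𝓝 0) := by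
  rcases eq_or_ne s 0 with rfl | hs
  · simp [dcutoff]
  · have h : Tendsto (fun n : ℕ => 2 * (1 / ((n : ℝ) + 1)) * s / (s ^ 2 + 1 / ((n : ℝ) + 1)) ^ 2)
        atTop (𝓝 (2 * 0 * s / (s ^ 2 + 0) ^ 2)) :=
      ((tendsto_one_div_add_atTop_nhds_zero_nat.const_mul 2).mul_const s).div
        ((tendsto_const_nhds.add tendsto_one_div_add_atTop_nhds_zero_nat).pow 2) (by positivity)
    simpa [dcutoff] using h

theorem tendsto_cutoff_large (s : ℝ) :
    Tendsto (fun n : ℕ => cutoff ((n : ℝ) + 1) s) atTop (𝓝 0) :=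
  tendsto_const_nhds.div_atTop (tendsto_atTop_add_const_left _ _
    (tendsto_atTop_add_const_right _ _ tendsto_natCast_atTop_atTop))

theorem tendsto_dcutoff_large (s : ℝ) :
    Tendsto (fun n : ℕ => dcutoff ((n : ℝ) + 1) s) atTop (𝓝 0) := by
  have h1 : Tendsto (fun n : ℕ => 2 * |s| * (1 / ((n : ℝ) + 1))) atTop (𝓝 0) := by
    simpa using tendsto_one_div_add_atTop_nhds_zero_nat.const_mul (2 * |s|)
  refine squeeze_zero_norm (fun n => ?_) h1
  have hn : (0 : ℝ) < (n : ℝ) + 1 := by positivity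
  rw [dcutoff, Real.norm_eq_abs, abs_div,
    abs_of_pos (by positivity : 0 < (s ^ 2 + ((n : ℝ) + 1)) ^ 2), abs_mul,
    abs_of_pos (by positivity : 0 < 2 * ((n : ℝ) + 1)), div_le_iff₀ (by positivity)]
  have : 2 * |s| * (1 / ((n : ℝ) + 1)) * (s ^ 2 + ((n : ℝ) + 1)) ^ 2 =
    2 * |s| * ((s ^ 2 + ((n : ℝ) + 1)) ^ 2 / ((n : ℝ) + 1)) := by ring
  rw [this, mul_assoc 2, mul_assoc 2, mul_comm _ |s|]
  have h2 : (n : ℝ) + 1 ≤ (s ^ 2 + ((n : ℝ) + 1)) ^ 2 / ((n : ℝ) + 1) := by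
    rw [le_div_iff₀ hn]
    nlinarith [sq_nonneg s, mul_nonneg (sq_nonneg s) hn.le, sq_nonneg (s ^ 2)]
  gcongr

variable {d : ℕ} {Ω : Set (E d)}

theorem IsTest.cutoff {φ : E d → ℝ} (hφ : IsTest Ω φ) {a : ℝ} (ha : 0 < a) :
    IsTest Ω fun x => cutoff a (φ x) :=
  ⟨(contDiff_cutoff ha).comp hφ.smooth, hφ.compact.comp_left (cutoff_zero a),
    (closure_mono (Function.support_comp_subset (cutoff_zero a) φ)).trans hφ.supp⟩

theorem IsTest.gradient_cutoff {φ : E d → ℝ} (hφ : IsTest Ω φ) {a : ℝ} (ha : 0 < a) (x : E d) :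
    gradient (fun x => PseudoParabolic.cutoff a (φ x)) x = dcutoff a (φ x) • gradient φ x := by
  have h := (hasDerivAt_cutoff ha (φ x)).comp_hasFDerivAt x
    (hφ.smooth.differentiable (by simp) x).hasFDerivAt
  have h' : fderiv ℝ (fun x => PseudoParabolic.cutoff a (φ x)) x = _ := h.fderiv
  rw [gradient, h', gradient, map_smulₛₗ]
  rfl

variable [IsFiniteMeasure (volume.restrict Ω)]

/-- The product `z ∇φ_n` limits the exponent: `∇φ_n` converges in L² only, so the limit holds in L²
for bounded `z` (`q = ∞`) and merely in L¹ for `z ∈ L²` (`q = 2`). Both cases are used. -/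
theorem tendsto_cutoff_mul {z w : L2Pair Ω} {a : ℝ} (ha : 0 < a) {φ : ℕ → E d → ℝ}
    (hφ : ∀ n, IsTest Ω (φ n))
    (hg : Tendsto (fun n => eLpNorm (gradient (φ n) - ⇑w.snd) 2 (volume.restrict Ω)) atTop (𝓝 0))
    (hae : ∀ᵐ x ∂(volume.restrict Ω), Tendsto (fun n => φ n x) atTop (𝓝 (w.fst x)))
    {q r : ℝ≥0∞} [ENNReal.HolderTriple q 2 r] (hr0 : r ≠ 0) (hr1 : 1 ≤ r) (hr : r ≠ ∞)
    (hz : MemLp z.fst q (volume.restrict Ω)) :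
    Tendsto (fun n => eLpNorm (fun x => cutoff a (φ n x) * z.fst x - cutoff a (w.fst x) * z.fst x)
      r (volume.restrict Ω)) atTop (𝓝 0) ∧
    Tendsto (fun n => eLpNorm (fun x =>
      (cutoff a (φ n x) • z.snd x + z.fst x • (dcutoff a (φ n x) • gradient (φ n) x)) -
      (cutoff a (w.fst x) • z.snd x + z.fst x • (dcutoff a (w.fst x) • w.snd x)))
      r (volume.restrict Ω)) atTop (𝓝 0) := by
  have m1 : ∀ n, AEStronglyMeasurable (fun x => cutoff a (φ n x)) (volume.restrict Ω) := fun n =>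
    ((contDiff_cutoff ha).continuous.comp (hφ n).smooth.continuous).aestronglyMeasurable
  have m1' : AEStronglyMeasurable (fun x => cutoff a (w.fst x)) (volume.restrict Ω) :=
    (contDiff_cutoff ha).continuous.comp_aestronglyMeasurable (Lp.memLp w.fst).1
  have m2 : ∀ n, AEStronglyMeasurable (fun x => dcutoff a (φ n x)) (volume.restrict Ω) := fun n =>
    ((continuous_dcutoff ha).comp (hφ n).smooth.continuous).aestronglyMeasurable
  have m2' : AEStronglyMeasurable (fun x => dcutoff a (w.fst x)) (volume.restrict Ω) :=
    (continuous_dcutoff ha).comp_aestronglyMeasurable (Lp.memLp w.fst).1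
  have l1 : ∀ᵐ x ∂(volume.restrict Ω),
      Tendsto (fun n => cutoff a (φ n x)) atTop (𝓝 (cutoff a (w.fst x))) := by
    filter_upwards [hae] with x hx
    exact ((contDiff_cutoff ha).continuous.tendsto _).comp hx
  have l2 : ∀ᵐ x ∂(volume.restrict Ω),
      Tendsto (fun n => dcutoff a (φ n x)) atTop (𝓝 (dcutoff a (w.fst x))) := by
    filter_upwards [hae] with x hx
    exact ((continuous_dcutoff ha).tendsto _).comp hx
  have h1 : MemLp (fun _ : E d => (1 : ℝ)) q (volume.restrict Ω) := memLp_const 1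
  have t1 := tendsto_eLpNorm_mul_smul_sub (r := r) hr0 hr1 hr h1 m1 m1'
    (fun n => .of_forall fun x => abs_cutoff_le ha _) (.of_forall fun x => abs_cutoff_le ha _) l1
    (H := fun _ => ⇑z.fst) (fun _ => Lp.memLp z.fst) (Lp.memLp z.fst) (by simp)
  have t2 := tendsto_eLpNorm_mul_smul_sub (r := r) hr0 hr1 hr h1 m1 m1'
    (fun n => .of_forall fun x => abs_cutoff_le ha _) (.of_forall fun x => abs_cutoff_le ha _) l1
    (H := fun _ => ⇑z.snd) (fun _ => Lp.memLp z.snd) (Lp.memLp z.snd) (by simp)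
  have t3 := tendsto_eLpNorm_mul_smul_sub (r := r) hr0 hr1 hr hz m2 m2'
    (fun n => .of_forall fun x => abs_dcutoff_le ha _) (.of_forall fun x => abs_dcutoff_le ha _) l2
    (fun n => (hφ n).memLp_gradient) (Lp.memLp w.snd) hg
  simp only [one_mul, smul_eq_mul] at t1 t2
  refine ⟨t1, ?_⟩
  have t4 := t2.add t3
  rw [add_zero] at t4
  refine tendsto_of_tendsto_of_tendsto_of_le_of_le tendsto_const_nhds t4 (fun _ => zero_le)
    fun n => ?_
  refine le_trans (le_of_eq ?_) (eLpNorm_add_le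
    (((m1 n).smul (Lp.memLp z.snd).1).sub (m1'.smul (Lp.memLp z.snd).1))
    (((hz.1.mul (m2 n)).smul (hφ n).memLp_gradient.1).sub
      ((hz.1.mul m2').smul (Lp.memLp w.snd).1)) hr1)
  congr 1
  funext x
  simp only [Pi.add_apply, Pi.sub_apply, Pi.smul_apply', Pi.mul_apply, mul_smul]
  abel

theorem InH10.isWeakGrad (hfin : volume Ω ≠ ∞) {f : E d → ℝ} {G : E d → E d}
    (h : InH10 Ω f G) : IsWeakGrad Ω f G := by
  obtain ⟨z, hz, h1, h2⟩ := h
  exact (mem_H1_iff_isWeakGrad.1 (H10_le_H1 hfin hz)).congr h1 h2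

theorem IsTest.inH10_cutoff_mul (hΩ : IsOpen Ω) (hfin : volume Ω ≠ ∞) {z : L2Pair Ω}
    (hz : z ∈ H1 Ω) {φ : E d → ℝ} (hφ : IsTest Ω φ) {a : ℝ} (ha : 0 < a) :
    InH10 Ω (fun x => PseudoParabolic.cutoff a (φ x) * z.fst x) fun x =>
      PseudoParabolic.cutoff a (φ x) • z.snd x + z.fst x • (dcutoff a (φ x) • gradient φ x) := by
  have := InH10.mul_test hΩ hfin hz (hφ.cutoff ha)
  simpa only [hφ.gradient_cutoff ha] using this

section Domination

variable {z w : L2Pair Ω} {C : ℝ} (hC : ∀ᵐ x ∂(volume.restrict Ω), |z.fst x| ≤ C * |w.fst x|)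
include hC

/-- The domination trades `z` for `w`, and `|s| * |dcutoff a s| ≤ 1` absorbs `w`; what remains is
square integrable although `z` may be unbounded. -/
theorem ae_norm_mul_dcutoff_le {a : ℝ} (ha : 0 < a) : ∀ᵐ x ∂(volume.restrict Ω),
    ‖z.fst x • (dcutoff a (w.fst x) • w.snd x)‖ ≤ |C| * ‖w.snd x‖ := by
  filter_upwards [hC] with x hx
  rw [← mul_smul, norm_smul, norm_mul, Real.norm_eq_abs, Real.norm_eq_abs]
  gcongr
  calc |z.fst x| * |dcutoff a (w.fst x)| ≤ (|C| * |w.fst x|) * |dcutoff a (w.fst x)| := by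
        gcongr
        exact hx.trans (by gcongr; exact le_abs_self C)
    _ = |C| * (|w.fst x| * |dcutoff a (w.fst x)|) := by ring
    _ ≤ |C| * 1 := by gcongr; exact abs_mul_dcutoff_le ha _
    _ = |C| := mul_one _

theorem memLp_mul_dcutoff {a : ℝ} (ha : 0 < a) :
    MemLp (fun x => z.fst x • (dcutoff a (w.fst x) • w.snd x)) 2 (volume.restrict Ω) :=
  (Lp.memLp w.snd).of_le_mul (c := |C|)
    ((Lp.memLp z.fst).1.smul (((continuous_dcutoff ha).comp_aestronglyMeasurable
      (Lp.memLp w.fst).1).smul (Lp.memLp w.snd).1)) (ae_norm_mul_dcutoff_le hC ha)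

omit [IsFiniteMeasure (volume.restrict Ω)] hC in
theorem memLp_cutoff_smul {F : Type*} [NormedAddCommGroup F] [NormedSpace ℝ F] {f : E d → F}
    (hf : MemLp f 2 (volume.restrict Ω)) (w : L2 Ω) {a : ℝ} (ha : 0 < a) :
    MemLp (fun x => cutoff a (w x) • f x) 2 (volume.restrict Ω) :=
  hf.of_le (((contDiff_cutoff ha).continuous.comp_aestronglyMeasurable (Lp.memLp w).1).smul hf.1)
    (.of_forall fun x => by
      rw [norm_smul]
      exact mul_le_of_le_one_left (norm_nonneg _) (abs_cutoff_le ha _))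

/-- For test functions `φ_n → w`, the products `cutoff a (φ_n) z` lie in H¹₀, and boundedness of `z`
makes them converge there to `cutoff a (w) z`. As `a → 0` the cutoff tends to 1 where `w ≠ 0`, and
where `w = 0` the domination forces `z = 0`. -/
theorem mem_H10_of_bounded_of_le (hΩ : IsOpen Ω) (hfin : volume Ω ≠ ∞) (hz : z ∈ H1 Ω)
    (hw : w ∈ H10 Ω) {B : ℝ} (hB : ∀ᵐ x ∂(volume.restrict Ω), |z.fst x| ≤ B) : z ∈ H10 Ω := by
  obtain ⟨φ, hφ, -, hg, hae⟩ := exists_seq_test hw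
  have hzB : MemLp z.fst ∞ (volume.restrict Ω) := memLp_top_of_bound (Lp.memLp z.fst).1 B hB
  have m1 : ∀ {a : ℝ}, 0 < a → MemLp (fun x => cutoff a (w.fst x) • z.snd x +
      z.fst x • (dcutoff a (w.fst x) • w.snd x)) 2 (volume.restrict Ω) := fun ha =>
    (memLp_cutoff_smul (Lp.memLp z.snd) w.fst ha).add (memLp_mul_dcutoff hC ha)
  have h1 : ∀ {a : ℝ}, 0 < a → InH10 Ω (fun x => cutoff a (w.fst x) * z.fst x)
      fun x => cutoff a (w.fst x) • z.snd x + z.fst x • (dcutoff a (w.fst x) • w.snd x) := by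
    intro a ha
    obtain ⟨t1, t2⟩ := tendsto_cutoff_mul (q := ∞) (r := 2) ha hφ hg hae (by norm_num)
      (by norm_num) (by norm_num) hzB
    exact InH10.of_tendsto (fun n => (hφ n).inH10_cutoff_mul hΩ hfin hz ha)
      (memLp_cutoff_smul (Lp.memLp z.fst) w.fst ha) (m1 ha) t1 t2
  -- The gradients converge to `∇z` on this set and to zero off it.
  set s : Set (E d) := {x | w.fst x ≠ 0}
  have hs : MeasurableSet s := (Lp.stronglyMeasurable w.fst).measurable
    (measurableSet_singleton (0 : ℝ)).compl
  have hsz : MemLp (s.indicator z.snd) 2 (volume.restrict Ω) := (Lp.memLp z.snd).indicator hs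
  have hpos : ∀ n : ℕ, (0 : ℝ) < 1 / ((n : ℝ) + 1) := fun n => by positivity
  have mc : ∀ n : ℕ, AEStronglyMeasurable (fun x => cutoff (1 / ((n : ℝ) + 1)) (w.fst x))
      (volume.restrict Ω) := fun n =>
    (contDiff_cutoff (hpos n)).continuous.comp_aestronglyMeasurable (Lp.memLp w.fst).1
  have h2 : InH10 Ω z.fst (s.indicator z.snd) := by
    refine InH10.of_tendsto (fun n : ℕ => h1 (hpos n)) (Lp.memLp _) hsz ?_ ?_
    · refine tendsto_eLpNorm_zero_of_dominated (b := fun x => |z.fst x|) (by norm_num)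
        (by norm_num) (fun n => ((mc n).mul (Lp.memLp _).1).sub (Lp.memLp _).1)
        (Lp.memLp z.fst).norm (fun n => .of_forall fun x => ?_) ?_
      · rw [← sub_one_mul, norm_mul, Real.norm_eq_abs, Real.norm_eq_abs]
        refine mul_le_of_le_one_left (abs_nonneg _) ?_
        rw [abs_le]
        constructor <;> linarith [cutoff_nonneg (hpos n) (w.fst x), cutoff_le_one (hpos n) (w.fst x)]
      · filter_upwards [hC] with x hx
        by_cases h0 : w.fst x = 0
        · have : z.fst x = 0 := by
            rw [h0, abs_zero, mul_zero] at hx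
            exact abs_nonpos_iff.1 hx
          simp [this]
        · simpa using ((tendsto_cutoff_small h0).mul_const (z.fst x)).sub_const (z.fst x)
    · refine tendsto_eLpNorm_zero_of_dominated
        (b := fun x => 2 * ‖z.snd x‖ + |C| * ‖w.snd x‖) (by norm_num)
        (by norm_num) (fun n => (m1 (hpos n)).1.sub hsz.1)
        (((Lp.memLp z.snd).norm.const_mul 2).add ((Lp.memLp w.snd).norm.const_mul |C|))
        (fun n => ?_) (.of_forall fun x => ?_)
      · filter_upwards [ae_norm_mul_dcutoff_le hC (hpos n)] with x hx
        have i1 : ‖cutoff (1 / ((n : ℝ) + 1)) (w.fst x) • z.snd x‖ ≤ ‖z.snd x‖ := by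
          rw [norm_smul]
          exact mul_le_of_le_one_left (norm_nonneg _) (abs_cutoff_le (hpos n) _)
        have i2 : ‖s.indicator z.snd x‖ ≤ ‖z.snd x‖ := norm_indicator_le_norm_self _ _
        refine (norm_sub_le _ _).trans ?_
        linarith [norm_add_le (cutoff (1 / ((n : ℝ) + 1)) (w.fst x) • z.snd x)
          (z.fst x • (dcutoff (1 / ((n : ℝ) + 1)) (w.fst x) • w.snd x))]
      · have d0 := ((tendsto_dcutoff_small (w.fst x)).smul_const (w.snd x)).const_smul (z.fst x)
        by_cases h0 : w.fst x = 0
        · have hx : x ∉ s := fun h => h h0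
          simp only [h0, cutoff_zero, indicator_of_notMem hx] at d0 ⊢
          simpa using d0
        · have hx : x ∈ s := h0
          simp only [indicator_of_mem hx]
          simpa using (((tendsto_cutoff_small h0).smul_const (z.snd x)).add d0).sub_const (z.snd x)
  -- The limit pair is in H¹₀, so its second component is a weak gradient of `z`; uniqueness
  -- identifies it with `∇z`, and no separate argument for the zero set of `w` is needed.
  have h3 : s.indicator z.snd =ᵐ[volume.restrict Ω] z.snd :=
    (h2.isWeakGrad hfin).unique hΩ (mem_H1_iff_isWeakGrad.1 hz)
      (hsz.integrable (by norm_num)) ((Lp.memLp z.snd).integrable (by norm_num))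
  obtain ⟨y, hy, e1, e2⟩ := h2
  exact InH10.mem ⟨y, hy, e1, e2.trans h3⟩

/-- An element of `H¹(Ω)` that is dominated by an element of `H¹₀(Ω)` belongs to `H¹₀(Ω)`. -/
theorem mem_H10_of_le (hΩ : IsOpen Ω) (hfin : volume Ω ≠ ∞) (hz : z ∈ H1 Ω)
    (hw : w ∈ H10 Ω) : z ∈ H10 Ω := by
  obtain ⟨φ, hφ, -, hg, hae⟩ := exists_seq_test hw
  have m0 : ∀ {a : ℝ}, 0 < a → MemLp (fun x => cutoff a (w.fst x) * z.fst x) 2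
    (volume.restrict Ω) := fun ha => memLp_cutoff_smul (Lp.memLp z.fst) w.fst ha
  have m1 : ∀ {a : ℝ}, 0 < a → MemLp (fun x => cutoff a (w.fst x) • z.snd x +
      z.fst x • (dcutoff a (w.fst x) • w.snd x)) 2 (volume.restrict Ω) := fun ha =>
    (memLp_cutoff_smul (Lp.memLp z.snd) w.fst ha).add (memLp_mul_dcutoff hC ha)
  -- Without a bound on `z` the products converge in L¹ only: enough to identify the weak gradient,
  -- not to stay in H¹₀.
  have h1 : ∀ {a : ℝ}, 0 < a → IsWeakGrad Ω (fun x => cutoff a (w.fst x) * z.fst x)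
      fun x => cutoff a (w.fst x) • z.snd x + z.fst x • (dcutoff a (w.fst x) • w.snd x) := by
    intro a ha
    obtain ⟨t1, t2⟩ := tendsto_cutoff_mul (q := 2) (r := 1) ha hφ hg hae (by norm_num)
      (by norm_num) (by norm_num) (Lp.memLp z.fst)
    have hin := fun n => (hφ n).inH10_cutoff_mul hΩ hfin hz ha
    have i0 : ∀ {F : Type} [NormedAddCommGroup F] {f : E d → F} {y : Lp F 2 (volume.restrict Ω)},
        y =ᵐ[volume.restrict Ω] f → Integrable f (volume.restrict Ω) := fun h =>
      ((Lp.memLp _).integrable (by norm_num)).congr h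
    exact IsWeakGrad.of_tendsto (fun n => (hin n).isWeakGrad hfin)
      (fun n => let ⟨_, _, e, _⟩ := hin n; i0 e) ((m0 ha).integrable (by norm_num))
      (fun n => let ⟨_, _, _, e⟩ := hin n; i0 e) ((m1 ha).integrable (by norm_num)) t1 t2
  -- The remainder `(1 - cutoff a w) z` is in H¹, still dominated by `w`, and bounded by `|C| (1 +
  -- a)`; the bounded case applies.
  have h2 : ∀ {a : ℝ}, 0 < a → InH10 Ω (fun x => z.fst x - cutoff a (w.fst x) * z.fst x)
      fun x => z.snd x -
        (cutoff a (w.fst x) • z.snd x + z.fst x • (dcutoff a (w.fst x) • w.snd x)) := by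
    intro a ha
    set y : L2Pair Ω := z - WithLp.toLp 2 ((m0 ha).toLp, (m1 ha).toLp) with hy
    have y1 : y.fst =ᵐ[volume.restrict Ω] fun x => z.fst x - cutoff a (w.fst x) * z.fst x :=
      (Lp.coeFn_sub z.fst (m0 ha).toLp).trans (Filter.EventuallyEq.rfl.sub (m0 ha).coeFn_toLp)
    have y2 : y.snd =ᵐ[volume.restrict Ω] fun x => z.snd x -
        (cutoff a (w.fst x) • z.snd x + z.fst x • (dcutoff a (w.fst x) • w.snd x)) :=
      (Lp.coeFn_sub z.snd (m1 ha).toLp).trans (Filter.EventuallyEq.rfl.sub (m1 ha).coeFn_toLp)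
    have hyH : y ∈ H1 Ω := by
      refine (H1 Ω).sub_mem hz ?_
      rw [mem_H1_iff_isWeakGrad]
      exact (h1 ha).congr (m0 ha).coeFn_toLp.symm (m1 ha).coeFn_toLp.symm
    have hfac : ∀ x, |z.fst x - cutoff a (w.fst x) * z.fst x| =
        |z.fst x| * (1 - cutoff a (w.fst x)) := fun x => by
      rw [← one_sub_mul, abs_mul, mul_comm,
        abs_of_nonneg (by linarith [cutoff_le_one ha (w.fst x)] : 0 ≤ 1 - cutoff a (w.fst x))]
    refine ⟨y, ?_, y1, y2⟩
    refine mem_H10_of_bounded_of_le (C := C) (w := w) (B := |C| * (1 + a)) ?_ hΩ hfin hyH hw ?_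
    · filter_upwards [hC, y1] with x hx hx1
      rw [hx1, hfac]
      refine le_trans (mul_le_of_le_one_right (abs_nonneg _) ?_) hx
      linarith [cutoff_nonneg ha (w.fst x)]
    · filter_upwards [hC, y1] with x hx hx1
      rw [hx1, hfac]
      have h0 : 0 ≤ 1 - cutoff a (w.fst x) := by linarith [cutoff_le_one ha (w.fst x)]
      calc |z.fst x| * (1 - cutoff a (w.fst x))
          ≤ (|C| * |w.fst x|) * (1 - cutoff a (w.fst x)) := by
            gcongr
            exact hx.trans (by gcongr; exact le_abs_self C)
        _ = |C| * (|w.fst x| * (1 - cutoff a (w.fst x))) := by ring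
        _ ≤ |C| * (1 + a) := by gcongr; exact abs_mul_one_sub_cutoff_le ha _
  -- Now `a = n + 1 → ∞`: the cutoff tends to zero and the remainder to `z`.
  have hpos : ∀ n : ℕ, (0 : ℝ) < (n : ℝ) + 1 := fun n => by positivity
  refine InH10.mem (InH10.of_tendsto (fun n : ℕ => h2 (hpos n)) (Lp.memLp _) (Lp.memLp _) ?_ ?_)
  · refine tendsto_eLpNorm_zero_of_dominated (b := fun x => |z.fst x|) (by norm_num)
      (by norm_num) (fun n => ((Lp.memLp _).1.sub (m0 (hpos n)).1).sub (Lp.memLp _).1)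
      (Lp.memLp z.fst).norm (fun n => .of_forall fun x => ?_) (.of_forall fun x => ?_)
    · rw [sub_sub_cancel_left, norm_neg, norm_mul, Real.norm_eq_abs, Real.norm_eq_abs]
      exact mul_le_of_le_one_left (abs_nonneg _) (abs_cutoff_le (hpos n) _)
    · simpa using ((tendsto_cutoff_large (w.fst x)).mul_const (z.fst x)).neg
  · refine tendsto_eLpNorm_zero_of_dominated
      (b := fun x => ‖z.snd x‖ + |C| * ‖w.snd x‖) (by norm_num)
      (by norm_num) (fun n => ((Lp.memLp _).1.sub (m1 (hpos n)).1).sub (Lp.memLp _).1)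
      ((Lp.memLp z.snd).norm.add ((Lp.memLp w.snd).norm.const_mul |C|))
      (fun n => ?_) (.of_forall fun x => ?_)
    · filter_upwards [ae_norm_mul_dcutoff_le hC (hpos n)] with x hx
      rw [sub_sub_cancel_left, norm_neg]
      refine (norm_add_le _ _).trans (add_le_add ?_ hx)
      rw [norm_smul]
      exact mul_le_of_le_one_left (norm_nonneg _) (abs_cutoff_le (hpos n) _)
    · have d0 := ((tendsto_dcutoff_large (w.fst x)).smul_const (w.snd x)).const_smul (z.fst x)
      simpa [sub_sub_cancel_left] using
        (((tendsto_cutoff_large (w.fst x)).smul_const (z.snd x)).add d0).neg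

end Domination

end PseudoParabolic

/-! ### Bordered operators, Gronwall's inequality, integral equations in Banach spaces. -/

namespace PseudoParabolic

section Saddle

variable {V : Type*} [NormedAddCommGroup V] [InnerProductSpace ℝ V]

/-- The operator `(x, h) ↦ (B x - h p, ⟪w, x⟫)`. -/
noncomputable def saddle (B : V →L[ℝ] V) (p w : V) : V × ℝ →L[ℝ] V × ℝ :=
  (B ∘L .fst ℝ V ℝ - (ContinuousLinearMap.snd ℝ V ℝ).smulRight p).prod
    (innerSL ℝ w ∘L .fst ℝ V ℝ)

theorem saddle_apply (B : V →L[ℝ] V) (p w : V) (z : V × ℝ) :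
    saddle B p w z = (B z.1 - z.2 • p, inner ℝ w z.1) := rfl

/-- Lax–Milgram for the bilinear form `⟪B u, v⟫`. -/
theorem bijective_of_coercive [CompleteSpace V] {B : V →L[ℝ] V} {c : ℝ} (hc : 0 < c)
    (hB : ∀ x, c * ‖x‖ ^ 2 ≤ inner ℝ (B x) x) : Function.Bijective B := by
  have hco : IsCoercive ((innerSL ℝ : V →L[ℝ] V →L[ℝ] ℝ) ∘L B) :=
    ⟨c, hc, fun u => by
      have := hB u
      rw [sq, ← mul_assoc] at this
      exact this⟩
  have : ⇑B = ⇑hco.continuousLinearEquivOfBilin := by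
    funext v
    refine ext_inner_right ℝ fun w => ?_
    rw [hco.continuousLinearEquivOfBilin_apply]
    rfl
  rw [this]
  exact hco.continuousLinearEquivOfBilin.bijective

/-- Elimination of `x`: with `B q = p` the first row gives `x = B⁻¹ y + h q`, and the second row
becomes the scalar equation `h ⟪w, q⟫ = m - ⟪w, B⁻¹ y⟫`. Quantifying over all solutions of `B x = p`
avoids naming the inverse. -/
theorem isUnit_saddle [CompleteSpace V] {B : V →L[ℝ] V} {p w : V} {c : ℝ} (hc : 0 < c)
    (hB : ∀ x, c * ‖x‖ ^ 2 ≤ inner ℝ (B x) x) (hp : ∀ x, B x = p → inner ℝ w x ≠ 0) :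
    IsUnit (saddle B p w) := by
  obtain ⟨hinj, hsurj⟩ := bijective_of_coercive hc hB
  rw [ContinuousLinearMap.isUnit_iff_bijective]
  obtain ⟨q, hq⟩ := hsurj p
  have hq0 := hp q hq
  constructor
  · rw [injective_iff_map_eq_zero]
    rintro ⟨x, h⟩ hx
    rw [saddle_apply, Prod.mk_eq_zero] at hx
    obtain ⟨h1, h2⟩ := hx
    have hxq : x = h • q := hinj (by rw [map_smul, hq]; exact sub_eq_zero.1 h1)
    simp only [hxq, inner_smul_right] at h2
    have h0 : h = 0 := (mul_eq_zero.1 h2).resolve_right hq0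
    simp [hxq, h0]
  · rintro ⟨y, m⟩
    obtain ⟨x, hx⟩ := hsurj y
    refine ⟨(x + ((m - inner ℝ w x) / inner ℝ w q) • q, (m - inner ℝ w x) / inner ℝ w q), ?_⟩
    rw [saddle_apply, Prod.mk.injEq]
    constructor
    · simp [hx, hq]
    · rw [inner_add_right, inner_smul_right, div_mul_cancel₀ _ hq0]
      ring

theorem continuousOn_saddle {s : Set ℝ} {B : ℝ → V →L[ℝ] V} {p : ℝ → V} (w : V)
    (hB : ContinuousOn B s) (hp : ContinuousOn p s) :
    ContinuousOn (fun t => saddle (B t) (p t) w) s := by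
  have h1 : ContinuousOn (fun t => B t ∘L .fst ℝ V ℝ -
      (ContinuousLinearMap.snd ℝ V ℝ).smulRight (p t)) s :=
    (hB.clm_comp continuousOn_const).sub
      ((ContinuousLinearMap.smulRightL ℝ (V × ℝ) V (.snd ℝ V ℝ)).continuous.comp_continuousOn hp)
  exact (ContinuousLinearMap.prodₗᵢ (𝕜 := ℝ) ℝ).continuous.comp_continuousOn
    (h1.prodMk continuousOn_const)

theorem continuousOn_ringInverse {R : Type*} [NormedRing R] [HasSummableGeomSeries R] {s : Set ℝ}
    {A : ℝ → R} (hA : ContinuousOn A s) (hu : ∀ t ∈ s, IsUnit (A t)) :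
    ContinuousOn (fun t => Ring.inverse (A t)) s := by
  intro t ht
  obtain ⟨x, hx⟩ := hu t ht
  have := NormedRing.inverse_continuousAt x
  rw [hx] at this
  exact this.comp_continuousWithinAt (hA t ht)

end Saddle

section Gronwall

/-- With the weight `exp (2 K s)`, integrating a Lipschitz bound with constant `K` gains the factor
1/2; this serves both Gronwall and the contraction. -/
theorem integral_mul_exp (K t : ℝ) :
    ∫ s in (0 : ℝ)..t, K * Real.exp (2 * K * s) = (Real.exp (2 * K * t) - 1) / 2 := by
  have h : ∀ s : ℝ, HasDerivAt (fun s => Real.exp (2 * K * s) / 2) (K * Real.exp (2 * K * s)) s := by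
    intro s
    have := (((hasDerivAt_id s).const_mul (2 * K)).exp).div_const 2
    convert! this using 1
    simp
    ring
  rw [intervalIntegral.integral_eq_sub_of_hasDerivAt (fun s _ => h s)
    (Continuous.intervalIntegrable (by fun_prop) _ _)]
  simp
  ring

/-- Gronwall's inequality in integral form. -/
theorem le_of_le_add_integral {T K C : ℝ} (hK : 0 ≤ K) (hC : 0 ≤ C) {φ : ℝ → ℝ}
    (hφ : ContinuousOn φ (Icc 0 T))
    (h : ∀ t ∈ Icc 0 T, φ t ≤ C + K * ∫ s in (0 : ℝ)..t, φ s) :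
    ∀ t ∈ Icc 0 T, φ t ≤ 2 * C * Real.exp (2 * K * T) := by
  intro t ht
  have hT : 0 ≤ T := ht.1.trans ht.2
  -- The maximum `N` of the weighted function bounds `φ` by `N exp (2 K s)`. Inserting this in the
  -- hypothesis at the maximum point bounds `N` itself.
  have hcont : ContinuousOn (fun s => Real.exp (-(2 * K * s)) * φ s) (Icc 0 T) :=
    ContinuousOn.mul (Continuous.continuousOn (by fun_prop)) hφ
  obtain ⟨r, hr, hmax⟩ := isCompact_Icc.exists_isMaxOn (nonempty_Icc.2 hT) hcont
  set N := Real.exp (-(2 * K * r)) * φ r with hN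
  have hle : ∀ s ∈ Icc 0 T, φ s ≤ N * Real.exp (2 * K * s) := by
    intro s hs
    have h1 : Real.exp (-(2 * K * s)) * φ s ≤ N := hmax hs
    calc φ s = (Real.exp (-(2 * K * s)) * φ s) * Real.exp (2 * K * s) := by
          rw [mul_right_comm, ← Real.exp_add]; simp
      _ ≤ _ := by gcongr
  have hN2 : N ≤ 2 * C := by
    have h1 := h r hr
    have h2 : ∫ s in (0 : ℝ)..r, φ s ≤ ∫ s in (0 : ℝ)..r, N * Real.exp (2 * K * s) := by
      refine intervalIntegral.integral_mono_on hr.1 ?_ (Continuous.intervalIntegrable (by fun_prop) _ _)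
        fun s hs => hle s ⟨hs.1, hs.2.trans hr.2⟩
      exact (hφ.mono (by rw [uIcc_of_le hr.1]; exact Icc_subset_Icc_right hr.2)).intervalIntegrable
    have h3 : K * ∫ s in (0 : ℝ)..r, N * Real.exp (2 * K * s) =
        N * ((Real.exp (2 * K * r) - 1) / 2) := by
      rw [← integral_mul_exp, ← intervalIntegral.integral_const_mul,
        ← intervalIntegral.integral_const_mul]
      congr 1
      funext s
      ring
    have h4 : φ r = N * Real.exp (2 * K * r) := by
      rw [hN, mul_right_comm, ← Real.exp_add]; simp
    have h5 : N * Real.exp (2 * K * r) ≤ C + N * ((Real.exp (2 * K * r) - 1) / 2) := by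
      rw [← h4, ← h3]
      exact h1.trans (by gcongr)
    by_contra hlt
    rw [not_le] at hlt
    have h6 : 1 ≤ Real.exp (2 * K * r) := Real.one_le_exp (by have := hr.1; positivity)
    nlinarith
  calc φ t ≤ N * Real.exp (2 * K * t) := hle t ht
    _ ≤ 2 * C * Real.exp (2 * K * T) := by
      gcongr
      exact ht.2

end Gronwall

section Existence

variable {V : Type*} [NormedAddCommGroup V] [NormedSpace ℝ V] [CompleteSpace V]

/-- Existence for an integral equation with a Lipschitz right-hand side. -/
theorem exists_integral_solution {G : ℝ → V → V} {T K : ℝ} (hT : 0 ≤ T) (hK : 0 ≤ K) (x₀ : V)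
    (hG : ∀ t ∈ Icc 0 T, ∀ x y, ‖G t x - G t y‖ ≤ K * ‖x - y‖)
    (hint : ∀ x : ℝ → V, Continuous x → IntervalIntegrable (fun s => G s (x s)) volume 0 T) :
    ∃ u : ℝ → V, Continuous u ∧ ∀ t ∈ Icc 0 T, u t = x₀ + ∫ s in (0 : ℝ)..t, G s (u s) := by
  -- The unknown is `z s = exp (-2 K s) u s`, so the sup norm of `z` is an exponentially weighted
  -- norm of `u` and the map is a contraction on the whole interval, whatever `T`. Continuity of `G`
  -- in time is not required, only integrability along continuous curves.
  set ext : C(Icc (0 : ℝ) T, V) → ℝ → V := fun z s => Real.exp (2 * K * s) • z (projIcc 0 T hT s)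
    with hext
  have hextc : ∀ z, Continuous (ext z) := fun z =>
    Continuous.smul (by fun_prop) (z.continuous.comp continuous_projIcc)
  have hprim : ∀ z, ContinuousOn (fun t => ∫ s in (0 : ℝ)..t, G s (ext z s)) (Icc 0 T) := fun z => by
    have := intervalIntegral.continuousOn_primitive_interval
      (f := fun s => G s (ext z s)) (a := 0) (b := T) (μ := volume)
      (by rw [uIcc_of_le hT, integrableOn_Icc_iff_integrableOn_Ioc]
          exact (intervalIntegrable_iff_integrableOn_Ioc_of_le hT).1 (hint _ (hextc z)))
    rwa [uIcc_of_le hT] at this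
  let Ψ : C(Icc (0 : ℝ) T, V) → C(Icc (0 : ℝ) T, V) := fun z =>
    ⟨fun t => Real.exp (-(2 * K * t)) • (x₀ + ∫ s in (0 : ℝ)..t, G s (ext z s)),
      Continuous.smul (by fun_prop) (continuous_const.add
        (continuousOn_iff_continuous_restrict.1 (hprim z)))⟩
  have hsub : ∀ z, ∀ t ∈ Icc 0 T, IntervalIntegrable (fun s => G s (ext z s)) volume 0 t :=
    fun z t ht => (hint _ (hextc z)).mono_set (by
      rw [uIcc_of_le hT, uIcc_of_le ht.1]; exact Icc_subset_Icc_right ht.2)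
  have hcontr : ContractingWith (1 / 2) Ψ := by
    refine ⟨by rw [← NNReal.coe_lt_coe]; norm_num, LipschitzWith.of_dist_le_mul fun z z' => ?_⟩
    rw [ContinuousMap.dist_le (by positivity)]
    intro t
    rw [dist_eq_norm]
    simp only [Ψ, ContinuousMap.coe_mk]
    rw [← smul_sub, add_sub_add_left_eq_sub, ← intervalIntegral.integral_sub
      (hsub z t t.2) (hsub z' t t.2), norm_smul, Real.norm_eq_abs, Real.abs_exp]
    have h1 : ‖∫ s in (0 : ℝ)..t, (G s (ext z s) - G s (ext z' s))‖ ≤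
        ∫ s in (0 : ℝ)..t, (K * Real.exp (2 * K * s)) * dist z z' := by
      refine intervalIntegral.norm_integral_le_of_norm_le t.2.1 (.of_forall fun s hs => ?_)
        (Continuous.intervalIntegrable (by fun_prop) _ _)
      refine (hG s ⟨hs.1.le, hs.2.trans t.2.2⟩ _ _).trans ?_
      rw [hext]
      simp only
      rw [← smul_sub, norm_smul, Real.norm_eq_abs, Real.abs_exp, mul_assoc K, ← dist_eq_norm]
      have := ContinuousMap.dist_apply_le_dist (f := z) (g := z') (projIcc 0 T hT s)
      gcongr
    rw [intervalIntegral.integral_mul_const, integral_mul_exp] at h1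
    calc Real.exp (-(2 * K * t)) * ‖∫ s in (0 : ℝ)..t, (G s (ext z s) - G s (ext z' s))‖
        ≤ Real.exp (-(2 * K * t)) * ((Real.exp (2 * K * t) - 1) / 2 * dist z z') := by gcongr
      _ = (1 - Real.exp (-(2 * K * t))) / 2 * dist z z' := by
          have : Real.exp (-(2 * K * t)) * Real.exp (2 * K * t) = 1 := by
            rw [← Real.exp_add]; simp
          linear_combination (dist z z' / 2) * this
      _ ≤ ((1 / 2 : ℝ≥0) : ℝ) * dist z z' := by
          gcongr
          push_cast
          linarith [Real.exp_pos (-(2 * K * (t : ℝ)))]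
  have : Nonempty C(Icc (0 : ℝ) T, V) := ⟨0⟩
  set z := hcontr.fixedPoint
  have hz : Ψ z = z := hcontr.fixedPoint_isFixedPt
  refine ⟨ext z, hextc z, fun t ht => ?_⟩
  have h1 : Ψ z ⟨t, ht⟩ = z ⟨t, ht⟩ := by rw [hz]
  have h2 : ext z t = Real.exp (2 * K * t) • z ⟨t, ht⟩ := by
    rw [hext]; simp only; rw [projIcc_of_mem hT ht]
  rw [h2, ← h1]
  simp only [Ψ, ContinuousMap.coe_mk]
  rw [smul_smul, ← Real.exp_add]
  simp

end Existence

end PseudoParabolic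

/-! ### The time grid, averages over its cells, and Rothe functions. -/

namespace PseudoParabolic
namespace Data

variable {d : ℕ} (D : Data d)

section Nodes

variable {D} (hT : 0 < D.T) {n : ℕ} (hn : 0 < n)
include hT hn

theorem step_pos : 0 < D.step n := div_pos hT (by exact_mod_cast hn)

theorem node_self : D.node n n = D.T := by
  unfold node step
  have : (n : ℝ) ≠ 0 := by exact_mod_cast hn.ne'
  field_simp

omit hT hn in
theorem node_zero : D.node n 0 = 0 := by simp [node]

omit hT hn in
theorem node_succ (i : ℕ) : D.node n (i + 1) = D.node n i + D.step n := by
  simp [node]; ring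

theorem node_lt_succ (i : ℕ) : D.node n i < D.node n (i + 1) := by
  rw [node_succ]; linarith [step_pos hT hn]

theorem node_mono : Monotone (D.node n) :=
  monotone_nat_of_le_succ fun i => (node_lt_succ hT hn i).le

theorem node_nonneg (i : ℕ) : 0 ≤ D.node n i := by
  rw [← node_zero (D := D) (n := n)]; exact node_mono hT hn (Nat.zero_le i)

theorem node_mem {i : ℕ} (hi : i ≤ n) : D.node n i ∈ Icc 0 D.T :=
  ⟨node_nonneg hT hn i, by rw [← node_self hT hn]; exact node_mono hT hn hi⟩

theorem index_eq {i : ℕ} {s : ℝ} (hs : s ∈ Ioc (D.node n i) (D.node n (i + 1))) :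
    D.index n s = i + 1 := by
  have hτ := step_pos hT hn
  unfold index
  rw [Nat.ceil_eq_iff (by omega)]
  simp only [Nat.add_sub_cancel]
  rw [lt_div_iff₀ hτ, div_le_iff₀ hτ]
  exact hs

theorem exists_index {s : ℝ} (hs : s ∈ Ioc 0 D.T) :
    ∃ i < n, s ∈ Ioc (D.node n i) (D.node n (i + 1)) ∧ D.index n s = i + 1 := by
  have hτ := step_pos hT hn
  have h0 : 0 < s / D.step n := div_pos hs.1 hτ
  have hpos : 0 < D.index n s := Nat.ceil_pos.2 h0
  obtain ⟨i, hi⟩ := Nat.exists_eq_succ_of_ne_zero hpos.ne'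
  have hmem : s ∈ Ioc (D.node n i) (D.node n (i + 1)) := by
    have := (Nat.ceil_eq_iff (n := i + 1) (by omega)).1 hi
    simp only [Nat.add_sub_cancel] at this
    rwa [lt_div_iff₀ hτ, div_le_iff₀ hτ] at this
  refine ⟨i, ?_, hmem, hi⟩
  by_contra h
  have h1 := node_mono hT hn (not_lt.1 h)
  rw [node_self hT hn] at h1
  linarith [hmem.1, hs.2]

omit hT hn in
theorem measurable_index : Measurable (D.index n) :=
  Nat.measurable_ceil.comp (measurable_id.div_const _)

end Nodes

theorem integral_Ioo_eq (hT : 0 < D.T) {F : Type*} [NormedAddCommGroup F] [NormedSpace ℝ F]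
    (f : ℝ → F) : ∫ s in Ioo 0 D.T, f s = ∫ s in (0 : ℝ)..D.T, f s := by
  rw [intervalIntegral.integral_of_le hT.le, integral_Ioc_eq_integral_Ioo]

theorem intervalIntegrable_iff_Ioo (hT : 0 < D.T) {F : Type*} [NormedAddCommGroup F]
    {f : ℝ → F} :
    IntervalIntegrable f volume 0 D.T ↔ Integrable f (volume.restrict (Ioo 0 D.T)) :=
  intervalIntegrable_iff_integrableOn_Ioo_of_le hT.le

theorem intervalIntegrable_of_mem (hT : 0 < D.T) {F : Type*} [NormedAddCommGroup F]
    {f : ℝ → F} (hf : Integrable f (volume.restrict (Ioo 0 D.T))) {a b : ℝ}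
    (ha : a ∈ Icc 0 D.T) (hb : b ∈ Icc 0 D.T) : IntervalIntegrable f volume a b :=
  ((D.intervalIntegrable_iff_Ioo hT).2 hf).mono_set (by
    rw [uIcc_of_le hT.le]; exact uIcc_subset_Icc ha hb)

theorem integrable_of_memLp {F : Type*} [NormedAddCommGroup F] {f : ℝ → F}
    (hf : MemLp f 2 (volume.restrict (Ioo 0 D.T))) :
    Integrable f (volume.restrict (Ioo 0 D.T)) := hf.integrable (by norm_num)

theorem continuousOn_primitive (hT : 0 < D.T) {F : Type*} [NormedAddCommGroup F] [NormedSpace ℝ F]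
    {f : ℝ → F} (hf : Integrable f (volume.restrict (Ioo 0 D.T))) :
    ContinuousOn (fun t => ∫ s in (0 : ℝ)..t, f s) (Icc 0 D.T) := by
  have := intervalIntegral.continuousOn_primitive_interval (a := 0) (b := D.T) (μ := volume)
    (f := f) (by
      rw [uIcc_of_le hT.le, integrableOn_Icc_iff_integrableOn_Ioo]
      exact hf)
  rwa [uIcc_of_le hT.le] at this

/-- A function that is constant on the subintervals. -/
theorem integrable_piecewise (hT : 0 < D.T) {n : ℕ} (hn : 0 < n) {F : Type*}
    [NormedAddCommGroup F] (z : ℕ → F) :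
    MemLp (fun s => z (D.index n s)) 2 (volume.restrict (Ioo 0 D.T)) := by
  have hm : StronglyMeasurable fun s => z (D.index n s) :=
    (StronglyMeasurable.of_discrete (f := z)).comp_measurable measurable_index
  refine MemLp.of_bound hm.aestronglyMeasurable (∑ i ∈ Finset.range (n + 1), ‖z i‖) ?_
  filter_upwards [ae_restrict_mem measurableSet_Ioo] with s hs
  obtain ⟨i, hi, -, h⟩ := exists_index hT hn ⟨hs.1, hs.2.le⟩
  rw [h]
  exact Finset.single_le_sum (f := fun i => ‖z i‖) (fun _ _ => norm_nonneg _)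
    (Finset.mem_range.2 (by omega))

theorem integral_piecewise (hT : 0 < D.T) {n : ℕ} (hn : 0 < n) {F : Type*}
    [NormedAddCommGroup F] [NormedSpace ℝ F] [CompleteSpace F] (z : ℕ → F) {i : ℕ} {s : ℝ}
    (hs : s ∈ Icc (D.node n i) (D.node n (i + 1))) :
    ∫ r in D.node n i..s, z (D.index n r) = (s - D.node n i) • z (i + 1) := by
  rw [← intervalIntegral.integral_const]
  refine intervalIntegral.integral_congr_ae (.of_forall fun r hr => ?_)
  rw [uIoc_of_le hs.1] at hr
  rw [index_eq hT hn ⟨hr.1, hr.2.trans hs.2⟩]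

theorem integral_eq_sum (hT : 0 < D.T) {n : ℕ} (hn : 0 < n) {F : Type*}
    [NormedAddCommGroup F] [NormedSpace ℝ F] {f : ℝ → F}
    (hf : Integrable f (volume.restrict (Ioo 0 D.T))) {k : ℕ} (hk : k ≤ n) :
    ∫ s in (0 : ℝ)..D.node n k, f s =
      ∑ i ∈ Finset.range k, ∫ s in D.node n i..D.node n (i + 1), f s := by
  rw [intervalIntegral.sum_integral_adjacent_intervals fun i hi =>
    D.intervalIntegrable_of_mem hT hf (node_mem hT hn (by omega)) (node_mem hT hn (by omega)),
    node_zero]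

/-- The average of `w` over the subinterval ending at `t_i`. -/
noncomputable def average (n : ℕ) (w : ℝ → ℝ) (i : ℕ) : ℝ :=
  (D.step n)⁻¹ * ∫ s in D.node n (i - 1)..D.node n i, w s

/-- Averaging is a contraction in L²: on each cell, with mean `A`, the integral of `(w - A)²` is
that of `w²` minus `τ A²`, and it is nonnegative. -/
theorem integral_sq_average_le (hT : 0 < D.T) {n : ℕ} (hn : 0 < n) {w : ℝ → ℝ}
    (hw : MemLp w 2 (volume.restrict (Ioo 0 D.T))) :
    ∫ s in (0 : ℝ)..D.T, (D.average n w (D.index n s)) ^ 2 ≤ ∫ s in (0 : ℝ)..D.T, w s ^ 2 := by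
  have hτ := step_pos hT hn
  have h1 := D.integral_eq_sum hT hn hw.integrable_sq le_rfl
  have h2 := D.integral_eq_sum hT hn
    (D.integrable_piecewise hT hn (D.average n w)).integrable_sq le_rfl
  rw [node_self hT hn] at h1 h2
  rw [h1, h2]
  refine Finset.sum_le_sum fun i hi => ?_
  rw [Finset.mem_range] at hi
  have m1 := node_mem hT hn hi.le
  have m2 := node_mem hT hn (Nat.succ_le_of_lt hi)
  have e1 := D.integral_piecewise hT hn (fun j => D.average n w j ^ 2) (i := i)
    (right_mem_Icc.2 (node_lt_succ hT hn i).le)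
  rw [e1, node_succ, add_sub_cancel_left, smul_eq_mul, ← node_succ]
  set A := D.average n w (i + 1) with hA
  have hA' : ∫ s in D.node n i..D.node n (i + 1), w s = D.step n * A := by
    rw [hA, average, Nat.add_sub_cancel]
    field_simp
  have i1 := D.intervalIntegrable_of_mem hT hw.integrable_sq m1 m2
  have i2 := D.intervalIntegrable_of_mem hT (D.integrable_of_memLp hw) m1 m2
  have h3 : 0 ≤ ∫ s in D.node n i..D.node n (i + 1), (w s - A) ^ 2 :=
    intervalIntegral.integral_nonneg (node_lt_succ hT hn i).le fun s _ => sq_nonneg _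
  have h4 : ∫ s in D.node n i..D.node n (i + 1), (w s - A) ^ 2 =
      (∫ s in D.node n i..D.node n (i + 1), w s ^ 2) - D.step n * A ^ 2 := by
    have e : ∀ s, (w s - A) ^ 2 = w s ^ 2 - 2 * A * w s + A ^ 2 := fun s => by ring
    simp only [e]
    rw [intervalIntegral.integral_add (i1.sub (i2.const_mul _)) (by simp),
      intervalIntegral.integral_sub i1 (i2.const_mul _), intervalIntegral.integral_const_mul,
      hA', intervalIntegral.integral_const, node_succ, smul_eq_mul]
    ring
  linarith

theorem average_sub (hT : 0 < D.T) {n : ℕ} (hn : 0 < n) {w w' : ℝ → ℝ}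
    (hw : Integrable w (volume.restrict (Ioo 0 D.T)))
    (hw' : Integrable w' (volume.restrict (Ioo 0 D.T))) {i : ℕ} (hi : i ≤ n) :
    D.average n (fun s => w s - w' s) i = D.average n w i - D.average n w' i := by
  have m1 := node_mem hT hn hi
  have m2 := node_mem hT hn ((Nat.sub_le i 1).trans hi)
  unfold average
  rw [intervalIntegral.integral_sub (D.intervalIntegrable_of_mem hT hw m2 m1)
    (D.intervalIntegrable_of_mem hT hw' m2 m1), mul_sub]

theorem tendsto_step : Tendsto D.step atTop (𝓝 0) :=
  tendsto_const_nhds.div_atTop tendsto_natCast_atTop_atTop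

/-- Uniform continuity on `[0,T]` at the scale of the time step. -/
theorem eventually_dist_le (hT : 0 < D.T) {F : Type*} [PseudoMetricSpace F] {c : ℝ → F}
    (hc : ContinuousOn c (Icc 0 D.T)) {ε : ℝ} (hε : 0 < ε) :
    ∀ᶠ n in atTop, ∀ r ∈ Icc 0 D.T, ∀ s ∈ Icc 0 D.T, |r - s| ≤ D.step n →
      dist (c r) (c s) ≤ ε := by
  have huc := isCompact_Icc.uniformContinuousOn_of_continuous hc
  obtain ⟨δ, hδ, h⟩ := Metric.uniformContinuousOn_iff.1 huc ε hε
  have h1 : ∀ᶠ n in atTop, D.step n < δ := D.tendsto_step.eventually_lt_const hδ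
  filter_upwards [h1] with n hn r hr s hs hrs
  exact (h r hr s hs (by rw [Real.dist_eq]; linarith)).le

/-- Piecewise averages converge in `L²`. -/
theorem tendsto_average (hT : 0 < D.T) {w : ℝ → ℝ}
    (hw : MemLp w 2 (volume.restrict (Ioo 0 D.T))) :
    Tendsto (fun n => ∫ s in (0 : ℝ)..D.T, (D.average n w (D.index n s) - w s) ^ 2) atTop
      (𝓝 0) := by
  rw [Metric.tendsto_atTop]
  intro ε hε
  -- Approximate `w` by a continuous `c` within `η` in L². The budget is `3 η²` for `w - c`, `3 η²`
  -- for its averages, and `3 T η²` for the distance of `c` from its averages.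
  obtain ⟨η, hη, hηε⟩ : ∃ η > 0, 6 * η ^ 2 + 3 * D.T * η ^ 2 < ε := by
    have hlim : Tendsto (fun η : ℝ => 6 * η ^ 2 + 3 * D.T * η ^ 2) (𝓝[>] 0) (𝓝 0) := by
      have : Continuous fun η : ℝ => 6 * η ^ 2 + 3 * D.T * η ^ 2 := by fun_prop
      simpa using (this.tendsto 0).mono_left nhdsWithin_le_nhds
    obtain ⟨η, h1, h2⟩ := ((hlim.eventually_lt_const hε).and self_mem_nhdsWithin).exists
    exact ⟨η, h2, h1⟩
  obtain ⟨c, hc, hcL⟩ := hw.exists_boundedContinuous_eLpNorm_sub_le (by norm_num)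
    (ε := ENNReal.ofReal η) (by simpa using hη)
  have hwc : MemLp (fun s => w s - c s) 2 (volume.restrict (Ioo 0 D.T)) := hw.sub hcL
  have hsq : ∫ s in (0 : ℝ)..D.T, (w s - c s) ^ 2 ≤ η ^ 2 := by
    rw [← D.integral_Ioo_eq hT]
    have h1 := hwc.eLpNorm_eq_integral_rpow_norm (by norm_num) (by norm_num)
    have h2 : eLpNorm (fun s => w s - c s) 2 (volume.restrict (Ioo 0 D.T)) ≤ ENNReal.ofReal η := hc
    rw [h1, ENNReal.ofReal_le_ofReal_iff hη.le] at h2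
    have h3 : ∫ s in Ioo 0 D.T, ‖w s - c s‖ ^ (2 : ℝ≥0∞).toReal =
        ∫ s in Ioo 0 D.T, (w s - c s) ^ 2 := by
      refine integral_congr_ae (.of_forall fun s => ?_)
      simp
    rw [h3] at h2
    have h0 : 0 ≤ ∫ s in Ioo 0 D.T, (w s - c s) ^ 2 := integral_nonneg fun s => sq_nonneg _
    rw [ENNReal.toReal_ofNat, ← one_div, ← Real.sqrt_eq_rpow] at h2
    exact (Real.sqrt_le_left hη.le).1 h2
  have hev := D.eventually_dist_le hT c.continuous.continuousOn hη
  obtain ⟨N, hN⟩ := eventually_atTop.1 hev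
  refine ⟨max N 1, fun n hnN => ?_⟩
  have hn : 0 < n := lt_of_lt_of_le one_pos ((le_max_right _ _).trans hnN)
  have hτ := step_pos hT hn
  have hcont := hN n ((le_max_left _ _).trans hnN)
  have hpw := fun z : ℕ → ℝ => D.integrable_piecewise hT hn z
  have hnonneg : 0 ≤ ∫ s in (0 : ℝ)..D.T, (D.average n w (D.index n s) - w s) ^ 2 :=
    intervalIntegral.integral_nonneg hT.le fun s _ => sq_nonneg _
  rw [Real.dist_eq, sub_zero, abs_of_nonneg hnonneg]
  refine lt_of_le_of_lt ?_ hηε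
  have hcavg : ∀ s ∈ Ioc 0 D.T, |D.average n c (D.index n s) - c s| ≤ η := by
    intro s hs
    obtain ⟨i, hi, hsi, hidx⟩ := exists_index hT hn hs
    have m1 := node_mem hT hn hi.le
    have m2 := node_mem hT hn (Nat.succ_le_of_lt hi)
    have e1 : D.average n c (i + 1) - c s =
        (D.step n)⁻¹ * ∫ r in D.node n i..D.node n (i + 1), (c r - c s) := by
      rw [intervalIntegral.integral_sub (c.continuous.intervalIntegrable _ _) (by simp),
        intervalIntegral.integral_const, average, Nat.add_sub_cancel, node_succ,
        add_sub_cancel_left, smul_eq_mul]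
      field_simp
    have e2 : ‖∫ r in D.node n i..D.node n (i + 1), (c r - c s)‖ ≤
        η * |D.node n (i + 1) - D.node n i| := by
      refine intervalIntegral.norm_integral_le_of_norm_le_const fun r hr => ?_
      rw [uIoc_of_le (node_lt_succ hT hn i).le] at hr
      rw [← dist_eq_norm]
      refine hcont r ⟨m1.1.trans hr.1.le, hr.2.trans m2.2⟩ s ⟨hs.1.le, hs.2⟩ ?_
      have := node_succ (D := D) (n := n) i
      rw [abs_le]
      constructor <;> linarith [hr.1, hr.2, hsi.1, hsi.2]
    rw [node_succ, add_sub_cancel_left, abs_of_pos hτ, ← node_succ] at e2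
    rw [hidx, e1, abs_mul, abs_of_pos (inv_pos.2 hτ), inv_mul_le_iff₀ hτ, mul_comm]
    exact e2
  have hptw : ∀ s ∈ Ioc 0 D.T, (D.average n w (D.index n s) - w s) ^ 2 ≤
      3 * (D.average n (fun s => w s - c s) (D.index n s)) ^ 2 + 3 * η ^ 2 +
        3 * (w s - c s) ^ 2 := by
    intro s hs
    obtain ⟨i, hi, -, hidx⟩ := exists_index hT hn hs
    have h1 := hcavg s hs
    rw [hidx] at h1 ⊢
    rw [D.average_sub hT hn (D.integrable_of_memLp hw) (D.integrable_of_memLp hcL) (by omega)]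
    have h2 : (D.average n c (i + 1) - c s) ^ 2 ≤ η ^ 2 := sq_le_sq' (by linarith [neg_le_of_abs_le h1])
      (le_of_abs_le h1)
    nlinarith [sq_nonneg ((D.average n w (i + 1) - D.average n c (i + 1)) -
      (D.average n c (i + 1) - c s)), sq_nonneg ((D.average n w (i + 1) - D.average n c (i + 1)) +
      (w s - c s)), sq_nonneg ((D.average n c (i + 1) - c s) + (w s - c s))]
  have ii1 := (D.intervalIntegrable_iff_Ioo hT).2
    (hpw (D.average n fun s => w s - c s)).integrable_sq
  have ii2 := (D.intervalIntegrable_iff_Ioo hT).2 hwc.integrable_sq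
  have ii3 := (D.intervalIntegrable_iff_Ioo hT).2
    ((hpw (D.average n w)).sub hw).integrable_sq
  have hle := intervalIntegral.integral_mono_on_of_le_Ioo hT.le ii3
    (((ii1.const_mul 3).add (by simp : IntervalIntegrable (fun _ => 3 * η ^ 2) volume 0 D.T)).add
      (ii2.const_mul 3)) (fun s hs => hptw s ⟨hs.1, hs.2.le⟩)
  refine hle.trans ?_
  rw [intervalIntegral.integral_add ((ii1.const_mul 3).add (by simp)) (ii2.const_mul 3),
    intervalIntegral.integral_add (ii1.const_mul 3) (by simp),
    intervalIntegral.integral_const_mul, intervalIntegral.integral_const_mul,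
    intervalIntegral.integral_const_mul, intervalIntegral.integral_const, sub_zero, smul_eq_mul]
  have := D.integral_sq_average_le hT hn hwc
  linarith

theorem diffQuot_eq_average (hT : 0 < D.T) {m w : ℝ → ℝ} (hm : HasL2TimeDeriv D.T m w) {n : ℕ}
    (hn : 0 < n) {i : ℕ} (hi : i < n) :
    D.diffQuot n (fun j => m (D.node n j)) i = D.average n w (i + 1) := by
  have m1 := node_mem hT hn hi.le
  have m2 := node_mem hT hn (Nat.succ_le_of_lt hi)
  have m0 : (0 : ℝ) ∈ Icc 0 D.T := left_mem_Icc.2 hT.le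
  have hi := D.integrable_of_memLp hm.1
  rw [diffQuot, average, Nat.add_sub_cancel, hm.2 _ m1, hm.2 _ m2, smul_eq_mul,
    add_sub_add_left_eq_sub, intervalIntegral.integral_interval_sub_left
      (D.intervalIntegrable_of_mem hT hi m0 m2) (D.intervalIntegrable_of_mem hT hi m0 m1)]

theorem rotheLinear_eq (hT : 0 < D.T) {n : ℕ} (hn : 0 < n) (u : ℕ → H10 D.Ω) {i : ℕ} {s : ℝ}
    (hs : s ∈ Ioc (D.node n i) (D.node n (i + 1))) :
    D.rotheLinear n u s = u i + (s - D.node n i) • D.diffQuot n u i := by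
  have h0 : ¬ s ≤ 0 := not_le.2 (lt_of_le_of_lt (node_nonneg hT hn i) hs.1)
  rw [rotheLinear, if_neg h0, index_eq hT hn hs, Nat.add_sub_cancel]

theorem diffQuot_smul_step (hT : 0 < D.T) {n : ℕ} (hn : 0 < n) {X : Type*} [AddCommGroup X]
    [Module ℝ X] (u : ℕ → X) (i : ℕ) : D.step n • D.diffQuot n u i = u (i + 1) - u i := by
  rw [diffQuot, smul_smul, mul_inv_cancel₀ (step_pos hT hn).ne', one_smul]

/-- The piecewise linear Rothe function is the primitive of its derivative. -/
theorem rotheLinear_eq_integral (hT : 0 < D.T) {n : ℕ} (hn : 0 < n) (u : ℕ → H10 D.Ω) {t : ℝ}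
    (ht : t ∈ Icc 0 D.T) :
    D.rotheLinear n u t = u 0 + ∫ s in (0 : ℝ)..t, D.rotheDeriv n u s := by
  have hint : Integrable (D.rotheDeriv n u) (volume.restrict (Ioo 0 D.T)) :=
    D.integrable_of_memLp (D.integrable_piecewise hT hn fun i => D.diffQuot n u (i - 1))
  have m0 : (0 : ℝ) ∈ Icc 0 D.T := left_mem_Icc.2 hT.le
  rcases ht.1.eq_or_lt with h0 | h0
  · rw [← h0, rotheLinear, if_pos le_rfl, intervalIntegral.integral_same, add_zero]
  · obtain ⟨i, hi, hti, -⟩ := exists_index hT hn ⟨h0, ht.2⟩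
    have m1 := node_mem hT hn hi.le
    have hpc := fun (i : ℕ) (s : ℝ) (hs : s ∈ Icc (D.node n i) (D.node n (i + 1))) =>
      D.integral_piecewise hT hn (fun i => D.diffQuot n u (i - 1)) hs
    rw [D.rotheLinear_eq hT hn u hti, ← intervalIntegral.integral_add_adjacent_intervals
      (D.intervalIntegrable_of_mem hT hint m0 m1) (D.intervalIntegrable_of_mem hT hint m1 ht),
      D.integral_eq_sum hT hn hint hi.le]
    -- On a full cell the integral of the derivative is the increment of `u`, and the sum
    -- telescopes.
    have h1 : ∀ j ∈ Finset.range i, ∫ s in D.node n j..D.node n (j + 1), D.rotheDeriv n u s =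
        u (j + 1) - u j := fun j _ => by
      have := hpc j _ (right_mem_Icc.2 (node_lt_succ hT hn j).le)
      rw [node_succ, add_sub_cancel_left, Nat.add_sub_cancel, D.diffQuot_smul_step hT hn,
        ← node_succ] at this
      exact this
    rw [Finset.sum_congr rfl h1, Finset.sum_range_sub u]
    have h2 := hpc i t ⟨hti.1.le, hti.2⟩
    rw [Nat.add_sub_cancel] at h2
    rw [show ∫ s in D.node n i..t, D.rotheDeriv n u s = _ from h2]
    abel

end Data
end PseudoParabolic

/-! ### From a pointwise error estimate to the convergence of the Rothe functions. -/

namespace PseudoParabolic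
namespace Data

variable {d : ℕ} (D : Data d)

theorem integrable_inner_of_memLp {α : Type*} [MeasurableSpace α] {μ : Measure α} {F : Type*}
    [NormedAddCommGroup F] [InnerProductSpace ℝ F] {f g : α → F} (hf : MemLp f 2 μ)
    (hg : MemLp g 2 μ) : Integrable (fun x => inner ℝ (f x) (g x)) μ :=
  (hf.norm.integrable_mul hg.norm).mono' (hf.1.inner hg.1)
    (.of_forall fun x => norm_inner_le_norm _ _)

theorem memLp_one_add_abs {μ : ℝ → ℝ} (hμ : MemLp μ 2 (volume.restrict (Ioo 0 D.T))) :
    MemLp (fun s => 1 + |μ s|) 2 (volume.restrict (Ioo 0 D.T)) := by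
  have h1 : MemLp (fun _ : ℝ => (1 : ℝ)) 2 (volume.restrict (Ioo 0 D.T)) := memLp_const 1
  exact h1.add hμ.norm

section Remainder

variable {D} (hT : 0 < D.T) {μ : ℝ → ℝ} (hμ : MemLp μ 2 (volume.restrict (Ioo 0 D.T)))
include hT hμ

/-- A remainder that is bounded by the approximation error of piecewise averages tends to zero. -/
theorem tendsto_remainder {F : Type*} [NormedAddCommGroup F] {q : ℕ → ℝ → F} {C : ℝ}
    (hC : 0 ≤ C)
    (hq : ∀ ε : ℝ, 0 < ε → ∀ᶠ n in atTop, ∀ᵐ s ∂(volume.restrict (Ioo 0 D.T)),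
      ‖q n s‖ ≤ ε * (1 + |μ s|) + C * |D.average n μ (D.index n s) - μ s|)
    {F' : Type*} [NormedAddCommGroup F'] {g : ℝ → F'}
    (hg : MemLp g 2 (volume.restrict (Ioo 0 D.T))) :
    Tendsto (fun n => ∫ s in Ioo 0 D.T, ‖q n s‖ * ‖g s‖) atTop (𝓝 0) := by
  set I1 := ∫ s in Ioo 0 D.T, (1 + |μ s|) * ‖g s‖ with hI1
  set I2 := ∫ s in Ioo 0 D.T, ‖g s‖ ^ 2 with hI2
  have h10 : 0 ≤ I1 := integral_nonneg fun s => by positivity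
  have h20 : 0 ≤ I2 := integral_nonneg fun s => by positivity
  rw [Metric.tendsto_atTop']
  intro ε hε
  set η := ε / (2 * (I1 + C * I2 + 1)) with hη
  have hden : 0 < I1 + C * I2 + 1 := by positivity
  have hη0 : 0 < η := by positivity
  have hlim := (D.tendsto_average hT hμ).const_mul (C / η)
  rw [mul_zero] at hlim
  have hev := ((hq η hη0).and (hlim.eventually_lt_const (half_pos hε))).and (eventually_gt_atTop 0)
  obtain ⟨N, hN⟩ := eventually_atTop.1 hev
  refine ⟨N, fun n hn => ?_⟩
  obtain ⟨⟨h1, h2⟩, hn0⟩ := hN n hn.le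
  have m1 : MemLp (fun s => 1 + |μ s|) 2 (volume.restrict (Ioo 0 D.T)) :=
    D.memLp_one_add_abs hμ
  have m2 : MemLp (fun s => D.average n μ (D.index n s) - μ s) 2 (volume.restrict (Ioo 0 D.T)) :=
    (D.integrable_piecewise hT hn0 _).sub hμ
  have i1 : Integrable (fun s => (1 + |μ s|) * ‖g s‖) (volume.restrict (Ioo 0 D.T)) :=
    m1.integrable_mul hg.norm
  have i2 := m2.integrable_sq
  have i3 : Integrable (fun s => ‖g s‖ ^ 2) (volume.restrict (Ioo 0 D.T)) := hg.norm.integrable_sq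
  have h0 : 0 ≤ ∫ s in Ioo 0 D.T, ‖q n s‖ * ‖g s‖ := integral_nonneg fun s => by positivity
  rw [Real.dist_eq, sub_zero, abs_of_nonneg h0]
  have hle : ∫ s in Ioo 0 D.T, ‖q n s‖ * ‖g s‖ ≤ ∫ s in Ioo 0 D.T,
      (η * ((1 + |μ s|) * ‖g s‖) +
        ((C / η) * (D.average n μ (D.index n s) - μ s) ^ 2 + (C * η) * ‖g s‖ ^ 2)) := by
    refine integral_mono_of_nonneg (.of_forall fun s => by positivity)
      ((i1.const_mul _).add ((i2.const_mul _).add (i3.const_mul _))) ?_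
    filter_upwards [h1] with s hs
    set x := D.average n μ (D.index n s) - μ s
    have hxg : |x| * ‖g s‖ ≤ x ^ 2 / η + η * ‖g s‖ ^ 2 := by
      rw [← sq_abs x]
      have : 0 ≤ (|x| / η - ‖g s‖) ^ 2 * η := by positivity
      have e : (|x| / η - ‖g s‖) ^ 2 * η = |x| ^ 2 / η - 2 * (|x| * ‖g s‖) + η * ‖g s‖ ^ 2 := by
        field_simp
        ring
      have : 0 ≤ |x| * ‖g s‖ := by positivity
      linarith
    calc ‖q n s‖ * ‖g s‖ ≤ (η * (1 + |μ s|) + C * |x|) * ‖g s‖ := by gcongr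
      _ = η * ((1 + |μ s|) * ‖g s‖) + C * (|x| * ‖g s‖) := by ring
      _ ≤ η * ((1 + |μ s|) * ‖g s‖) + C * (x ^ 2 / η + η * ‖g s‖ ^ 2) := by gcongr
      _ = _ := by ring
  have i4 : Integrable (fun s => (C / η) * (D.average n μ (D.index n s) - μ s) ^ 2 +
      (C * η) * ‖g s‖ ^ 2) (volume.restrict (Ioo 0 D.T)) := (i2.const_mul _).add (i3.const_mul _)
  rw [integral_add (i1.const_mul _) i4, integral_add (i2.const_mul _) (i3.const_mul _), integral_const_mul, integral_const_mul,
    integral_const_mul, D.integral_Ioo_eq hT (fun s => (D.average n μ (D.index n s) - μ s) ^ 2),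
    ← hI1, ← hI2] at hle
  have h3 : η * I1 + C * η * I2 < ε / 2 := by
    have : η * (I1 + C * I2 + 1) = ε / 2 := by rw [hη]; field_simp
    nlinarith
  linarith

end Remainder

set_option maxHeartbeats 400000 in
/-- Convergence of the Rothe functions from a pointwise error estimate. -/
theorem rotheConverges_of_estimate (hT : 0 < D.T) {μ : ℝ → ℝ}
    (hμ : MemLp μ 2 (volume.restrict (Ioo 0 D.T)))
    {U : ℕ → ℕ → H10 D.Ω} {H : ℕ → ℕ → ℝ} {u ut : ℝ → H10 D.Ω} {h : ℝ → ℝ}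
    (hu : ContinuousOn u (Icc 0 D.T)) (hut : HasL2TimeDeriv D.T u ut)
    (hh : MemLp h 2 (volume.restrict (Ioo 0 D.T)))
    (hinit : ∀ n : ℕ, 0 < n → U n 0 = u 0) {C : ℝ} (hC : 0 ≤ C)
    (hest : ∀ ε : ℝ, 0 < ε → ∀ᶠ n in atTop, ∀ᵐ s ∂(volume.restrict (Ioo 0 D.T)),
      ‖D.rotheDeriv n (U n) s - ut s‖ ≤ C * ‖D.rotheLinear n (U n) s - u s‖ +
        (ε * (1 + |μ s|) + C * |D.average n μ (D.index n s) - μ s|) ∧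
      ‖D.rotheConst n (H n) s - h s‖ ≤ C * ‖D.rotheLinear n (U n) s - u s‖ +
        (ε * (1 + |μ s|) + C * |D.average n μ (D.index n s) - μ s|)) :
    D.RotheConverges U H u ut h := by
  have hderiv : ∀ n, 0 < n → MemLp (D.rotheDeriv n (U n)) 2 (volume.restrict (Ioo 0 D.T)) :=
    fun n hn => D.integrable_piecewise hT hn fun i => D.diffQuot n (U n) (i - 1)
  have hsrc : ∀ n, 0 < n → MemLp (D.rotheConst n (H n)) 2 (volume.restrict (Ioo 0 D.T)) :=
    fun n hn => D.integrable_piecewise hT hn (H n)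
  have m0 : (0 : ℝ) ∈ Icc 0 D.T := left_mem_Icc.2 hT.le
  -- The initial values agree, so the error is the primitive of the error of the derivatives; the
  -- estimate then closes a Gronwall loop.
  have herr : ∀ n, 0 < n → ∀ t ∈ Icc 0 D.T, D.rotheLinear n (U n) t - u t =
      ∫ s in (0 : ℝ)..t, (D.rotheDeriv n (U n) s - ut s) := by
    intro n hn t ht
    rw [intervalIntegral.integral_sub
      (D.intervalIntegrable_of_mem hT (D.integrable_of_memLp (hderiv n hn)) m0 ht)
      (D.intervalIntegrable_of_mem hT (D.integrable_of_memLp hut.1) m0 ht),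
      D.rotheLinear_eq_integral hT hn (U n) ht, hut.2 t ht, hinit n hn]
    abel
  have herrc : ∀ n, 0 < n →
      ContinuousOn (fun t => ‖D.rotheLinear n (U n) t - u t‖) (Icc 0 D.T) := by
    intro n hn
    refine ContinuousOn.norm ?_
    have := D.continuousOn_primitive hT (f := fun s => D.rotheDeriv n (U n) s - ut s)
      ((D.integrable_of_memLp (hderiv n hn)).sub (D.integrable_of_memLp hut.1))
    exact this.congr fun t ht => herr n hn t ht
  set R : ℝ → ℕ → ℝ → ℝ := fun ε n s =>
    ε * (1 + |μ s|) + C * |D.average n μ (D.index n s) - μ s| with hR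
  have hRm : ∀ ε n, 0 < n → MemLp (R ε n) 2 (volume.restrict (Ioo 0 D.T)) := fun ε n hn =>
    ((D.memLp_one_add_abs hμ).const_mul ε).add
      ((((D.integrable_piecewise hT hn _).sub hμ).norm).const_mul C)
  have hR0 : ∀ ε n s, 0 ≤ ε → 0 ≤ R ε n s := fun ε n s hε => by rw [hR]; positivity
  -- uniform convergence in the norm of the Sobolev space
  have hunif : ∀ δ : ℝ, 0 < δ → ∀ᶠ n in atTop, ∀ t ∈ Icc 0 D.T, ‖D.rotheLinear n (U n) t - u t‖ ≤ δ := by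
    intro δ hδ
    set I1 := ∫ s in Ioo 0 D.T, (1 + |μ s|) with hI1
    have h10 : 0 ≤ I1 := integral_nonneg fun s => by positivity
    set X := Real.exp (2 * C * D.T) with hX
    have hX0 : 0 < X := Real.exp_pos _
    -- Gronwall bounds the error by `2 E X`, where `E` has two parts; this choice and the smallness
    -- of the averaging error make each at most `δ / (4 X)`.
    set ε := δ / (4 * X * (I1 + 1)) with hε
    have hε0 : 0 < ε := by positivity
    have hrem := tendsto_remainder hT hμ (C := C)
      (q := fun n s => C * |D.average n μ (D.index n s) - μ s|) hC
      (fun ε hε => .of_forall fun n => .of_forall fun s => by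
        rw [Real.norm_eq_abs, abs_of_nonneg (by positivity)]
        have : 0 ≤ ε * (1 + |μ s|) := by positivity
        linarith) (g := fun _ => (1 : ℝ)) (memLp_const 1)
    simp only [norm_one, mul_one] at hrem
    have hev := ((hest ε hε0).and (hrem.eventually_lt_const
      (by positivity : 0 < δ / (4 * X)))).and (eventually_gt_atTop 0)
    filter_upwards [hev] with n ⟨⟨h1, h2⟩, hn⟩ t ht
    have i1 := D.integrable_of_memLp (hRm ε n hn)
    set E := ∫ s in (0 : ℝ)..D.T, R ε n s with hE
    have hE0 : 0 ≤ E := intervalIntegral.integral_nonneg hT.le fun s _ => hR0 ε n s hε0.le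
    have hgr := le_of_le_add_integral (T := D.T) hC hE0 (herrc n hn) (fun t ht => by
      rw [herr n hn t ht]
      have hsub : Ioc 0 t ⊆ Ioc 0 D.T := Ioc_subset_Ioc_right ht.2
      have i2 : IntervalIntegrable (fun s => ‖D.rotheLinear n (U n) s - u s‖) volume 0 t :=
        ((herrc n hn).mono (by
          rw [uIcc_of_le ht.1]; exact Icc_subset_Icc_right ht.2)).intervalIntegrable
      have i3 := D.intervalIntegrable_of_mem hT i1 m0 ht
      have hb := intervalIntegral.norm_integral_le_of_norm_le (a := 0) (b := t) ht.1
        (f := fun s => D.rotheDeriv n (U n) s - ut s)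
        (g := fun s => R ε n s + C * ‖D.rotheLinear n (U n) s - u s‖) (μ := volume) (by
          have h1' := (ae_restrict_iff' measurableSet_Ioo).1 h1
          filter_upwards [h1', Ioo_ae_eq_Ioc (μ := volume) (a := (0 : ℝ)) (b := D.T)]
            with s hs hs' hmem
          have : s ∈ Ioo 0 D.T := (eq_iff_iff.1 hs').2 (hsub hmem)
          have := (hs this).1
          linarith) (i3.add (i2.const_mul C))
      refine hb.trans ?_
      rw [intervalIntegral.integral_add i3 (i2.const_mul C), intervalIntegral.integral_const_mul]
      gcongr
      rw [hE, ← intervalIntegral.integral_add_adjacent_intervals i3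
        (D.intervalIntegrable_of_mem hT i1 ht (right_mem_Icc.2 hT.le))]
      have := intervalIntegral.integral_nonneg (μ := volume) ht.2
        (fun s _ => hR0 ε n s hε0.le)
      linarith) t ht
    refine hgr.trans ?_
    have hEle : E ≤ ε * I1 + δ / (4 * X) := by
      rw [hE, ← D.integral_Ioo_eq hT, hR]
      simp only
      have j1 : Integrable (fun s => 1 + |μ s|) (volume.restrict (Ioo 0 D.T)) :=
        D.integrable_of_memLp (D.memLp_one_add_abs hμ)
      have j2 : Integrable (fun s => C * |D.average n μ (D.index n s) - μ s|)
          (volume.restrict (Ioo 0 D.T)) :=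
        D.integrable_of_memLp ((((D.integrable_piecewise hT hn _).sub hμ).norm).const_mul C)
      rw [integral_add (j1.const_mul ε) j2, integral_const_mul, ← hI1]
      have e : ∫ s in Ioo 0 D.T, ‖C * |D.average n μ (D.index n s) - μ s|‖ =
          ∫ s in Ioo 0 D.T, C * |D.average n μ (D.index n s) - μ s| :=
        integral_congr_ae (.of_forall fun s => by
          simp only [Real.norm_eq_abs]
          exact abs_of_nonneg (by positivity))
      rw [e] at h2
      linarith
    have h3 : ε * I1 ≤ δ / (4 * X) := by
      rw [hε, div_mul_eq_mul_div, div_le_div_iff₀ (by positivity) (by positivity)]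
      have : 0 ≤ δ * (4 * X) := by positivity
      nlinarith
    calc 2 * E * X ≤ 2 * (δ / (4 * X) + δ / (4 * X)) * X := by gcongr; linarith
      _ = δ := by field_simp; norm_num
  -- the remainders of the time derivatives and of the sources
  have hrem : ∀ {F : Type} [NormedAddCommGroup F] {q : ℕ → ℝ → F},
      (∀ ε : ℝ, 0 < ε → ∀ᶠ n in atTop, ∀ᵐ s ∂(volume.restrict (Ioo 0 D.T)),
        ‖q n s‖ ≤ C * ‖D.rotheLinear n (U n) s - u s‖ + R ε n s) →
      ∀ {F' : Type} [NormedAddCommGroup F'] {g : ℝ → F'},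
        MemLp g 2 (volume.restrict (Ioo 0 D.T)) →
        Tendsto (fun n => ∫ s in Ioo 0 D.T, ‖q n s‖ * ‖g s‖) atTop (𝓝 0) := by
    intro F _ q hq F' _ g hg
    refine tendsto_remainder hT hμ hC (fun ε hε => ?_) hg
    -- Once uniform convergence is known, `C ‖U_n - u‖` is below `ε / 2` and joins the term with `1
    -- + |μ|`.
    filter_upwards [hq (ε / 2) (half_pos hε), hunif (ε / (2 * (C + 1))) (by positivity)]
      with n h1 h2
    filter_upwards [h1, ae_restrict_mem measurableSet_Ioo] with s hs hm
    refine hs.trans ?_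
    have h3 := h2 s ⟨hm.1.le, hm.2.le⟩
    have h4 : C * ‖D.rotheLinear n (U n) s - u s‖ ≤ ε / 2 := by
      calc C * ‖D.rotheLinear n (U n) s - u s‖ ≤ (C + 1) * (ε / (2 * (C + 1))) := by
            gcongr; linarith
        _ = ε / 2 := by field_simp
    rw [hR]
    simp only
    have : 0 ≤ ε * |μ s| := by positivity
    linarith
  have hrem1 := fun {F' : Type} [NormedAddCommGroup F'] {g : ℝ → F'}
    (hg : MemLp g 2 (volume.restrict (Ioo 0 D.T))) =>
    hrem (q := fun n s => D.rotheDeriv n (U n) s - ut s)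
      (fun ε hε => (hest ε hε).mono fun n hn => hn.mono fun s hs => hs.1) hg
  have hrem2 := fun {F' : Type} [NormedAddCommGroup F'] {g : ℝ → F'}
    (hg : MemLp g 2 (volume.restrict (Ioo 0 D.T))) =>
    hrem (q := fun n s => D.rotheConst n (H n) s - h s)
      (fun ε hε => (hest ε hε).mono fun n hn => hn.mono fun s hs => hs.2) hg
  have hlin : ∀ t ∈ Icc 0 D.T, Tendsto (fun n => D.rotheLinear n (U n) t) atTop (𝓝 (u t)) := by
    intro t ht
    rw [Metric.tendsto_atTop']
    intro ε hε
    obtain ⟨N, hN⟩ := eventually_atTop.1 (hunif (ε / 2) (half_pos hε))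
    refine ⟨N, fun n hn => ?_⟩
    rw [dist_eq_norm]
    linarith [hN n hn.le t ht]
  have hconst : ∀ t ∈ Icc 0 D.T, Tendsto (fun n => D.rotheConst n (U n) t) atTop (𝓝 (u t)) := by
    intro t ht
    rw [Metric.tendsto_atTop']
    intro ε hε
    obtain ⟨N, hN⟩ := eventually_atTop.1 (((hunif (ε / 3) (by positivity)).and
      (D.eventually_dist_le hT hu (by positivity : 0 < ε / 3))).and (eventually_gt_atTop 0))
    refine ⟨N, fun n hn => ?_⟩
    obtain ⟨⟨h1, h2⟩, hn0⟩ := hN n hn.le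
    rcases ht.1.eq_or_lt with h0 | h0
    · rw [← h0]
      have : D.rotheConst n (U n) 0 = u 0 := by
        rw [rotheConst, index, zero_div, Nat.ceil_zero, hinit n hn0]
      rw [this, dist_self]
      exact hε
    · obtain ⟨i, hi, hti, hidx⟩ := exists_index hT hn0 ⟨h0, ht.2⟩
      have m2 := node_mem hT hn0 (Nat.succ_le_of_lt hi)
      -- The piecewise constant function at `t` is the piecewise linear one at the right end of the
      -- cell, at most one step away; uniform continuity of `u` covers the gap.
      have e1 : D.rotheConst n (U n) t = D.rotheLinear n (U n) (D.node n (i + 1)) := by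
        rw [rotheConst, hidx, D.rotheLinear_eq hT hn0 (U n)
          (right_mem_Ioc.2 (node_lt_succ hT hn0 i)), node_succ, add_sub_cancel_left,
          D.diffQuot_smul_step hT hn0]
        abel
      have e2 := h1 _ m2
      have e3 := h2 _ m2 t ht (by
        have := node_succ (D := D) (n := n) i
        rw [abs_le]
        constructor <;> linarith [hti.1, hti.2])
      rw [e1]
      refine (dist_triangle _ (u (D.node n (i + 1))) _).trans_lt ?_
      rw [dist_eq_norm]
      linarith
  refine ⟨?_, ?_, ?_, ?_, ?_⟩
  · rw [Metric.tendstoUniformlyOn_iff]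
    intro ε hε
    filter_upwards [hunif (ε / 2) (half_pos hε)] with n hn t ht
    have h1 := hn t ht
    rw [norm_sub_rev] at h1
    have h2 : ‖val (u t) - val (D.rotheLinear n (U n) t)‖ ≤ ‖u t - D.rotheLinear n (U n) t‖ := by
      have e : val (u t) - val (D.rotheLinear n (U n) t) =
        ((u t - D.rotheLinear n (U n) t : H10 D.Ω) : L2Pair D.Ω).fst := rfl
      rw [e]
      exact WithLp.norm_fst_le _ _
    rw [dist_eq_norm]
    linarith
  · exact fun t ht φ => (hlin t ht).inner tendsto_const_nhds
  · exact fun t ht φ => (hconst t ht).inner tendsto_const_nhds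
  · intro g hg
    rw [← tendsto_sub_nhds_zero_iff]
    refine squeeze_zero_norm' ?_ (hrem1 hg)
    filter_upwards [eventually_gt_atTop 0] with n hn
    have i1 : Integrable (fun s => inner ℝ (D.rotheDeriv n (U n) s) (g s))
      (volume.restrict (Ioo 0 D.T)) := integrable_inner_of_memLp (hderiv n hn) hg
    have i2 : Integrable (fun s => inner ℝ (ut s) (g s))
      (volume.restrict (Ioo 0 D.T)) := integrable_inner_of_memLp hut.1 hg
    rw [← integral_sub i1 i2]
    refine norm_integral_le_of_norm_le ((((hderiv n hn).sub hut.1).norm).integrable_mul hg.norm)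
      (.of_forall fun s => ?_)
    rw [← inner_sub_left]
    exact norm_inner_le_norm _ _
  · intro g hg
    rw [← tendsto_sub_nhds_zero_iff]
    refine squeeze_zero_norm' ?_ (hrem2 hg)
    filter_upwards [eventually_gt_atTop 0] with n hn
    have i1 : Integrable (fun s => D.rotheConst n (H n) s * g s)
      (volume.restrict (Ioo 0 D.T)) := (hsrc n hn).integrable_mul hg
    have i2 : Integrable (fun s => h s * g s) (volume.restrict (Ioo 0 D.T)) := hh.integrable_mul hg
    rw [← integral_sub i1 i2]
    refine norm_integral_le_of_norm_le ((((hsrc n hn).sub hh).norm).integrable_mul hg.norm)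
      (.of_forall fun s => ?_)
    rw [← sub_mul, norm_mul]

end Data
end PseudoParabolic

/-! ### The forms of the equation as bounded operators on H¹₀, and `ω/ρ` as a test function. -/

namespace PseudoParabolic

variable {d : ℕ} {Ω : Set (E d)}

section Operators

/-- Multiplication by bounded functions on `L²`. -/
noncomputable def mulOp (Ω : Set (E d)) (F : Type*) [NormedAddCommGroup F] [NormedSpace ℝ F] :
    LInf Ω →L[ℝ] Lp F 2 (volume.restrict Ω) →L[ℝ] Lp F 2 (volume.restrict Ω) :=
  (ContinuousLinearMap.lsmul ℝ ℝ).holderL (volume.restrict Ω) ∞ 2 2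

theorem coeFn_mulOp {F : Type*} [NormedAddCommGroup F] [NormedSpace ℝ F] (a : LInf Ω)
    (f : Lp F 2 (volume.restrict Ω)) :
    mulOp Ω F a f =ᵐ[volume.restrict Ω] fun x => a x • f x :=
  ContinuousLinearMap.coeFn_holder (ContinuousLinearMap.lsmul ℝ ℝ : ℝ →L[ℝ] F →L[ℝ] F) a f

variable {F : Type*} [NormedAddCommGroup F] [InnerProductSpace ℝ F]

theorem inner_mulOp (a : LInf Ω) (f g : Lp F 2 (volume.restrict Ω)) :
    inner ℝ (mulOp Ω F a f) g = ∫ x in Ω, a x * inner ℝ (f x) (g x) := by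
  rw [L2.inner_def]
  refine integral_congr_ae ?_
  filter_upwards [coeFn_mulOp a f] with x hx
  rw [hx, real_inner_smul_left]

theorem integrable_mul_inner (a : LInf Ω) (f g : Lp F 2 (volume.restrict Ω)) :
    Integrable (fun x => a x * inner ℝ (f x) (g x)) (volume.restrict Ω) := by
  refine (L2.integrable_inner (mulOp Ω F a f) g).congr ?_
  filter_upwards [coeFn_mulOp a f] with x hx
  rw [hx, real_inner_smul_left]

theorem le_inner_mulOp {a : LInf Ω} {c : ℝ} (ha : ∀ᵐ x ∂(volume.restrict Ω), c ≤ a x)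
    (f : Lp F 2 (volume.restrict Ω)) : c * ‖f‖ ^ 2 ≤ inner ℝ (mulOp Ω F a f) f := by
  rw [inner_mulOp, ← real_inner_self_eq_norm_sq, L2.inner_def, ← integral_const_mul]
  refine integral_mono_ae ((L2.integrable_inner f f).const_mul c) (integrable_mul_inner a f f) ?_
  filter_upwards [ha] with x hx
  exact mul_le_mul_of_nonneg_right hx real_inner_self_nonneg

theorem norm_mulOp_le {a : LInf Ω} {c : ℝ} (hc : 0 ≤ c)
    (ha : ∀ᵐ x ∂(volume.restrict Ω), |a x| ≤ c) (f : Lp F 2 (volume.restrict Ω)) :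
    ‖mulOp Ω F a f‖ ≤ c * ‖f‖ := by
  refine Lp.norm_le_mul_norm_of_ae_le_mul ?_
  filter_upwards [ha, coeFn_mulOp a f] with x hx h1
  rw [h1, norm_smul]
  gcongr
  exact hx

/-- The inclusion of `H¹₀` into `L²`. -/
noncomputable def valL (Ω : Set (E d)) : H10 Ω →L[ℝ] L2 Ω :=
  WithLp.fstL 2 ℝ (L2 Ω) (L2Vec Ω) ∘L (H10 Ω).subtypeL

/-- The gradient as an operator from `H¹₀` to `L²`. -/
noncomputable def gradL (Ω : Set (E d)) : H10 Ω →L[ℝ] L2Vec Ω :=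
  WithLp.sndL 2 ℝ (L2 Ω) (L2Vec Ω) ∘L (H10 Ω).subtypeL

theorem norm_sq_H10 (u : H10 Ω) : ‖u‖ ^ 2 = ‖val u‖ ^ 2 + ‖grad u‖ ^ 2 :=
  WithLp.prod_norm_sq_eq_of_L2 (u : L2Pair Ω)

theorem norm_val_le (u : H10 Ω) : ‖val u‖ ≤ ‖u‖ := WithLp.norm_fst_le _ _

/-- The operator `A† ∘ B ∘ A`, as a linear function of `B`. -/
noncomputable def conjL {V X : Type*} [NormedAddCommGroup V] [InnerProductSpace ℝ V]
    [CompleteSpace V] [NormedAddCommGroup X] [InnerProductSpace ℝ X] [CompleteSpace X]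
    (A : V →L[ℝ] X) : (X →L[ℝ] X) →L[ℝ] (V →L[ℝ] V) :=
  (ContinuousLinearMap.postcomp V (ContinuousLinearMap.adjoint A)).comp
    (ContinuousLinearMap.precomp X A)

/-- The operator of the form `(u, φ) ↦ ∫ a u φ` on `H¹₀`. -/
noncomputable def massOp (Ω : Set (E d)) : LInf Ω →L[ℝ] H10 Ω →L[ℝ] H10 Ω :=
  (conjL (valL Ω)).comp (mulOp Ω ℝ)

/-- The operator of the form `(u, φ) ↦ ∫ a ∇u·∇φ` on `H¹₀`. -/
noncomputable def stiffOp (Ω : Set (E d)) : LInf Ω →L[ℝ] H10 Ω →L[ℝ] H10 Ω :=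
  (conjL (gradL Ω)).comp (mulOp Ω (E d))

theorem inner_massOp' (a : LInf Ω) (u φ : H10 Ω) :
    inner ℝ (massOp Ω a u) φ = inner ℝ (mulOp Ω ℝ a (val u)) (val φ) :=
  ContinuousLinearMap.adjoint_inner_left (valL Ω) φ (mulOp Ω ℝ a (val u))

theorem inner_stiffOp' (a : LInf Ω) (u φ : H10 Ω) :
    inner ℝ (stiffOp Ω a u) φ = inner ℝ (mulOp Ω (E d) a (grad u)) (grad φ) :=
  ContinuousLinearMap.adjoint_inner_left (gradL Ω) φ (mulOp Ω (E d) a (grad u))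

theorem inner_massOp (a : LInf Ω) (u φ : H10 Ω) :
    inner ℝ (massOp Ω a u) φ = ∫ x in Ω, a x * (val u x * val φ x) := by
  rw [inner_massOp', inner_mulOp]
  refine integral_congr_ae (.of_forall fun x => ?_)
  simp only [real_inner_eq_re_inner, RCLike.inner_apply, conj_trivial, RCLike.re_to_real]
  ring

theorem inner_stiffOp (a : LInf Ω) (u φ : H10 Ω) :
    inner ℝ (stiffOp Ω a u) φ = ∫ x in Ω, a x * inner ℝ (grad u x) (grad φ x) := by
  rw [inner_stiffOp', inner_mulOp]

theorem stiffOp_symm (a : LInf Ω) (u φ : H10 Ω) :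
    inner ℝ (stiffOp Ω a u) φ = inner ℝ (stiffOp Ω a φ) u := by
  rw [inner_stiffOp, inner_stiffOp]
  simp only [real_inner_comm]

theorem massOp_symm (a : LInf Ω) (u φ : H10 Ω) :
    inner ℝ (massOp Ω a u) φ = inner ℝ (massOp Ω a φ) u := by
  rw [inner_massOp, inner_massOp]
  simp only [mul_comm]

end Operators

section Superposition

variable [IsFiniteMeasure (volume.restrict Ω)] {f : ℝ → ℝ} {L : ℝ≥0}

/-- Superposition with a Lipschitz function preserves L² when the function vanishes at 0; the
constant `f 0` is restored afterwards, the measure being finite. -/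
theorem lipschitz_sub_const (hf : LipschitzWith L f) : LipschitzWith L fun s => f s - f 0 := by
  simpa using hf.sub (LipschitzWith.const (f 0))

/-- The superposition operator `v ↦ f ∘ v` on `L²`. -/
noncomputable def superpose (hf : LipschitzWith L f) (v : L2 Ω) : L2 Ω :=
  (lipschitz_sub_const hf).compLp (sub_self _) v + Lp.const 2 (volume.restrict Ω) (f 0)

theorem coeFn_superpose (hf : LipschitzWith L f) (v : L2 Ω) :
    superpose hf v =ᵐ[volume.restrict Ω] fun x => f (v x) := by
  filter_upwards [Lp.coeFn_add ((lipschitz_sub_const hf).compLp (sub_self _) v)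
    (Lp.const 2 (volume.restrict Ω) (f 0)), (lipschitz_sub_const hf).coeFn_compLp (sub_self _) v,
    Lp.coeFn_const 2 (volume.restrict Ω) (f 0)] with x h1 h2 h3
  rw [superpose, h1, Pi.add_apply, h2, h3]
  simp

theorem norm_superpose_sub_le (hf : LipschitzWith L f) (v w : L2 Ω) :
    ‖superpose hf v - superpose hf w‖ ≤ L * ‖v - w‖ := by
  have := ((lipschitz_sub_const hf).lipschitzWith_compLp (μ := volume.restrict Ω) (p := 2)
    (sub_self _)).dist_le_mul v w
  rw [dist_eq_norm, dist_eq_norm] at this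
  rwa [superpose, superpose, add_sub_add_right_eq_sub]

/-- The functional `φ ↦ ∫ f(u) φ` on `H¹₀`. -/
noncomputable def reaction (hf : LipschitzWith L f) (u : H10 Ω) : H10 Ω :=
  ContinuousLinearMap.adjoint (valL Ω) (superpose hf (val u))

end Superposition

/-- The functional `φ ↦ ∫ g φ` on `H¹₀`. -/
noncomputable def load (g : L2 Ω) : H10 Ω := ContinuousLinearMap.adjoint (valL Ω) g

theorem inner_load' (g : L2 Ω) (φ : H10 Ω) : inner ℝ (load g) φ = inner ℝ g (val φ) :=
  ContinuousLinearMap.adjoint_inner_left (valL Ω) φ g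

theorem inner_load (g : L2 Ω) (φ : H10 Ω) : inner ℝ (load g) φ = ∫ x in Ω, g x * val φ x := by
  rw [inner_load', L2.inner_def]
  refine integral_congr_ae (.of_forall fun x => ?_)
  simp only [real_inner_eq_re_inner, RCLike.inner_apply, conj_trivial, RCLike.re_to_real]
  ring

section Superposition

variable [IsFiniteMeasure (volume.restrict Ω)] {f : ℝ → ℝ} {L : ℝ≥0}

theorem inner_reaction (hf : LipschitzWith L f) (u φ : H10 Ω) :
    inner ℝ (reaction hf u) φ = ∫ x in Ω, f (val u x) * val φ x := by
  refine (inner_load (superpose hf (val u)) φ).trans (integral_congr_ae ?_)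
  filter_upwards [coeFn_superpose hf (val u)] with x hx
  rw [hx]

theorem norm_load_le (g : L2 Ω) : ‖load g‖ ≤ ‖g‖ := by
  rcases eq_or_ne (load g) 0 with h | h
  · rw [h, norm_zero]; exact norm_nonneg _
  · have h1 : ‖load g‖ ^ 2 ≤ ‖g‖ * ‖load g‖ := by
      rw [← real_inner_self_eq_norm_sq, inner_load']
      exact (real_inner_le_norm _ _).trans (by gcongr; exact norm_val_le _)
    have h2 : 0 < ‖load g‖ := norm_pos_iff.2 h
    nlinarith

theorem norm_reaction_sub_le (hf : LipschitzWith L f) (u v : H10 Ω) :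
    ‖reaction hf u - reaction hf v‖ ≤ L * ‖u - v‖ := by
  have e : reaction hf u - reaction hf v =
      load (superpose hf (val u) - superpose hf (val v)) := (map_sub _ _ _).symm
  rw [e]
  refine (norm_load_le _).trans ((norm_superpose_sub_le hf _ _).trans ?_)
  gcongr
  exact norm_val_le (u - v)

end Superposition

theorem continuous_load : Continuous (load : L2 Ω → H10 Ω) :=
  (ContinuousLinearMap.adjoint (valL Ω)).continuous

attribute [irreducible] mulOp massOp stiffOp load reaction

namespace Data

variable {D : Data d}

namespace Assumptions

variable (hD : D.Assumptions)
include hD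

theorem volume_ne_top : volume D.Ω ≠ ∞ := hD.bounded_Ω.measure_lt_top.ne

theorem isFiniteMeasure : IsFiniteMeasure (volume.restrict D.Ω) :=
  ⟨by simpa using hD.volume_ne_top.lt_top⟩

theorem nonempty_Icc : Nonempty (Icc (0 : ℝ) D.T) := ⟨⟨0, left_mem_Icc.2 hD.T_pos.le⟩⟩

theorem continuousOn_ρ : ContinuousOn D.ρ (Icc 0 D.T) := hD.ρ_contDiff.continuousOn

theorem continuousOn_dρ : ContinuousOn D.dρ (Icc 0 D.T) :=
  hD.ρ_contDiff.continuousOn_derivWithin (uniqueDiffOn_Icc hD.T_pos) le_rfl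

theorem continuousOn_κ : ContinuousOn D.κ (Icc 0 D.T) := hD.κ_contDiff.continuousOn

theorem hasDerivWithinAt_ρ {t : ℝ} (ht : t ∈ Icc 0 D.T) :
    HasDerivWithinAt D.ρ (D.dρ t) (Icc 0 D.T) t :=
  (hD.ρ_contDiff.differentiableOn (by norm_num) t ht).hasDerivWithinAt

theorem norm_p_le {t : ℝ} (ht : t ∈ Icc 0 D.T) : ‖D.p t‖ ≤ D.normP := by
  have hb : BddAbove (range fun t : Icc (0 : ℝ) D.T => ‖D.p t‖) := by
    have := (isCompact_Icc.image_of_continuousOn hD.p_cont.norm).bddAbove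
    rwa [image_eq_range] at this
  exact le_ciSup hb (⟨t, ht⟩ : Icc (0 : ℝ) D.T)

theorem norm_gradWeight_le {t : ℝ} (ht : t ∈ Icc 0 D.T) : ‖D.gradWeight t‖ ≤ D.M :=
  le_ciSup hD.M_finite (⟨t, ht⟩ : Icc (0 : ℝ) D.T)

/-- The function `ω/ρ(t)` belongs to `H¹₀(Ω)`, with gradient `gradWeight t`. -/
theorem exists_weight {t : ℝ} (ht : t ∈ Icc 0 D.T) :
    ∃ W : H10 D.Ω, val W =ᵐ[volume.restrict D.Ω] D.weight t ∧ grad W = D.gradWeight t := by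
  have := hD.isFiniteMeasure
  have hex := hD.weight_H1 t ht
  have hz := hex.choose_spec
  set z := hex.choose with hzdef
  have hg : D.gradWeight t = z.snd := by
    rw [gradWeight, weakGrad, dif_pos hex]
  -- Since `ρ ≥ ρ0`, the weight is dominated by a multiple of `ω ∈ H¹₀`; with membership in H¹ this
  -- puts it in H¹₀.
  have hle : ∀ᵐ x ∂(volume.restrict D.Ω),
      |z.fst x| ≤ D.ρ0⁻¹ * |((D.ω : H10 D.Ω) : L2Pair D.Ω).fst x| := by
    filter_upwards [hz.2, hD.ρ_bounds t ht] with x h1 h2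
    have h3 := hD.ρ0_pos
    rw [h1, weight, abs_div, abs_of_pos (h3.trans_le h2.1), div_eq_inv_mul]
    exact mul_le_mul_of_nonneg_right (inv_anti₀ h3 h2.1) (abs_nonneg _)
  exact ⟨⟨z, mem_H10_of_le hle hD.isOpen_Ω hD.volume_ne_top hz.1 D.ω.2⟩, hz.2, hg.symm⟩

end Assumptions

open Classical in
/-- The function `ω/ρ(t)` as an element of `H¹₀(Ω)`. -/
noncomputable def weightElt (D : Data d) (t : ℝ) : H10 D.Ω :=
  if h : ∃ W : H10 D.Ω, val W =ᵐ[volume.restrict D.Ω] D.weight t ∧ grad W = D.gradWeight t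
  then h.choose else 0

namespace Assumptions

variable (hD : D.Assumptions) {t : ℝ} (ht : t ∈ Icc 0 D.T)
include hD ht

theorem val_weightElt : val (D.weightElt t) =ᵐ[volume.restrict D.Ω] D.weight t := by
  rw [weightElt, dif_pos (hD.exists_weight ht)]
  exact (hD.exists_weight ht).choose_spec.1

theorem grad_weightElt : grad (D.weightElt t) = D.gradWeight t := by
  rw [weightElt, dif_pos (hD.exists_weight ht)]
  exact (hD.exists_weight ht).choose_spec.2

theorem inner_load_weightElt : inner ℝ (load (D.p t)) (D.weightElt t) = D.omegaBar t := by
  rw [inner_load, omegaBar]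
  refine integral_congr_ae ?_
  filter_upwards [hD.val_weightElt ht] with x hx
  rw [hx]

theorem mulOp_weightElt : mulOp D.Ω ℝ (D.ρ t) (val (D.weightElt t)) = val D.ω := by
  refine Lp.ext ?_
  filter_upwards [coeFn_mulOp (D.ρ t) (val (D.weightElt t)), hD.val_weightElt ht,
    hD.ρ_bounds t ht] with x h1 h2 h3
  have : D.ρ t x ≠ 0 := (hD.ρ0_pos.trans_le h3.1).ne'
  rw [h1, h2, weight, smul_eq_mul, mul_div_cancel₀ _ this]

/-- The factor `ρ` cancels: tested with `ω/ρ`, the mass term becomes the measurement functional `u ↦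
(ω, u)`. The link between (1), (2) and the measurement rests on this. -/
theorem inner_massOp_weightElt (u : H10 D.Ω) :
    inner ℝ (massOp D.Ω (D.ρ t) u) (D.weightElt t) = inner ℝ (load (val D.ω)) u := by
  rw [massOp_symm, inner_massOp', hD.mulOp_weightElt ht, inner_load']

theorem norm_val_weightElt_le : ‖val (D.weightElt t)‖ ≤ D.ρ0⁻¹ * ‖val D.ω‖ := by
  refine Lp.norm_le_mul_norm_of_ae_le_mul ?_
  filter_upwards [hD.val_weightElt ht, hD.ρ_bounds t ht] with x h1 h2
  have h3 := hD.ρ0_pos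
  rw [h1, weight, norm_div, Real.norm_of_nonneg (h3.le.trans h2.1), div_eq_inv_mul]
  gcongr
  exact h2.1

theorem norm_weightElt_le : ‖D.weightElt t‖ ≤ D.ρ0⁻¹ * ‖val D.ω‖ + D.M := by
  have h1 := hD.norm_val_weightElt_le ht
  have h2 := hD.norm_gradWeight_le ht
  rw [← hD.grad_weightElt ht] at h2
  have h3 := norm_sq_H10 (D.weightElt t)
  refine le_trans ?_ (add_le_add h1 h2)
  refine le_of_sq_le_sq ?_ (by positivity)
  rw [h3]
  nlinarith [norm_nonneg (val (D.weightElt t)), norm_nonneg (grad (D.weightElt t))]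

end Assumptions

end Data
end PseudoParabolic

/-! ### Elliptic problems with an unknown source: solvability and variational form. -/

namespace PseudoParabolic

variable {d : ℕ}

/-- Pair the first row with `W`. The term `R x` becomes `⟪w, x⟫` and, by symmetry, `Q x` becomes `⟪Q
W, x⟫`, so fixing the second row is the same as solving for `h`. In the application `R`, `S`, `Q`
carry `ρ`, `η` and `τ κ`. The border contains `Q W` because the discrete source formula uses `κ
∇u_(i-1)` where the equation has `κ ∇u_i`. -/
theorem saddle_eq_iff {V : Type*} [NormedAddCommGroup V] [InnerProductSpace ℝ V]
    {R S Q : V →L[ℝ] V} {x y p W w : V} {h m c : ℝ} (hR : inner ℝ (R x) W = inner ℝ w x)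
    (hQ : inner ℝ (Q x) W = inner ℝ (Q W) x) (hc : inner ℝ p W = c) (hc0 : c ≠ 0) :
    saddle (R + S + Q) p (w + Q W) (x, h) = (y, m) ↔
      R x + S x + Q x = y + h • p ∧ h = 1 / c * (m - inner ℝ y W + inner ℝ (S x) W) := by
  rw [saddle_apply, Prod.mk.injEq]
  simp only [ContinuousLinearMap.add_apply, sub_eq_iff_eq_add]
  refine and_congr_right fun heq => ?_
  have key := congrArg (fun z => inner ℝ z W) heq
  simp only [inner_add_left, real_inner_smul_left, hR, hQ, hc] at key
  rw [inner_add_left, one_div, eq_inv_mul_iff_mul_eq₀ hc0]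
  constructor <;> intro h1 <;> linarith

theorem inner_smul_op_symm {V : Type*} [NormedAddCommGroup V] [InnerProductSpace ℝ V]
    {Q : V →L[ℝ] V} (hQ : ∀ u v, inner ℝ (Q u) v = inner ℝ (Q v) u) (τ : ℝ) (u v : V) :
    inner ℝ ((τ • Q) u) v = inner ℝ ((τ • Q) v) u := by
  rw [ContinuousLinearMap.smul_apply, ContinuousLinearMap.smul_apply, real_inner_smul_left,
    real_inner_smul_left, hQ]

/-- Here `v` is the old value, `x` its difference quotient and `v + τ • x` the new value. -/
theorem eq_iff_forall_inner {V : Type*} [NormedAddCommGroup V] [InnerProductSpace ℝ V]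
    {A R S K : V →L[ℝ] V} {v x r p : V} {τ h : ℝ} :
    R x + S x + (τ • K) x = r - A v - K v + h • p ↔
      ∀ φ, inner ℝ (A v + R x) φ + inner ℝ (S x) φ + inner ℝ (K (v + τ • x)) φ =
        h * inner ℝ p φ + inner ℝ r φ := by
  rw [ext_iff_inner_right ℝ]
  refine forall_congr' fun φ => ?_
  simp only [inner_add_left, inner_sub_left, real_inner_smul_left,
    ContinuousLinearMap.smul_apply, map_add, map_smul]
  constructor <;> intro h <;> linarith

theorem le_of_mul_sq_le {c z k : ℝ} (hz : 0 ≤ z) (hk : 0 ≤ k) (h : c * z ^ 2 ≤ k * z) :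
    c * z ≤ k := by
  rcases hz.eq_or_lt with rfl | h0
  · rwa [mul_zero]
  · rw [sq, ← mul_assoc] at h
    exact le_of_mul_le_mul_right h h0

theorem sum_eq_of_eqs {m r r₁ r₂ r₃ r₄ i₁ i₂ i₃ i₄ : ℝ} (h : r = r₁ - r₂ - r₃) (h₁ : r₂ = i₁)
    (h₂ : r₄ = i₂) (h₃ : r₃ = i₃) (h₄ : i₄ = r₁) :
    m - r + r₄ = m + i₁ + i₂ + i₃ - i₄ := by
  rw [h, h₁, h₂, h₃, h₄]
  ring

namespace Data

variable {D : Data d}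

namespace Assumptions

variable (hD : D.Assumptions)
include hD

/-- From `ρ(t) W(t) = ω = ρ(s) W(s)` one gets `ρ(t) (W(t) - W(s)) = (ρ(s) - ρ(t)) W(s)`; test with
the difference. The resulting L² continuity makes `ω̄` continuous, so its absolute value has a
positive minimum. -/
theorem norm_val_weightElt_sub_le {s t : ℝ} (hs : s ∈ Icc 0 D.T) (ht : t ∈ Icc 0 D.T) :
    D.ρ0 * ‖val (D.weightElt t) - val (D.weightElt s)‖ ≤
      ‖mulOp D.Ω ℝ (D.ρ s - D.ρ t)‖ * ‖val (D.weightElt s)‖ := by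
  set z := val (D.weightElt t) - val (D.weightElt s)
  have h1 : mulOp D.Ω ℝ (D.ρ t) z = mulOp D.Ω ℝ (D.ρ s - D.ρ t) (val (D.weightElt s)) := by
    rw [map_sub, hD.mulOp_weightElt ht, map_sub, ContinuousLinearMap.sub_apply,
      hD.mulOp_weightElt hs]
  have h2 : D.ρ0 * ‖z‖ ^ 2 ≤ inner ℝ (mulOp D.Ω ℝ (D.ρ t) z) z :=
    le_inner_mulOp ((hD.ρ_bounds t ht).mono fun x hx => hx.1) z
  rw [h1] at h2
  have h3 := h2.trans ((real_inner_le_norm _ _).trans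
    (mul_le_mul_of_nonneg_right (ContinuousLinearMap.le_opNorm (mulOp D.Ω ℝ (D.ρ s - D.ρ t)) (val (D.weightElt s))) (norm_nonneg z)))
  exact le_of_mul_sq_le (norm_nonneg _) (mul_nonneg (norm_nonneg _) (norm_nonneg _)) h3

theorem continuousOn_val_weightElt : ContinuousOn (fun t => val (D.weightElt t)) (Icc 0 D.T) := by
  intro s hs
  rw [ContinuousWithinAt, tendsto_iff_norm_sub_tendsto_zero]
  have h1 : ContinuousOn
      (fun t => D.ρ0⁻¹ * (‖mulOp D.Ω ℝ (D.ρ s - D.ρ t)‖ * ‖val (D.weightElt s)‖)) (Icc 0 D.T) :=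
    continuousOn_const.mul ((((mulOp D.Ω ℝ).continuous.comp_continuousOn
      (continuousOn_const.sub hD.continuousOn_ρ)).norm).mul continuousOn_const)
  have h2 := (h1 s hs).tendsto
  simp only [sub_self, map_zero, norm_zero, zero_mul, mul_zero] at h2
  refine squeeze_zero' (.of_forall fun _ => norm_nonneg _) ?_ h2
  filter_upwards [self_mem_nhdsWithin] with t ht
  rw [← div_eq_inv_mul, le_div_iff₀' hD.ρ0_pos]
  exact hD.norm_val_weightElt_sub_le hs ht

theorem continuousOn_omegaBar : ContinuousOn D.omegaBar (Icc 0 D.T) := by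
  refine (hD.p_cont.inner hD.continuousOn_val_weightElt (𝕜 := ℝ)).congr fun t ht => ?_
  rw [← hD.inner_load_weightElt ht, inner_load']

theorem omegaMin_pos : 0 < D.omegaMin := by
  have hne := hD.nonempty_Icc
  obtain ⟨t, ht, hmin⟩ := isCompact_Icc.exists_isMinOn (Set.nonempty_Icc.2 hD.T_pos.le)
    hD.continuousOn_omegaBar.abs
  exact (abs_pos.2 (hD.omegaBar_ne t ht)).trans_le (le_ciInf fun s => hmin s.2)

theorem omegaMin_le {t : ℝ} (ht : t ∈ Icc 0 D.T) : D.omegaMin ≤ |D.omegaBar t| :=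
  ciInf_le (f := fun t : Icc (0 : ℝ) D.T => |D.omegaBar t|) ⟨0, by rintro _ ⟨s, rfl⟩; positivity⟩
    ⟨t, ht⟩

theorem small_sq : D.normP ^ 2 * D.M ^ 2 * D.η1 ^ 2 < 4 * D.omegaMin ^ 2 * D.η0 * D.ρ0 := by
  obtain ⟨ζ, -, h1, h2⟩ := hD.small
  have h0 := hD.omegaMin_pos
  have h3 := hD.η0_pos
  have h4 := hD.ρ0_pos
  have h5 := h2.trans h1
  rw [← mul_div_assoc, div_lt_one (by positivity)] at h5
  linarith

end Assumptions

/-- The operator of the elliptic problems with time step `τ` at time `t`. -/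
noncomputable def ellipticOp (D : Data d) (τ t : ℝ) : H10 D.Ω →L[ℝ] H10 D.Ω :=
  massOp D.Ω (D.ρ t) + stiffOp D.Ω (D.η t) + τ • stiffOp D.Ω (D.κ t)

/-- The operator of the elliptic problems with an unknown source and a measurement. -/
noncomputable def sourceOp (D : Data d) (τ t : ℝ) : H10 D.Ω × ℝ →L[ℝ] H10 D.Ω × ℝ :=
  saddle (D.ellipticOp τ t) (load (D.p t))
    (load (val D.ω) + (τ • stiffOp D.Ω (D.κ t)) (D.weightElt t))

namespace Assumptions

variable (hD : D.Assumptions) {t : ℝ} (ht : t ∈ Icc 0 D.T)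
include hD ht

theorem le_inner_ellipticOp {τ : ℝ} (hτ : 0 ≤ τ) (x : H10 D.Ω) :
    D.ρ0 * ‖val x‖ ^ 2 + D.η0 * ‖grad x‖ ^ 2 ≤ inner ℝ (D.ellipticOp τ t x) x := by
  have h1 := le_inner_mulOp ((hD.ρ_bounds t ht).mono fun x hx => hx.1) (val x)
  have h2 := le_inner_mulOp ((hD.η_bounds t ht).mono fun x hx => hx.1) (grad x)
  have h3 := le_inner_mulOp ((hD.κ_bounds t ht).mono fun x hx => hx.1) (grad x)
  have h4 : 0 ≤ D.κ0 * ‖grad x‖ ^ 2 := mul_nonneg hD.κ0_pos.le (sq_nonneg _)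
  rw [ellipticOp, ContinuousLinearMap.add_apply, ContinuousLinearMap.add_apply,
    ContinuousLinearMap.smul_apply, inner_add_left, inner_add_left, real_inner_smul_left,
    inner_massOp', inner_stiffOp', inner_stiffOp']
  have h5 := mul_nonneg hτ (h4.trans h3)
  linarith

theorem coercive_ellipticOp {τ : ℝ} (hτ : 0 ≤ τ) (x : H10 D.Ω) :
    min D.ρ0 D.η0 * ‖x‖ ^ 2 ≤ inner ℝ (D.ellipticOp τ t x) x := by
  refine le_trans ?_ (hD.le_inner_ellipticOp ht hτ x)
  rw [norm_sq_H10, mul_add]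
  exact add_le_add (mul_le_mul_of_nonneg_right (min_le_left _ _) (sq_nonneg _))
    (mul_le_mul_of_nonneg_right (min_le_right _ _) (sq_nonneg _))

/-- Suppose `x` solves the elliptic problem with source `p` and is annihilated by the border.
Testing with `W = ω/ρ` bounds `‖∇x‖` below through `ω̄`, testing with `x` bounds it above through
`‖p‖`, and smallness makes the bounds incompatible. There is no restriction on the size of `τ`. -/
theorem isUnit_sourceOp {τ : ℝ} (hτ : 0 ≤ τ) : IsUnit (D.sourceOp τ t) := by
  refine isUnit_saddle (lt_min hD.ρ0_pos hD.η0_pos) (hD.coercive_ellipticOp ht hτ)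
    fun x hx h0 => ?_
  set W := D.weightElt t with hW
  set a := ‖val x‖ with ha
  set b := ‖grad x‖ with hb
  have hP := hD.norm_p_le ht
  have h1 : D.ρ0 * a ^ 2 + D.η0 * b ^ 2 ≤ D.normP * a := by
    refine (hD.le_inner_ellipticOp ht hτ x).trans ?_
    rw [hx, inner_load']
    exact (real_inner_le_norm _ _).trans (mul_le_mul_of_nonneg_right hP (norm_nonneg _))
  -- Mass term and `τ κ` term add up to the border functional at `x`, which is zero; only the `η`
  -- term is left.
  have h2 : D.omegaBar t = inner ℝ (stiffOp D.Ω (D.η t) x) W := by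
    have h3 := congrArg (fun z => inner ℝ z W) hx
    simp only [hW] at h3
    rw [hD.inner_load_weightElt ht, ellipticOp, ContinuousLinearMap.add_apply,
      ContinuousLinearMap.add_apply, inner_add_left, inner_add_left,
      hD.inner_massOp_weightElt ht] at h3
    rw [inner_add_left, ContinuousLinearMap.smul_apply, real_inner_smul_left, stiffOp_symm] at h0
    rw [ContinuousLinearMap.smul_apply, real_inner_smul_left] at h3
    linarith
  have h3 : D.omegaMin ≤ |D.η1| * b * D.M := by
    refine (hD.omegaMin_le ht).trans ?_
    rw [h2, inner_stiffOp', hD.grad_weightElt ht]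
    refine (abs_real_inner_le_norm _ _).trans (mul_le_mul ?_ (hD.norm_gradWeight_le ht)
      (norm_nonneg _) (by positivity))
    refine norm_mulOp_le (abs_nonneg _) ?_ _
    filter_upwards [hD.η_bounds t ht] with y hy
    rw [abs_of_pos (hD.η0_pos.trans_le hy.1)]
    exact hy.2.trans (le_abs_self _)
  have hρ := hD.ρ0_pos
  have hη := hD.η0_pos
  -- Completing the square in `a`: `P a - ρ0 a² ≤ P² / (4 ρ0)`, with `P` the norm of `p`.
  have h4 : 4 * D.ρ0 * D.η0 * b ^ 2 ≤ D.normP ^ 2 := by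
    nlinarith [sq_nonneg (2 * D.ρ0 * a - D.normP)]
  have h5 : D.omegaMin ^ 2 ≤ D.η1 ^ 2 * b ^ 2 * D.M ^ 2 := by
    have := pow_le_pow_left₀ hD.omegaMin_pos.le h3 2
    rwa [mul_pow, mul_pow, sq_abs] at this
  have h6 := mul_le_mul_of_nonneg_right h4 (mul_nonneg (sq_nonneg D.M) (sq_nonneg D.η1))
  have h7 := mul_le_mul_of_nonneg_left h5 (mul_pos hρ hη).le
  have h8 := hD.small_sq
  linarith

theorem inner_massOp_weightElt_eq (a : LInf D.Ω) (v : H10 D.Ω) :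
    inner ℝ (massOp D.Ω a v) (D.weightElt t) =
      ∫ x in D.Ω, val v x * (val D.ω x * a x / D.ρ t x) := by
  rw [inner_massOp]
  refine integral_congr_ae ?_
  filter_upwards [hD.val_weightElt ht] with x hx
  rw [hx, weight]
  ring

end Assumptions

/-- The known part of the right-hand side of the elliptic problem at time `t`, where `a` stands
for the time derivative of `ρ`. -/
noncomputable def residual (hD : D.Assumptions) (a : LInf D.Ω) (t : ℝ) (v : H10 D.Ω) : H10 D.Ω :=
  haveI := hD.isFiniteMeasure
  reaction hD.f_lip v - massOp D.Ω a v - stiffOp D.Ω (D.κ t) v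

/-- One dictionary for both problems: `τ = 0` with `a = ∂_t ρ` gives the weak formulation at time
`t`, and the step size with `a = δρ_i` gives one Rothe step. -/
theorem sourceOp_eq_iff (hD : D.Assumptions) {t : ℝ} (ht : t ∈ Icc 0 D.T) (τ : ℝ) (a : LInf D.Ω)
    (v x : H10 D.Ω) (h m : ℝ) :
    D.sourceOp τ t (x, h) = (residual hD a t v, m) ↔
      (∀ φ : H10 D.Ω, inner ℝ (massOp D.Ω a v + massOp D.Ω (D.ρ t) x) φ
          + inner ℝ (stiffOp D.Ω (D.η t) x) φ + inner ℝ (stiffOp D.Ω (D.κ t) (v + τ • x)) φ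
        = h * (∫ y in D.Ω, D.p t y * val φ y) + ∫ y in D.Ω, D.f (val v y) * val φ y) ∧
      h = 1 / D.omegaBar t * (m + (∫ y in D.Ω, val v y * (val D.ω y * a y / D.ρ t y))
        + (∫ y in D.Ω, D.η t y * inner ℝ (grad x y) (D.gradWeight t y))
        + (∫ y in D.Ω, D.κ t y * inner ℝ (grad v y) (D.gradWeight t y))
        - ∫ y in D.Ω, D.f (val v y) * D.weight t y) := by
  have := hD.isFiniteMeasure
  have hsym : inner ℝ ((τ • stiffOp D.Ω (D.κ t)) x) (D.weightElt t) =
      inner ℝ ((τ • stiffOp D.Ω (D.κ t)) (D.weightElt t)) x :=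
    inner_smul_op_symm (stiffOp_symm _) τ _ _
  rw [sourceOp, ellipticOp, saddle_eq_iff (hD.inner_massOp_weightElt ht x) hsym
    (hD.inner_load_weightElt ht) (hD.omegaBar_ne t ht)]
  refine and_congr ?_ ?_
  · refine (eq_iff_forall_inner (A := massOp D.Ω a) (R := massOp D.Ω (D.ρ t))
      (S := stiffOp D.Ω (D.η t)) (K := stiffOp D.Ω (D.κ t)) (v := v) (x := x)
      (r := reaction hD.f_lip v) (p := load (D.p t)) (τ := τ) (h := h)).trans ?_
    refine forall_congr' fun φ => ?_
    exact Eq.congr_right (congrArg₂ (fun b c => h * b + c) (inner_load _ _)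
      (inner_reaction _ _ _))
  · have e1 : ∫ y in D.Ω, D.f (val v y) * D.weight t y =
        inner ℝ (reaction hD.f_lip v) (D.weightElt t) := by
      rw [inner_reaction]
      refine integral_congr_ae ?_
      filter_upwards [hD.val_weightElt ht] with y hy
      rw [hy]
    have e2 := hD.inner_massOp_weightElt_eq ht a v
    have e3 := inner_stiffOp (D.η t) x (D.weightElt t)
    have e4 := inner_stiffOp (D.κ t) v (D.weightElt t)
    rw [hD.grad_weightElt ht] at e3 e4
    have e5 : inner ℝ (residual hD a t v) (D.weightElt t) =
        inner ℝ (reaction hD.f_lip v) (D.weightElt t) -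
          inner ℝ (massOp D.Ω a v) (D.weightElt t) -
          inner ℝ (stiffOp D.Ω (D.κ t) v) (D.weightElt t) :=
      (inner_sub_left _ _ _).trans (congrArg (· - _) (inner_sub_left _ _ _))
    exact Eq.congr_right (congrArg _ (sum_eq_of_eqs e5 e2 e3 e4 e1))

end Data
end PseudoParabolic

/-! ### The evolution equation: existence, uniqueness, and the measurement. -/

namespace PseudoParabolic

variable {d : ℕ}

/-- Lebesgue differentiation: almost everywhere `g` is the derivative of its primitive, which is
locally constant. -/
theorem ae_eq_zero_of_integral_eq_zero {T : ℝ} (hT : 0 < T) {g : ℝ → ℝ}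
    (hg : IntervalIntegrable g volume 0 T)
    (h : ∀ t ∈ Icc 0 T, ∫ s in (0 : ℝ)..t, g s = 0) :
    ∀ᵐ t ∂(volume.restrict (Ioo 0 T)), g t = 0 := by
  rw [ae_restrict_iff' measurableSet_Ioo]
  filter_upwards [hg.ae_hasDerivAt_integral] with t ht hmem
  rw [uIcc_of_le hT.le] at ht
  have h1 := ht (Ioo_subset_Icc_self hmem) 0 (left_mem_Icc.2 hT.le)
  have h2 : (fun x => ∫ s in (0 : ℝ)..x, g s) =ᶠ[𝓝 t] fun _ => 0 := by
    filter_upwards [Ioo_mem_nhds hmem.1 hmem.2] with x hx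
    exact h x (Ioo_subset_Icc_self hx)
  exact h1.unique ((hasDerivAt_const t (0 : ℝ)).congr_of_eventuallyEq h2)

theorem exists_norm_le {F : Type*} [NormedAddCommGroup F] {T : ℝ} {g : ℝ → F}
    (hg : ContinuousOn g (Icc 0 T)) : ∃ C, ∀ t ∈ Icc 0 T, ‖g t‖ ≤ C :=
  isCompact_Icc.exists_bound_of_continuousOn hg

theorem continuousOn_add_of_norm {F : Type*} [NormedAddCommGroup F] {s : Set ℝ} {g k : ℝ → F}
    (hg : ContinuousOn g s) (hk : ContinuousOn k s) : ContinuousOn (fun t => g t + k t) s :=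
  hg.add hk

theorem memLp_of_continuousOn {F : Type*} [NormedAddCommGroup F] {T : ℝ} {g : ℝ → F}
    (hg : ContinuousOn g (Icc 0 T)) (q : ℝ≥0∞) : MemLp g q (volume.restrict (Ioo 0 T)) := by
  obtain ⟨C, hC⟩ := exists_norm_le hg
  refine MemLp.of_bound ((hg.mono Ioo_subset_Icc_self).aestronglyMeasurable measurableSet_Ioo) C ?_
  filter_upwards [ae_restrict_mem measurableSet_Ioo] with t ht
  exact hC t (Ioo_subset_Icc_self ht)

theorem memLp_smul_of_continuousOn {F : Type*} [NormedAddCommGroup F] [NormedSpace ℝ F] {T : ℝ}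
    {g : ℝ → F} {μ : ℝ → ℝ} (hμ : MemLp μ 2 (volume.restrict (Ioo 0 T)))
    (hg : ContinuousOn g (Icc 0 T)) :
    MemLp (fun t => μ t • g t) 2 (volume.restrict (Ioo 0 T)) :=
  MemLp.smul (p := 2) (q := ∞) (memLp_of_continuousOn hg ∞) hμ

theorem HasL2TimeDeriv.timeDeriv {T : ℝ} {m : ℝ → ℝ} (hm : ∃ w, HasL2TimeDeriv T m w) :
    HasL2TimeDeriv T m (timeDeriv T m) := by
  rw [PseudoParabolic.timeDeriv, dif_pos hm]
  exact hm.choose_spec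

theorem inner_massOp_add {Ω : Set (E d)} (a b : LInf Ω) (u v φ : H10 Ω) :
    inner ℝ (massOp Ω a u + massOp Ω b v) φ =
      ∫ x in Ω, (a x * val u x + b x * val v x) * val φ x := by
  rw [inner_add_left, inner_massOp', inner_massOp', ← inner_add_left, L2.inner_def]
  refine integral_congr_ae ?_
  filter_upwards [Lp.coeFn_add (mulOp Ω ℝ a (val u)) (mulOp Ω ℝ b (val v)),
    coeFn_mulOp a (val u), coeFn_mulOp b (val v)] with x h1 h2 h3
  rw [h1, Pi.add_apply, h2, h3]
  exact mul_comm _ _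

namespace Data

variable {D : Data d}

/-- The solution operator of the elliptic problem with time step `0`. -/
noncomputable def solveOp (D : Data d) (t : ℝ) : H10 D.Ω × ℝ →L[ℝ] H10 D.Ω × ℝ :=
  Ring.inverse (D.sourceOp 0 t)

theorem norm_residual_sub_le (hD : D.Assumptions) (a : LInf D.Ω) (t : ℝ) (v w : H10 D.Ω) :
    ‖residual hD a t v - residual hD a t w‖ ≤
      (D.Lf + ‖massOp D.Ω a‖ + ‖stiffOp D.Ω (D.κ t)‖) * ‖v - w‖ := by
  have := hD.isFiniteMeasure
  have h : residual hD a t v - residual hD a t w = reaction hD.f_lip v - reaction hD.f_lip w -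
      massOp D.Ω a (v - w) - stiffOp D.Ω (D.κ t) (v - w) := by
    rw [residual, residual, map_sub, map_sub]
    abel
  rw [h, add_mul, add_mul]
  refine (norm_sub_le _ _).trans (add_le_add ((norm_sub_le _ _).trans (add_le_add ?_ ?_)) ?_)
  · exact norm_reaction_sub_le hD.f_lip v w
  · exact ContinuousLinearMap.le_opNorm _ _
  · exact ContinuousLinearMap.le_opNorm _ _

namespace Assumptions

variable (hD : D.Assumptions)
include hD

theorem continuousOn_massOp_dρ : ContinuousOn (fun t => massOp D.Ω (D.dρ t)) (Icc 0 D.T) :=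
  (massOp D.Ω).continuous.comp_continuousOn hD.continuousOn_dρ

theorem continuousOn_stiffOp_κ : ContinuousOn (fun t => stiffOp D.Ω (D.κ t)) (Icc 0 D.T) :=
  (stiffOp D.Ω).continuous.comp_continuousOn hD.continuousOn_κ

/-- For `τ = 0` neither `κ` nor `ω/ρ` enters the operator, so its continuity in time follows from
that of `ρ`, `η` and `p`; `∇(ω/ρ)` is only required to be bounded. -/
theorem sourceOp_zero (t : ℝ) : D.sourceOp 0 t =
    saddle (massOp D.Ω (D.ρ t) + stiffOp D.Ω (D.η t)) (load (D.p t)) (load (val D.ω)) := by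
  rw [sourceOp, ellipticOp, zero_smul ℝ (stiffOp D.Ω (D.κ t)), add_zero, ContinuousLinearMap.zero_apply,
    add_zero]

theorem continuousOn_solveOp : ContinuousOn D.solveOp (Icc 0 D.T) := by
  refine continuousOn_ringInverse (R := H10 D.Ω × ℝ →L[ℝ] H10 D.Ω × ℝ) (A := D.sourceOp 0) ?_
    fun t ht => hD.isUnit_sourceOp ht le_rfl
  have h1 : ContinuousOn (fun t => massOp D.Ω (D.ρ t)) (Icc 0 D.T) :=
    (massOp D.Ω).continuous.comp_continuousOn hD.continuousOn_ρ
  have h2 : ContinuousOn (fun t => stiffOp D.Ω (D.η t)) (Icc 0 D.T) :=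
    (stiffOp D.Ω).continuous.comp_continuousOn hD.η_cont
  have h3 : ContinuousOn (fun t => load (D.p t)) (Icc 0 D.T) :=
    continuous_load.comp_continuousOn hD.p_cont
  have h4 := continuousOn_add_of_norm (F := H10 D.Ω →L[ℝ] H10 D.Ω) h1 h2
  exact (continuousOn_saddle (load (val D.ω)) h4 h3).congr fun t _ => hD.sourceOp_zero t

theorem continuousOn_residual {u : ℝ → H10 D.Ω} (hu : ContinuousOn u (Icc 0 D.T)) :
    ContinuousOn (fun t => residual hD (D.dρ t) t (u t)) (Icc 0 D.T) := by
  have := hD.isFiniteMeasure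
  have h1 : LipschitzWith D.Lf (reaction (Ω := D.Ω) hD.f_lip) :=
    LipschitzWith.of_dist_le_mul fun x y => by
      rw [dist_eq_norm, dist_eq_norm]
      exact norm_reaction_sub_le hD.f_lip x y
  exact ((h1.continuous.comp_continuousOn hu).sub (hD.continuousOn_massOp_dρ.clm_apply hu)).sub
    (hD.continuousOn_stiffOp_κ.clm_apply hu)

theorem sourceOp_eq_iff_eq_solveOp {t : ℝ} (ht : t ∈ Icc 0 D.T) (z y : H10 D.Ω × ℝ) :
    D.sourceOp 0 t z = y ↔ z = D.solveOp t y := by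
  have h := hD.isUnit_sourceOp ht le_rfl
  constructor
  · rintro rfl
    exact (DFunLike.congr_fun (Ring.inverse_mul_cancel _ h) z).symm
  · rintro rfl
    exact DFunLike.congr_fun (Ring.mul_inverse_cancel _ h) y

/-- A common bound for the operators. -/
theorem exists_bound : ∃ N : ℝ, 1 ≤ N ∧ D.Lf ≤ N ∧ ∀ t ∈ Icc 0 D.T, ‖D.solveOp t‖ ≤ N ∧
    ‖massOp D.Ω (D.dρ t)‖ ≤ N ∧ ‖stiffOp D.Ω (D.κ t)‖ ≤ N ∧ ‖D.weightElt t‖ ≤ N := by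
  obtain ⟨C₁, h1⟩ := exists_norm_le (F := H10 D.Ω × ℝ →L[ℝ] H10 D.Ω × ℝ) hD.continuousOn_solveOp
  obtain ⟨C₂, h2⟩ := exists_norm_le (F := H10 D.Ω →L[ℝ] H10 D.Ω) hD.continuousOn_massOp_dρ
  obtain ⟨C₃, h3⟩ := exists_norm_le (F := H10 D.Ω →L[ℝ] H10 D.Ω) hD.continuousOn_stiffOp_κ
  set C₄ := D.ρ0⁻¹ * ‖val D.ω‖ + D.M
  have h0 : (0 : ℝ) ∈ Icc 0 D.T := left_mem_Icc.2 hD.T_pos.le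
  have p1 := (norm_nonneg (D.solveOp 0)).trans (h1 0 h0)
  have p2 := (norm_nonneg (massOp D.Ω (D.dρ 0))).trans (h2 0 h0)
  have p3 := (norm_nonneg (stiffOp D.Ω (D.κ 0))).trans (h3 0 h0)
  have p4 : 0 ≤ C₄ := (norm_nonneg _).trans (hD.norm_weightElt_le h0)
  have p5 := D.Lf.coe_nonneg
  refine ⟨1 + D.Lf + C₁ + C₂ + C₃ + C₄, by linarith, by linarith, fun t ht =>
    ⟨(h1 t ht).trans (by linarith), (h2 t ht).trans (by linarith), (h3 t ht).trans (by linarith),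
      (hD.norm_weightElt_le ht).trans (by linarith)⟩⟩

/-- One factor `N` bounds the solution operator; `3 * N` collects the Lipschitz constants of
reaction, mass and stiffness terms. The scalar datum cancels, so the constant does not see `m'`. -/
theorem norm_solveOp_sub_le {t N : ℝ} (hN : 1 ≤ N) (hL : D.Lf ≤ N) (hb : ‖D.solveOp t‖ ≤ N ∧
    ‖massOp D.Ω (D.dρ t)‖ ≤ N ∧ ‖stiffOp D.Ω (D.κ t)‖ ≤ N ∧ ‖D.weightElt t‖ ≤ N)
    (x y : H10 D.Ω) (μ : ℝ) :
    ‖D.solveOp t (residual hD (D.dρ t) t x, μ) - D.solveOp t (residual hD (D.dρ t) t y, μ)‖ ≤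
      N * (3 * N) * ‖x - y‖ := by
  obtain ⟨h1, h2, h3, -⟩ := hb
  rw [← map_sub, Prod.mk_sub_mk, sub_self, mul_assoc]
  refine (ContinuousLinearMap.le_opNorm _ _).trans
    (mul_le_mul h1 ?_ (norm_nonneg _) (zero_le_one.trans hN))
  rw [Prod.norm_def, norm_zero, max_eq_left (norm_nonneg _)]
  refine (norm_residual_sub_le hD _ t x y).trans (mul_le_mul_of_nonneg_right ?_ (norm_nonneg _))
  linarith

theorem hasL2TimeDeriv_m : HasL2TimeDeriv D.T D.m (timeDeriv D.T D.m) :=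
  HasL2TimeDeriv.timeDeriv hD.m_H1

theorem sourceOp_zero_eq_iff {t : ℝ} (ht : t ∈ Icc 0 D.T) (v x : H10 D.Ω) (h m : ℝ) :
    D.sourceOp 0 t (x, h) = (residual hD (D.dρ t) t v, m) ↔
      (∀ φ : H10 D.Ω,
        (∫ y in D.Ω, (D.dρ t y * val v y + D.ρ t y * val x y) * val φ y)
          + (∫ y in D.Ω, D.η t y * inner ℝ (grad x y) (grad φ y))
          + (∫ y in D.Ω, D.κ t y * inner ℝ (grad v y) (grad φ y))
        = h * (∫ y in D.Ω, D.p t y * val φ y) + ∫ y in D.Ω, D.f (val v y) * val φ y) ∧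
      h = 1 / D.omegaBar t * (m + (∫ y in D.Ω, val v y * (val D.ω y * D.dρ t y / D.ρ t y))
        + (∫ y in D.Ω, D.η t y * inner ℝ (grad x y) (D.gradWeight t y))
        + (∫ y in D.Ω, D.κ t y * inner ℝ (grad v y) (D.gradWeight t y))
        - ∫ y in D.Ω, D.f (val v y) * D.weight t y) := by
  rw [sourceOp_eq_iff hD ht 0]
  refine and_congr_left' (forall_congr' fun φ => Eq.congr_left ?_)
  rw [zero_smul, add_zero]
  exact congrArg₂ (· + ·) (congrArg₂ (· + ·) (inner_massOp_add _ _ _ _ _) (inner_stiffOp _ _ _))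
    (inner_stiffOp _ _ _)

/-- The evolution equation that is equivalent to the weak formulation. -/
theorem isWeakSolution_iff {u ut : ℝ → H10 D.Ω} {h : ℝ → ℝ} :
    D.IsWeakSolution u ut h ↔ ContinuousOn u (Icc 0 D.T) ∧ HasL2TimeDeriv D.T u ut ∧
      u 0 = D.u0 ∧ MemLp h 2 (volume.restrict (Ioo 0 D.T)) ∧
      ∀ᵐ t ∂(volume.restrict (Ioo 0 D.T)),
        (ut t, h t) = D.solveOp t (residual hD (D.dρ t) t (u t), timeDeriv D.T D.m t) := by
  constructor
  · rintro ⟨h1, h2⟩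
    refine ⟨h1.cont, h1.deriv, h1.init, h1.source, ?_⟩
    filter_upwards [h1.eqn, h2, ae_restrict_mem measurableSet_Ioo] with t h3 h4 ht
    exact (hD.sourceOp_eq_iff_eq_solveOp (Ioo_subset_Icc_self ht) _ _).1
      ((hD.sourceOp_zero_eq_iff (Ioo_subset_Icc_self ht) _ _ _ _).2 ⟨h3, h4⟩)
  · rintro ⟨h1, h2, h3, h4, h5⟩
    have h6 := (h5.and (ae_restrict_mem measurableSet_Ioo)).mono fun t ht =>
      (hD.sourceOp_zero_eq_iff (Ioo_subset_Icc_self ht.2) _ _ _ _).1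
        ((hD.sourceOp_eq_iff_eq_solveOp (Ioo_subset_Icc_self ht.2) _ _).2 ht.1)
    exact ⟨⟨h1, h2, h3, h4, h6.mono fun t ht => ht.1⟩, h6.mono fun t ht => ht.2⟩

/-- The first component of the solved system is the right-hand side of an ordinary differential
equation for `u`; the second component, evaluated along the solution, is the source. -/
theorem exists_isWeakSolution : ∃ u ut h, D.IsWeakSolution u ut h := by
  obtain ⟨N, hN, hL, hb⟩ := hD.exists_bound
  have hN0 : 0 ≤ N := zero_le_one.trans hN
  have hm := hD.hasL2TimeDeriv_m
  set μ := timeDeriv D.T D.m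
  set Z : ℝ → H10 D.Ω → H10 D.Ω × ℝ := fun t v => D.solveOp t (residual hD (D.dρ t) t v, μ t)
    with hZ
  have hmem : ∀ x : ℝ → H10 D.Ω, ContinuousOn x (Icc 0 D.T) →
      MemLp (fun t => Z t (x t)) 2 (volume.restrict (Ioo 0 D.T)) := by
    intro x hx
    have c1 : ContinuousOn (fun t => D.solveOp t (residual hD (D.dρ t) t (x t), 0))
        (Icc 0 D.T) :=
      hD.continuousOn_solveOp.clm_apply ((hD.continuousOn_residual hx).prodMk continuousOn_const)
    have c2 : ContinuousOn (fun t => D.solveOp t (0, 1)) (Icc 0 D.T) :=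
      hD.continuousOn_solveOp.clm_apply continuousOn_const
    -- By linearity the datum `μ`, which is only in L², multiplies a continuous curve; the rest is
    -- continuous in time.
    have e : (fun t => Z t (x t)) = fun t =>
        D.solveOp t (residual hD (D.dρ t) t (x t), 0) + μ t • D.solveOp t (0, 1) := by
      funext t
      rw [← map_smul, ← map_add]
      simp [hZ]
    rw [e]
    exact (memLp_of_continuousOn c1 2).add (memLp_smul_of_continuousOn hm.1 c2)
  have hlip : ∀ t ∈ Icc 0 D.T, ∀ x y, ‖Z t x - Z t y‖ ≤ N * (3 * N) * ‖x - y‖ :=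
    fun t ht x y => hD.norm_solveOp_sub_le hN hL (hb t ht) _ _ _
  obtain ⟨u, hu, heq⟩ := exists_integral_solution (G := fun t v => (Z t v).1) hD.T_pos.le
    (by positivity : 0 ≤ N * (3 * N)) D.u0
    (fun t ht x y => (norm_fst_le (Z t x - Z t y)).trans (hlip t ht x y))
    (fun x hx => (D.intervalIntegrable_iff_Ioo hD.T_pos).2
      (D.integrable_of_memLp (hmem x hx.continuousOn).fst))
  have hu0 : u 0 = D.u0 := by
    rw [heq 0 (left_mem_Icc.2 hD.T_pos.le), intervalIntegral.integral_same, add_zero]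
  refine ⟨u, fun t => (Z t (u t)).1, fun t => (Z t (u t)).2, hD.isWeakSolution_iff.2
    ⟨hu.continuousOn, ⟨(hmem u hu.continuousOn).fst, fun t ht => ?_⟩, hu0,
      (hmem u hu.continuousOn).snd, .of_forall fun t => rfl⟩⟩
  rw [hu0]
  exact heq t ht

theorem isWeakSolution_unique {u ut v vt : ℝ → H10 D.Ω} {h g : ℝ → ℝ}
    (hu : D.IsWeakSolution u ut h) (hv : D.IsWeakSolution v vt g) :
    EqOn v u (Icc 0 D.T) ∧ g =ᵐ[volume.restrict (Ioo 0 D.T)] h := by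
  obtain ⟨N, hN, hL, hb⟩ := hD.exists_bound
  obtain ⟨u1, u2, u3, -, u5⟩ := hD.isWeakSolution_iff.1 hu
  obtain ⟨v1, v2, v3, -, v5⟩ := hD.isWeakSolution_iff.1 hv
  have m0 : (0 : ℝ) ∈ Icc 0 D.T := left_mem_Icc.2 hD.T_pos.le
  have hφ : ContinuousOn (fun t => ‖v t - u t‖) (Icc 0 D.T) := (v1.sub u1).norm
  have hlip : ∀ᵐ t ∂(volume.restrict (Ioo 0 D.T)), ‖vt t - ut t‖ ≤
      N * (3 * N) * ‖v t - u t‖ := by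
    filter_upwards [u5, v5, ae_restrict_mem measurableSet_Ioo] with t h1 h2 ht
    have h3 := hD.norm_solveOp_sub_le hN hL (hb t (Ioo_subset_Icc_self ht)) (v t) (u t)
      (timeDeriv D.T D.m t)
    rw [← h1, ← h2] at h3
    exact (norm_fst_le ((vt t, g t) - (ut t, h t))).trans h3
  have hle : ∀ t ∈ Icc 0 D.T, ‖v t - u t‖ ≤ 0 + N * (3 * N) * ∫ s in (0 : ℝ)..t, ‖v s - u s‖ := by
    intro t ht
    have i1 := D.intervalIntegrable_of_mem hD.T_pos (D.integrable_of_memLp v2.1) m0 ht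
    have i2 := D.intervalIntegrable_of_mem hD.T_pos (D.integrable_of_memLp u2.1) m0 ht
    rw [v2.2 t ht, u2.2 t ht, v3, u3, add_sub_add_left_eq_sub,
      ← intervalIntegral.integral_sub i1 i2, zero_add, ← intervalIntegral.integral_const_mul]
    refine intervalIntegral.norm_integral_le_of_norm_le ht.1 ?_
      ((hφ.mono (Icc_subset_Icc_right ht.2)).intervalIntegrable_of_Icc ht.1 |>.const_mul _)
    have h1 := (ae_restrict_iff' measurableSet_Ioo).1 hlip
    have h2 : ∀ᵐ s : ℝ, s ≠ D.T := by simp [ae_iff]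
    filter_upwards [h1, h2] with s h3 h4 hs
    exact h3 ⟨hs.1, lt_of_le_of_ne (hs.2.trans ht.2) h4⟩
  have hzero : EqOn v u (Icc 0 D.T) := by
    intro t ht
    have h1 := le_of_le_add_integral (by positivity) le_rfl hφ hle t ht
    rw [mul_zero, zero_mul] at h1
    exact sub_eq_zero.1 (norm_le_zero_iff.1 h1)
  refine ⟨hzero, ?_⟩
  filter_upwards [u5, v5, ae_restrict_mem measurableSet_Ioo] with t h1 h2 ht
  rw [hzero (Ioo_subset_Icc_self ht), ← h1] at h2
  exact congrArg Prod.snd h2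

/-- Given the variational equation at time `t`, the formula for `h` says exactly that the border
functional at `∂_t u` equals `m'`. -/
theorem sourceExpr_iff {t : ℝ} (ht : t ∈ Icc 0 D.T) {v x : H10 D.Ω} {h : ℝ}
    (heq : ∀ φ : H10 D.Ω,
        (∫ y in D.Ω, (D.dρ t y * val v y + D.ρ t y * val x y) * val φ y)
          + (∫ y in D.Ω, D.η t y * inner ℝ (grad x y) (grad φ y))
          + (∫ y in D.Ω, D.κ t y * inner ℝ (grad v y) (grad φ y))
        = h * (∫ y in D.Ω, D.p t y * val φ y) + ∫ y in D.Ω, D.f (val v y) * val φ y) :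
    h = D.sourceExpr t v x ↔ inner ℝ (load (val D.ω)) x = timeDeriv D.T D.m t := by
  have hsnd : ∀ m : ℝ, D.sourceOp 0 t (x, h) = (residual hD (D.dρ t) t v, m) →
      inner ℝ (load (val D.ω)) x = m := fun m hm => by
    rw [hD.sourceOp_zero t] at hm
    exact congrArg Prod.snd hm
  constructor
  · intro h1
    exact hsnd _ ((hD.sourceOp_zero_eq_iff ht v x h _).2 ⟨heq, h1⟩)
  · intro h1
    -- This scalar datum is the formula for `h` solved for `m`, so the system holds by construction;
    -- its second row then identifies the datum with the border functional at `x`.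
    have h2 := (hD.sourceOp_zero_eq_iff ht v x h (D.omegaBar t * h
      - (∫ y in D.Ω, val v y * (val D.ω y * D.dρ t y / D.ρ t y))
      - (∫ y in D.Ω, D.η t y * inner ℝ (grad x y) (D.gradWeight t y))
      - (∫ y in D.Ω, D.κ t y * inner ℝ (grad v y) (D.gradWeight t y))
      + ∫ y in D.Ω, D.f (val v y) * D.weight t y)).2 ⟨heq, by
        have := hD.omegaBar_ne t ht
        field_simp
        ring⟩
    have h3 := hsnd _ h2
    rw [← h3, h1] at h2
    exact ((hD.sourceOp_zero_eq_iff ht v x h _).1 h2).2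

/-- The formula for `h` is the time derivative of the measurement, `(ω, ∂_t u) = m'` almost
everywhere. Integration recovers the measurement up to its value at time 0, which is the
compatibility condition. -/
theorem isMeasuredSolution_iff {v vt : ℝ → H10 D.Ω} {g : ℝ → ℝ} :
    D.IsMeasuredSolution v vt g ↔
      D.IsWeakSolution v vt g ∧ ∫ x in D.Ω, val D.u0 x * val D.ω x = D.m 0 := by
  have hm := hD.hasL2TimeDeriv_m
  have m0 : (0 : ℝ) ∈ Icc 0 D.T := left_mem_Icc.2 hD.T_pos.le
  have hω : ∀ x : H10 D.Ω, ∫ y in D.Ω, val x y * val D.ω y = inner ℝ (load (val D.ω)) x :=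
    fun x => by
      rw [inner_load]
      simp only [mul_comm]
  simp only [IsMeasuredSolution, IsWeakSolution, hω, and_assoc]
  refine and_congr_right fun hvar => ?_
  have hiff : (∀ᵐ t ∂(volume.restrict (Ioo 0 D.T)), g t = D.sourceExpr t (v t) (vt t)) ↔
      ∀ᵐ t ∂(volume.restrict (Ioo 0 D.T)),
        inner ℝ (load (val D.ω)) (vt t) - timeDeriv D.T D.m t = 0 := by
    refine eventually_congr ?_
    filter_upwards [hvar.eqn, ae_restrict_mem measurableSet_Ioo] with t h1 ht
    rw [hD.sourceExpr_iff (Ioo_subset_Icc_self ht) h1, sub_eq_zero]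
  rw [hiff]
  have iv := D.integrable_of_memLp hvar.deriv.1
  have iw : Integrable (fun t => inner ℝ (load (val D.ω)) (vt t)) (volume.restrict (Ioo 0 D.T)) :=
    (innerSL ℝ (load (val D.ω))).integrable_comp iv
  have im := D.integrable_of_memLp hm.1
  have hint : ∀ t ∈ Icc 0 D.T,
      ∫ s in (0 : ℝ)..t, (inner ℝ (load (val D.ω)) (vt s) - timeDeriv D.T D.m s) =
        (inner ℝ (load (val D.ω)) (v t) - D.m t) - (inner ℝ (load (val D.ω)) D.u0 - D.m 0) := by
    intro t ht
    have h1 : ∫ s in (0 : ℝ)..t, inner ℝ (load (val D.ω)) (vt s) =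
        inner ℝ (load (val D.ω)) (∫ s in (0 : ℝ)..t, vt s) :=
      (innerSL ℝ (load (val D.ω))).intervalIntegral_comp_comm
        (D.intervalIntegrable_of_mem hD.T_pos iv m0 ht)
    rw [intervalIntegral.integral_sub (D.intervalIntegrable_of_mem hD.T_pos iw m0 ht)
      (D.intervalIntegrable_of_mem hD.T_pos im m0 ht), h1, hvar.deriv.2 t ht, hvar.init,
      inner_add_right, hm.2 t ht]
    ring
  constructor
  · intro h
    have h0 := h 0 m0
    rw [hvar.init] at h0
    refine ⟨ae_eq_zero_of_integral_eq_zero hD.T_pos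
      ((D.intervalIntegrable_iff_Ioo hD.T_pos).2 (iw.sub im)) fun t ht => ?_, h0⟩
    rw [hint t ht, h t ht, h0]
    ring
  · rintro ⟨h1, h0⟩ t ht
    have h2 := hint t ht
    rw [h0, intervalIntegral.integral_of_le ht.1, setIntegral_congr_set Ioo_ae_eq_Ioc.symm,
      integral_eq_zero_of_ae (ae_restrict_of_ae_restrict_of_subset
        (Ioo_subset_Ioo_right ht.2) h1)] at h2
    linarith

end Assumptions
end Data
end PseudoParabolic

/-! ### The Rothe scheme: solvability of each step and the error estimate. -/

namespace PseudoParabolic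

variable {d : ℕ}

section Estimate

/-- Absorption argument: `Δ` is the error of the pair, `X` the norm of the difference quotient, `e`
the error of the Rothe function, `g` that of the datum `m'`, and `a = |m'|`. Since `X` is bounded
through `Δ` with a factor `τ` in front, a small step absorbs it. -/
theorem le_of_step_bounds {N ε τ Δ X e q R g a : ℝ} (hN : 1 ≤ N) (hε : 0 ≤ ε) (hτ : 0 ≤ τ)
    (hτε : τ ≤ ε) (hτN : 12 * N ^ 3 * τ ≤ 1) (hΔ : 0 ≤ Δ) (hX : 0 ≤ X) (he : 0 ≤ e) (hg : 0 ≤ g)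
    (ha : 0 ≤ a) (hq : q ≤ e + τ * X) (hR : R ≤ 4 * N * q + 2 * ε * N)
    (h : Δ ≤ N * (R + τ * (N * X) + g + τ * (N * N * X)) + ε * (N + a))
    (hXΔ : X ≤ Δ + N * (N + a)) :
    Δ ≤ 18 * N ^ 5 * (e + ε * (1 + a) + g) := by
  have hN0 : 0 ≤ N := zero_le_one.trans hN
  have n23 : N ^ 2 ≤ N ^ 3 := pow_le_pow_right₀ hN (by norm_num)
  have n25 : N ^ 2 ≤ N ^ 5 := pow_le_pow_right₀ hN (by norm_num)
  have n15 : N ≤ N ^ 5 := le_self_pow₀ hN (by norm_num)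
  have n12 : N ≤ N ^ 2 := le_self_pow₀ hN (by norm_num)
  have hτX : 0 ≤ τ * X := mul_nonneg hτ hX
  have hM : N + a ≤ N * (1 + a) := by nlinarith
  have hεM : 0 ≤ ε * (1 + a) := by positivity
  have h1 : R ≤ 4 * N * (e + τ * X) + 2 * ε * N :=
    hR.trans (by gcongr)
  have h2 : Δ ≤ N * ((4 * N * (e + τ * X) + 2 * ε * N) + τ * (N * X) + g + τ * (N * N * X)) +
      ε * (N * (1 + a)) := h.trans (by gcongr)
  have h3 : N ^ 2 * (τ * X) ≤ N ^ 3 * (τ * X) := mul_le_mul_of_nonneg_right n23 hτX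
  have h4 : N * (ε * (1 + a)) ≤ N ^ 2 * (ε * (1 + a)) := mul_le_mul_of_nonneg_right n12 hεM
  have h5 : N ^ 2 * ε ≤ N ^ 2 * (ε * (1 + a)) := by
    refine mul_le_mul_of_nonneg_left ?_ (sq_nonneg N)
    nlinarith
  -- The last term costs at most `Δ / 2` by `12 N³ τ ≤ 1`, plus `6 N⁵ ε (1 + a)`; doubling `3 + 6`
  -- gives the constant 18.
  have h6 : Δ ≤ 4 * N ^ 2 * e + N * g + 3 * (N ^ 2 * (ε * (1 + a))) + 6 * (N ^ 3 * (τ * X)) := by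
    nlinarith
  have h7 : N ^ 3 * τ * X ≤ N ^ 3 * τ * (Δ + N ^ 2 * (1 + a)) := by
    refine mul_le_mul_of_nonneg_left (hXΔ.trans ?_) (by positivity)
    nlinarith
  have h8 : 12 * N ^ 3 * τ * Δ ≤ 1 * Δ := mul_le_mul_of_nonneg_right hτN hΔ
  have h9 : N ^ 5 * (τ * (1 + a)) ≤ N ^ 5 * (ε * (1 + a)) := by gcongr
  have h10 : N ^ 2 * e ≤ N ^ 5 * e := mul_le_mul_of_nonneg_right n25 he
  have h11 : N * g ≤ N ^ 5 * g := mul_le_mul_of_nonneg_right n15 hg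
  have h12 : N ^ 2 * (ε * (1 + a)) ≤ N ^ 5 * (ε * (1 + a)) := mul_le_mul_of_nonneg_right n25 hεM
  have h13 : 0 ≤ N ^ 5 * e := by positivity
  have h14 : 0 ≤ N ^ 5 * g := by positivity
  nlinarith

variable {V : Type*} [NormedAddCommGroup V] [InnerProductSpace ℝ V]

theorem norm_prod_mk_le (a : V) (b : ℝ) : ‖((a, b) : V × ℝ)‖ ≤ ‖a‖ + |b| :=
  max_le (le_add_of_nonneg_right (abs_nonneg b)) (le_add_of_nonneg_left (norm_nonneg a))

theorem exists_norm_apply_le {F : Type*} [NormedAddCommGroup F] [NormedSpace ℝ F]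
    (M : F →L[ℝ] V →L[ℝ] V) : ∃ B, 0 < B ∧ ∀ a, ‖M a‖ ≤ B * ‖a‖ := M.bound

/-- Discrete product rule: `δ(ρ u)` is `δρ` times the old `u` plus the new `ρ` times `δu`. -/
theorem apply_smul_sub_add {F : Type*} [NormedAddCommGroup F] [NormedSpace ℝ F]
    (M : F →L[ℝ] V →L[ℝ] V) (c : ℝ) (a b : F) (u v : V) :
    M (c • (b - a)) u + M b (c • (v - u)) = c • (M b v - M a u) := by
  rw [map_smul, map_smul, map_sub, map_sub, ContinuousLinearMap.smul_apply,
    ContinuousLinearMap.sub_apply, ← smul_add]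
  congr 1
  abel

/-- The `τ` terms are moved to the data, so that a discrete step is expressed by the operator with
`τ = 0`, whose inverse is continuous in time. -/
theorem saddle_eq_of_saddle_add_eq {B K : V →L[ℝ] V} {p w W y : V} {τ m : ℝ} {z : V × ℝ}
    (h : saddle (B + τ • K) p (w + (τ • K) W) z = (y, m)) :
    saddle B p w z = (y - τ • K z.1, m - τ * inner ℝ (K W) z.1) := by
  rw [saddle_apply, Prod.mk.injEq] at h
  rw [saddle_apply, ← h.1, ← h.2, inner_add_left, ContinuousLinearMap.smul_apply,
    real_inner_smul_left, add_sub_cancel_right, ContinuousLinearMap.add_apply,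
    ContinuousLinearMap.smul_apply, sub_right_comm, add_sub_cancel_right]

/-- The distance of the solutions of two problems with nearby operators. -/
theorem norm_sub_le_of_step {N ε τ σ δ μ : ℝ} {Φ Φ' : V × ℝ →L[ℝ] V × ℝ} {A A' K K' : V →L[ℝ] V}
    {v v₁ r r₁ W : V} {z z₀ : V × ℝ} (hN : 1 ≤ N) (hε : 0 ≤ ε) (hε1 : ε ≤ 1) (hτ : 0 ≤ τ)
    (hτε : τ ≤ ε) (hτN : 12 * N ^ 3 * τ ≤ 1) (hΦ : ‖Φ‖ ≤ N) (hΦ' : ‖Φ'‖ ≤ N) (hA : ‖A‖ ≤ N)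
    (hK' : ‖K'‖ ≤ N) (hW : ‖W‖ ≤ N) (hv : ‖v‖ ≤ N) (hr : ‖r₁ - r‖ ≤ N * ‖v₁ - v‖)
    (hy : ‖r - A v - K v‖ ≤ N) (dΦ : ‖Φ' - Φ‖ ≤ ε) (dA : ‖A' - A‖ ≤ ε) (dK : ‖K' - K‖ ≤ ε)
    (hσ : 0 ≤ σ) (hστ : σ ≤ τ)
    (hz : z = Φ' (r₁ - A' v₁ - K' v₁ - τ • K' z.1, δ - τ * inner ℝ (K' W) z.1))
    (hz₀ : z₀ = Φ (r - A v - K v, μ)) :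
    ‖z - z₀‖ ≤ 18 * N ^ 5 * (‖v₁ + σ • z.1 - v‖ + ε * (1 + |μ|) + |δ - μ|) := by
  have hN0 : 0 ≤ N := zero_le_one.trans hN
  have hKx : ‖K' z.1‖ ≤ N * ‖z.1‖ := K'.le_of_opNorm_le hK' _
  have hKW : |inner ℝ (K' W) z.1| ≤ N * N * ‖z.1‖ :=
    (abs_real_inner_le_norm _ _).trans (mul_le_mul_of_nonneg_right
      ((K'.le_of_opNorm_le hK' _).trans (mul_le_mul_of_nonneg_left hW hN0)) (norm_nonneg _))
  refine le_of_step_bounds (X := ‖z.1‖) (q := ‖v₁ - v‖)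
    (R := ‖(r₁ - A' v₁ - K' v₁) - (r - A v - K v)‖) hN hε hτ hτε hτN (norm_nonneg _)
    (norm_nonneg _) (norm_nonneg _) (abs_nonneg _) (abs_nonneg _) ?_ ?_ ?_ ?_
  -- `v₁` is the value at the left node and `v₁ + σ • z.1` the piecewise linear function at time
  -- `s`; they differ by at most `τ ‖z.1‖`.
  · have h1 : v₁ - v = (v₁ + σ • z.1 - v) - σ • z.1 := by abel
    rw [h1]
    refine (norm_sub_le _ _).trans ?_
    rw [norm_smul, Real.norm_of_nonneg hσ]
    gcongr
  · have h1 : (r₁ - A' v₁ - K' v₁) - (r - A v - K v) =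
        (r₁ - r) - (A (v₁ - v) + (A' - A) (v₁ - v) + (A' - A) v) - (K' (v₁ - v) + (K' - K) v) := by
      simp only [map_sub, ContinuousLinearMap.sub_apply]
      abel
    have h2 : ‖A (v₁ - v) + (A' - A) (v₁ - v) + (A' - A) v‖ ≤
        N * ‖v₁ - v‖ + ε * ‖v₁ - v‖ + ε * N :=
      norm_add₃_le.trans (add_le_add (add_le_add (A.le_of_opNorm_le hA _)
        ((A' - A).le_of_opNorm_le dA _))
        (((A' - A).le_of_opNorm_le dA _).trans (mul_le_mul_of_nonneg_left hv hε)))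
    have h3 : ‖K' (v₁ - v) + (K' - K) v‖ ≤ N * ‖v₁ - v‖ + ε * N :=
      (norm_add_le _ _).trans (add_le_add (K'.le_of_opNorm_le hK' _)
        (((K' - K).le_of_opNorm_le dK _).trans (mul_le_mul_of_nonneg_left hv hε)))
    have h4 : ε * ‖v₁ - v‖ ≤ N * ‖v₁ - v‖ :=
      mul_le_mul_of_nonneg_right (hε1.trans hN) (norm_nonneg _)
    rw [h1]
    refine ((norm_sub_le _ _).trans (add_le_add (norm_sub_le _ _) le_rfl)).trans ?_
    linarith
  -- Perturbation of the data under the discrete operator, plus perturbation of the operator on the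
  -- exact data.
  · have h1 : z - z₀ = Φ' ((r₁ - A' v₁ - K' v₁) - (r - A v - K v) - τ • K' z.1,
        (δ - μ) - τ * inner ℝ (K' W) z.1) + (Φ' - Φ) (r - A v - K v, μ) := by
      rw [ContinuousLinearMap.sub_apply, ← hz₀, ← add_sub_assoc, ← map_add, Prod.mk_add_mk]
      conv_lhs => rw [hz]
      congr 3
      · abel
      · ring
    rw [h1]
    refine (norm_add_le _ _).trans (add_le_add ?_ ?_)
    · refine (Φ'.le_of_opNorm_le hΦ' _).trans (mul_le_mul_of_nonneg_left ?_ hN0)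
      refine (norm_prod_mk_le _ _).trans ?_
      have h2 : ‖τ • K' z.1‖ ≤ τ * (N * ‖z.1‖) := by
        rw [norm_smul, Real.norm_of_nonneg hτ]
        exact mul_le_mul_of_nonneg_left hKx hτ
      have h3 : |τ * inner ℝ (K' W) z.1| ≤ τ * (N * N * ‖z.1‖) := by
        rw [abs_mul, abs_of_nonneg hτ]
        exact mul_le_mul_of_nonneg_left hKW hτ
      have h4 := norm_sub_le ((r₁ - A' v₁ - K' v₁) - (r - A v - K v)) (τ • K' z.1)
      have h5 := abs_sub (δ - μ) (τ * inner ℝ (K' W) z.1)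
      linarith
    · refine ((Φ' - Φ).le_of_opNorm_le dΦ _).trans (mul_le_mul_of_nonneg_left ?_ hε)
      exact (norm_prod_mk_le _ _).trans (by linarith)
  · have h1 : ‖z₀‖ ≤ N * (N + |μ|) := by
      rw [hz₀]
      exact (Φ.le_of_opNorm_le hΦ _).trans (mul_le_mul_of_nonneg_left
        ((norm_prod_mk_le _ _).trans (by linarith)) hN0)
    have h2 := norm_sub_norm_le z z₀
    have h3 := norm_fst_le z
    linarith

/-- A difference quotient is close to the derivative. -/
theorem norm_smul_sub_sub_le {F : Type*} [NormedAddCommGroup F] [NormedSpace ℝ F] {a b s T ε : ℝ}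
    {z dz : ℝ → F} (hab : a < b) (hsub : Icc a b ⊆ Icc 0 T)
    (hz : ∀ t ∈ Icc 0 T, HasDerivWithinAt z (dz t) (Icc 0 T) t)
    (hε : ∀ r ∈ Icc a b, ‖dz r - dz s‖ ≤ ε) :
    ‖(b - a)⁻¹ • (z b - z a) - dz s‖ ≤ ε := by
  have hba : 0 < b - a := sub_pos.2 hab
  have h1 : ∀ r ∈ Icc a b,
      HasDerivWithinAt (fun r => z r - r • dz s) (dz r - dz s) (Icc a b) r := by
    intro r hr
    have h2 := ((hasDerivWithinAt_id r (Icc a b)).smul_const (dz s))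
    rw [one_smul] at h2
    exact ((hz r (hsub hr)).mono hsub).sub h2
  have h2 := (convex_Icc a b).norm_image_sub_le_of_norm_hasDerivWithin_le h1 hε
    (left_mem_Icc.2 hab.le) (right_mem_Icc.2 hab.le)
  have h3 : (b - a)⁻¹ • (z b - z a) - dz s =
      (b - a)⁻¹ • ((z b - b • dz s) - (z a - a • dz s)) := by
    rw [sub_sub_sub_comm, ← sub_smul, smul_sub (b - a)⁻¹ (z b - z a), smul_smul,
      inv_mul_cancel₀ hba.ne', one_smul]
  rw [h3, norm_smul, norm_inv, Real.norm_of_nonneg hba.le, inv_mul_le_iff₀ hba, mul_comm]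
  rwa [Real.norm_of_nonneg hba.le] at h2

end Estimate

namespace Data

variable {D : Data d}

theorem eventually_norm_sub_le (hT : 0 < D.T) {F : Type*} [NormedAddCommGroup F] {c : ℝ → F}
    (hc : ContinuousOn c (Icc 0 D.T)) {ε : ℝ} (hε : 0 < ε) :
    ∀ᶠ n in atTop, ∀ r ∈ Icc 0 D.T, ∀ s ∈ Icc 0 D.T, |r - s| ≤ D.step n →
      ‖c r - c s‖ ≤ ε := by
  simpa only [dist_eq_norm] using D.eventually_dist_le hT hc hε

theorem inner_massOp_diffQuot (n : ℕ) (a b : LInf D.Ω) (u v φ : H10 D.Ω) :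
    inner ℝ (massOp D.Ω ((D.step n)⁻¹ • (b - a)) u + massOp D.Ω b ((D.step n)⁻¹ • (v - u))) φ =
      ∫ x in D.Ω, (b x * val v x - a x * val u x) / D.step n * val φ x := by
  have e := apply_smul_sub_add (massOp D.Ω) (D.step n)⁻¹ a b u v
  rw [e, real_inner_smul_left, inner_sub_left, inner_massOp', inner_massOp', ← inner_sub_left,
    L2.inner_def, ← integral_const_mul]
  refine integral_congr_ae ?_
  filter_upwards [Lp.coeFn_sub (mulOp D.Ω ℝ b (val v)) (mulOp D.Ω ℝ a (val u)),
    coeFn_mulOp b (val v), coeFn_mulOp a (val u)] with x h1 h2 h3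
  rw [h1, Pi.sub_apply, h2, h3, div_eq_inv_mul, mul_assoc]
  exact congrArg _ (mul_comm _ _)

namespace Assumptions

variable (hD : D.Assumptions)
include hD

/-- The scheme is a recursion: each step is one bordered system for the pair of difference quotient
and source, with data depending on the previous value. -/
theorem isDiscrete_iff {n : ℕ} (hn : 0 < n) {U : ℕ → H10 D.Ω} {H : ℕ → ℝ} :
    D.IsDiscrete n U H ↔ U 0 = D.u0 ∧ ∀ i < n,
      D.sourceOp (D.step n) (D.node n (i + 1)) (D.diffQuot n U i, H (i + 1)) =
        (residual hD (D.diffQuot n (fun j => D.ρ (D.node n j)) i) (D.node n (i + 1)) (U i),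
          D.diffQuot n (fun j => D.m (D.node n j)) i) := by
  have key : ∀ i < n, _ ↔ _ := fun i hi =>
    sourceOp_eq_iff hD (node_mem hD.T_pos hn (Nat.succ_le_of_lt hi)) (D.step n)
      (D.diffQuot n (fun j => D.ρ (D.node n j)) i) (U i) (D.diffQuot n U i) (H (i + 1))
      (D.diffQuot n (fun j => D.m (D.node n j)) i)
  have hstep : ∀ i, U i + D.step n • D.diffQuot n U i = U (i + 1) := fun i => by
    rw [D.diffQuot_smul_step hD.T_pos hn, add_sub_cancel]
  have hlhs : ∀ i (φ : H10 D.Ω),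
      inner ℝ (massOp D.Ω (D.diffQuot n (fun j => D.ρ (D.node n j)) i) (U i) +
            massOp D.Ω (D.ρ (D.node n (i + 1))) (D.diffQuot n U i)) φ
          + inner ℝ (stiffOp D.Ω (D.η (D.node n (i + 1))) (D.diffQuot n U i)) φ
          + inner ℝ (stiffOp D.Ω (D.κ (D.node n (i + 1)))
              (U i + D.step n • D.diffQuot n U i)) φ =
        (∫ x in D.Ω, (D.ρ (D.node n (i + 1)) x * val (U (i + 1)) x
          - D.ρ (D.node n i) x * val (U i) x) / D.step n * val φ x)
        + (∫ x in D.Ω, D.η (D.node n (i + 1)) x *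
          inner ℝ (grad (D.diffQuot n U i) x) (grad φ x))
        + (∫ x in D.Ω, D.κ (D.node n (i + 1)) x * inner ℝ (grad (U (i + 1)) x) (grad φ x)) := by
    intro i φ
    rw [hstep]
    exact congrArg₂ (· + ·) (congrArg₂ (· + ·) (inner_massOp_diffQuot n _ _ _ _ _)
      (inner_stiffOp _ _ _)) (inner_stiffOp _ _ _)
  constructor
  · intro h
    refine ⟨h.init, fun i hi => (key i hi).2 ⟨fun φ => ?_, h.source i hi⟩⟩
    exact (hlhs i φ).trans (h.eqn i hi φ)
  · rintro ⟨h0, h⟩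
    exact ⟨h0, fun i hi φ => (hlhs i φ).symm.trans (((key i hi).1 (h i hi)).1 φ),
      fun i hi => ((key i hi).1 (h i hi)).2⟩

theorem exists_isDiscrete {n : ℕ} (hn : 0 < n) : ∃ U H, D.IsDiscrete n U H := by
  set Z : ℕ → H10 D.Ω → H10 D.Ω × ℝ := fun i v =>
    Ring.inverse (D.sourceOp (D.step n) (D.node n (i + 1)))
      (residual hD (D.diffQuot n (fun j => D.ρ (D.node n j)) i) (D.node n (i + 1)) v,
        D.diffQuot n (fun j => D.m (D.node n j)) i) with hZ
  set U : ℕ → H10 D.Ω := fun i => Nat.rec D.u0 (fun i v => v + D.step n • (Z i v).1) i with hU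
  have hτ := step_pos hD.T_pos hn
  have hq : ∀ i, D.diffQuot n U i = (Z i (U i)).1 := fun i => by
    have h1 : U (i + 1) = U i + D.step n • (Z i (U i)).1 := rfl
    rw [diffQuot, h1, add_sub_cancel_left, smul_smul, inv_mul_cancel₀ hτ.ne', one_smul]
  -- The shift places the source of step `i` at index `i + 1`; the value at index 0 plays no role.
  refine ⟨U, fun i => (Z (i - 1) (U (i - 1))).2, (hD.isDiscrete_iff hn).2 ⟨rfl, fun i hi => ?_⟩⟩
  rw [hq, Nat.add_sub_cancel, Prod.mk.eta]
  exact DFunLike.congr_fun (Ring.mul_inverse_cancel _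
    (hD.isUnit_sourceOp (node_mem hD.T_pos hn (Nat.succ_le_of_lt hi)) hτ.le)) _

theorem isDiscrete_unique {n : ℕ} (hn : 0 < n) {U U₂ : ℕ → H10 D.Ω} {H H₂ : ℕ → ℝ}
    (h : D.IsDiscrete n U H) (h₂ : D.IsDiscrete n U₂ H₂) :
    (∀ i ≤ n, U₂ i = U i) ∧ ∀ i < n, H₂ (i + 1) = H (i + 1) := by
  rw [hD.isDiscrete_iff hn] at h h₂
  have hτ := step_pos hD.T_pos hn
  have hstep : ∀ i < n, U₂ i = U i →
      (D.diffQuot n U₂ i, H₂ (i + 1)) = (D.diffQuot n U i, H (i + 1)) := by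
    intro i hi he
    have hu := hD.isUnit_sourceOp (node_mem hD.T_pos hn (Nat.succ_le_of_lt hi)) hτ.le
    refine (ContinuousLinearMap.isUnit_iff_bijective.1 hu).1 ?_
    rw [h.2 i hi, h₂.2 i hi, he]
  have hU : ∀ i ≤ n, U₂ i = U i := by
    intro i
    induction i with
    | zero => exact fun _ => h₂.1.trans h.1.symm
    | succ i ih =>
      intro hi
      have h1 := ih (Nat.le_of_succ_le hi)
      have h2 := congrArg (fun z => D.step n • z.1) (hstep i hi h1)
      simp only [D.diffQuot_smul_step hD.T_pos hn, h1] at h2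
      exact sub_left_injective h2
  exact ⟨hU, fun i hi => congrArg Prod.snd (hstep i hi (hU i hi.le))⟩

theorem eq_solveOp_of_sourceOp_eq {τ t : ℝ} (ht : t ∈ Icc 0 D.T) {z : H10 D.Ω × ℝ} {y : H10 D.Ω}
    {m : ℝ} (h : D.sourceOp τ t z = (y, m)) :
    z = D.solveOp t (y - τ • stiffOp D.Ω (D.κ t) z.1,
      m - τ * inner ℝ (stiffOp D.Ω (D.κ t) (D.weightElt t)) z.1) := by
  rw [← hD.sourceOp_eq_iff_eq_solveOp ht, hD.sourceOp_zero t]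
  exact saddle_eq_of_saddle_add_eq h

/-- At time `s` in a cell, the exact pair is the solution operator at `s` applied to the exact data,
and the discrete pair is the one at the right node applied to perturbed data. Uniform continuity of
the operators at the scale of the step bounds their difference. -/
theorem rotheConverges {U : ℕ → ℕ → H10 D.Ω} {H : ℕ → ℕ → ℝ}
    (hUH : ∀ n : ℕ, 0 < n → D.IsDiscrete n (U n) (H n)) {u ut : ℝ → H10 D.Ω} {h : ℝ → ℝ}
    (hu : D.IsWeakSolution u ut h) : D.RotheConverges U H u ut h := by
  have hfin := hD.isFiniteMeasure
  obtain ⟨u1, u2, u3, u4, u5⟩ := hD.isWeakSolution_iff.1 hu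
  have hm := hD.hasL2TimeDeriv_m
  obtain ⟨N₀, hN₀, hL₀, hb₀⟩ := hD.exists_bound
  obtain ⟨C₁, hC₁⟩ := exists_norm_le u1
  obtain ⟨C₂, hC₂⟩ := exists_norm_le (hD.continuousOn_residual u1)
  obtain ⟨B, hB0, hB⟩ := exists_norm_apply_le (massOp D.Ω)
  have m0 : (0 : ℝ) ∈ Icc 0 D.T := left_mem_Icc.2 hD.T_pos.le
  have p1 := (norm_nonneg _).trans (hC₁ 0 m0)
  have p2 := (norm_nonneg _).trans (hC₂ 0 m0)
  -- A common bound for the operators, the solution and the residual along it.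
  set N := N₀ + C₁ + C₂ with hNdef
  have hNN : N₀ ≤ N := by linarith
  have hN : 1 ≤ N := hN₀.trans hNN
  have hN0 : 0 < N := zero_lt_one.trans_le hN
  set C := 18 * N ^ 5 with hC
  have hC0 : 0 < C := by positivity
  refine D.rotheConverges_of_estimate hD.T_pos hm.1 u1 u2 u4
    (fun n hn => (hUH n hn).init.trans u3.symm) hC0.le fun ε' hε' => ?_
  -- The first entry compensates the constant of the step estimate; the bound by 1 serves to absorb
  -- products of `ε` with the error.
  set ε := min (ε' / C) 1 with hεdef
  have hε : 0 < ε := lt_min (by positivity) one_pos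
  have hCε : C * ε ≤ ε' := by
    rw [← le_div_iff₀' hC0]
    exact min_le_left _ _
  have e1 := eventually_norm_sub_le hD.T_pos (F := H10 D.Ω × ℝ →L[ℝ] H10 D.Ω × ℝ)
    hD.continuousOn_solveOp hε
  have e2 := eventually_norm_sub_le hD.T_pos hD.continuousOn_dρ (div_pos hε hB0)
  have e3 := eventually_norm_sub_le hD.T_pos (F := H10 D.Ω →L[ℝ] H10 D.Ω)
    hD.continuousOn_stiffOp_κ hε
  have e4 : ∀ᶠ n in atTop, D.step n < ε := D.tendsto_step.eventually_lt_const hε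
  have e5 : ∀ᶠ n in atTop, D.step n < (12 * N ^ 3)⁻¹ :=
    D.tendsto_step.eventually_lt_const (by positivity)
  filter_upwards [e1, e2, e3, e4, e5, eventually_gt_atTop 0] with n e1 e2 e3 e4 e5 hn
  filter_upwards [u5, ae_restrict_mem measurableSet_Ioo] with s hs hsT
  have hτ := step_pos hD.T_pos hn
  have hsI := Ioo_subset_Icc_self hsT
  obtain ⟨i, hi, hsi, hidx⟩ := exists_index hD.T_pos hn ⟨hsT.1, hsT.2.le⟩
  have ht' := node_mem hD.T_pos hn (Nat.succ_le_of_lt hi)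
  have hti := node_mem hD.T_pos hn hi.le
  have hsucc := D.node_succ (n := n) i
  have hdist : ∀ r ∈ Icc (D.node n i) (D.node n (i + 1)), |r - s| ≤ D.step n := fun r hr => by
    rw [abs_le]
    constructor <;> linarith [hr.1, hr.2, hsi.1, hsi.2]
  have hlt := node_lt_succ hD.T_pos hn i
  have hd' := hdist _ (right_mem_Icc.2 hlt.le)
  obtain ⟨b1, b2, b3, b4⟩ := hb₀ s hsI
  obtain ⟨b1', b2', b3', b4'⟩ := hb₀ _ ht'
  have dΦ := e1 _ ht' s hsI hd'
  have dK := e3 _ ht' s hsI hd'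
  have hsub : Icc (D.node n i) (D.node n (i + 1)) ⊆ Icc 0 D.T := Icc_subset_Icc hti.1 ht'.2
  -- `δρ` is compared with `∂_t ρ` at `s` by the mean value inequality, uniformly over the cell.
  have dρ := norm_smul_sub_sub_le (s := s) hlt hsub (fun t ht => hD.hasDerivWithinAt_ρ ht)
    (fun r hr => e2 r (hsub hr) s hsI (hdist r hr))
  have dA : ‖massOp D.Ω (D.diffQuot n (fun j => D.ρ (D.node n j)) i) - massOp D.Ω (D.dρ s)‖ ≤
      ε := by
    rw [← map_sub]
    refine (hB _).trans ?_
    rw [← le_div_iff₀' hB0]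
    rw [hsucc, add_sub_cancel_left, ← hsucc] at dρ
    exact dρ
  have hdisc := ((hD.isDiscrete_iff hn).1 (hUH n hn)).2 i hi
  have hz := hD.eq_solveOp_of_sourceOp_eq ht' hdisc
  have hr : ‖reaction hD.f_lip (U n i) - reaction hD.f_lip (u s)‖ ≤ N * ‖U n i - u s‖ :=
    (norm_reaction_sub_le hD.f_lip _ _).trans
      (mul_le_mul_of_nonneg_right (hL₀.trans hNN) (norm_nonneg _))
  have main := norm_sub_le_of_step (σ := s - D.node n i) hN hε.le (min_le_right _ _) hτ.le e4.le
    (by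
      rw [lt_inv_comm₀ hτ (by positivity)] at e5
      have := mul_le_mul_of_nonneg_right e5.le hτ.le
      rwa [inv_mul_cancel₀ hτ.ne'] at this)
    (b1.trans hNN) (b1'.trans hNN) (b2.trans hNN) (b3'.trans hNN) (b4'.trans hNN)
    ((hC₁ s hsI).trans (by linarith)) hr ((hC₂ s hsI).trans (by linarith)) dΦ dA dK
    (sub_nonneg.2 hsi.1.le) (by linarith [hsi.2]) hz hs
  have hlin := D.rotheLinear_eq hD.T_pos hn (U n) hsi
  have havg := D.diffQuot_eq_average hD.T_pos hm hn hi
  have hfinal : ‖((D.diffQuot n (U n) i, H n (i + 1)) : H10 D.Ω × ℝ) - (ut s, h s)‖ ≤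
      C * ‖D.rotheLinear n (U n) s - u s‖ + (ε' * (1 + |timeDeriv D.T D.m s|) +
        C * |D.average n (timeDeriv D.T D.m) (D.index n s) - timeDeriv D.T D.m s|) := by
    rw [hlin, hidx, ← havg]
    refine main.trans ?_
    rw [mul_add, mul_add, ← mul_assoc, add_assoc]
    gcongr
  rw [rotheDeriv, rotheConst, hidx, Nat.add_sub_cancel]
  rw [hidx] at hfinal
  exact ⟨(norm_fst_le _).trans hfinal, (norm_snd_le _).trans hfinal⟩

end Assumptions
end Data
end PseudoParabolic

theorem mainTheorem1 {d : ℕ} (D : Data d) (hD : D.Assumptions) :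
    ∃ (u ut : ℝ → H10 D.Ω) (h : ℝ → ℝ),
      D.IsWeakSolution u ut h ∧
      (∀ (v vt : ℝ → H10 D.Ω) (g : ℝ → ℝ), D.IsWeakSolution v vt g →
        EqOn v u (Icc 0 D.T) ∧ g =ᵐ[volume.restrict (Ioo 0 D.T)] h) ∧
      (∀ (v vt : ℝ → H10 D.Ω) (g : ℝ → ℝ), D.IsMeasuredSolution v vt g ↔
        D.IsWeakSolution v vt g ∧ ∫ x in D.Ω, val D.u0 x * val D.ω x = D.m 0) ∧
      (∀ n : ℕ, 0 < n → ∃ (U : ℕ → H10 D.Ω) (H : ℕ → ℝ), D.IsDiscrete n U H ∧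
        ∀ (U₂ : ℕ → H10 D.Ω) (H₂ : ℕ → ℝ), D.IsDiscrete n U₂ H₂ →
          (∀ i ≤ n, U₂ i = U i) ∧ ∀ i < n, H₂ (i + 1) = H (i + 1)) ∧
      (∀ (U : ℕ → ℕ → H10 D.Ω) (H : ℕ → ℕ → ℝ), (∀ n : ℕ, 0 < n → D.IsDiscrete n (U n) (H n)) →
        D.RotheConverges U H u ut h) := by
  obtain ⟨u, ut, h, hu⟩ := hD.exists_isWeakSolution
  refine ⟨u, ut, h, hu, fun v vt g hv => hD.isWeakSolution_unique hu hv,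
    fun v vt g => hD.isMeasuredSolution_iff, fun n hn => ?_,
    fun U H hUH => hD.rotheConverges hUH hu⟩
  obtain ⟨U, H, hUH⟩ := hD.exists_isDiscrete hn
  exact ⟨U, H, hUH, fun U₂ H₂ h₂ => hD.isDiscrete_unique hn hUH h₂⟩
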